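/- **Setting.** Let $\mathbb E=\mathbb R^d\times\{1,\dots,m\}$ be the space of coloured points, on which $\mathbb R^d$ acts by $t+(x,i)=(t+x,i)$. Let $\ell$ be Lebesgue measure on $\mathbb R^d$ and $C_R$ the open cube of edge length $R$ centred at $0$. Let $M_p$ be the set of positive Borel measures $\lambda$ on $\mathbb E$ with $\lambda(A)\in\mathbb N=\{0,1,2,\dots\}$ for all relatively compact Borel sets $A$, with the vague topology (the coarsest one making $\lambda\mapsto\lambda(f)$ continuous for all $f\in C_c(\mathbb E)$), its Borel $\sigma$-algebra, and the translation action $(T_t\lambda)(A)=\lambda(-t+A)$. For $\lambda\in M_p$ let $\lambda^i(A)=\lambda(A\times\{i\})$ for Borel sets $A\subset\mathbb R^d$. Let $\xi:(\Omega,\mathcal A,P)\to M_p$ be a point process (a measurable map from a probability space) with law $\mu=\xi(P)$ and let $X\subset M_p$ be the support of $\mu$. Assume that * for some $r>0$, every $\lambda\in X$ satisfies $\lambda\big((a+C_r)\times\{1,\dots,m\}\big)\le 1$ for all $a\in\mathbb R^d$; * $\mu$ is translation invariant and ergodic; * every colour has positive intensity: $\int_X\lambda^i(C_1)\,d\mu(\lambda)>0$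 for $i=1,\dots,m$. Let $w=(w_1,\dots,w_m)\in\mathbb R^m$ and put $\lambda^w=\sum_{i}w_i\lambda^i$. The $w$-weighted Palm measure is the signed measure $$\dot\mu^w(D)=\frac1{\ell(B)}\int_X\sum_{x\in B}\lambda^w(\{x\})\,\mathbf 1_D(T_{-x}\lambda)\,d\mu(\lambda),$$ where $B$ is any bounded Borel set of positive Lebesgue measure (the value does not depend on $B$; for instance $B=C_1$). Its weighted first moment is $\dot\mu^w_1(f)=\int_X\lambda^w(f)\,d\dot\mu^w(\lambda)$. By a (complex) Radon measure on $\mathbb R^d$ we mean a linear functional on $C_c(\mathbb R^d)$ that is bounded in the sup norm on the functions supported in any given compact set. The $w$-weighted autocorrelation of $\lambda$ is, if it exists, the vague limit $$\gamma^w_\lambda=\lim_{R\to\infty}\frac1{\ell(C_R)}\,\lambda^w|_{C_R}*\widetilde{\lambda^w|_{C_R}},$$ that is, $\gamma^w_\lambda(f)=\lim_{R\to\infty}\ell(C_R)^{-1}\sum_{x,y\in C_R}\lambda^w(\{x\})\lambda^w(\{y\})f(x-y)$ for all $f\in C_c(\mathbb R^d)$. **Theorem.** 1. $\dot\mu^w_1$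 is a Radon measure on $\mathbb R^d$, and it is positive definite: $\dot\mu^w_1(g*\tilde g)\ge 0$ for all $g\in C_c(\mathbb R^d)$, where $\tilde g(x)=\overline{g(-x)}$. 2. $\dot\mu^w_1$ is Fourier transformable and its transform is a positive translation bounded measure: there is a positive Borel measure $\sigma$ on $\mathbb R^d$ with $\sup_{t\in\mathbb R^d}\sigma(t+K)<\infty$ for all compact $K$ such that $\sigma(f)=\dot\mu^w_1(\hat f)$ for all Schwartz functions $f$, all integrals being absolutely convergent; here $\hat f(k)=\int f(x)e^{-2\pi i k\cdot x}\,dx$. 3. For $\mu$-almost every $\lambda$, the $w$-weighted autocorrelation $\gamma^w_\lambda$ exists and $\gamma^w_\lambda=\dot\mu^w_1$. 4. If $X$ is uniquely ergodic (that is, $\mu$ is the only translation invariant Borel probability measure on $X$), then $\gamma^w_\lambda$ exists and equals $\dot\mu^w_1$ for every $\lambda\in X$. 5. In the one-colour unweighted case ($m=1$, $w_1=1$), $\dot\mu^w_1$ is moreover a positive translation bounded measure. -/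

import Mathlib

open MeasureTheory Filter Topology
open scoped CompactlySupported SchwartzMap FourierTransform ENNReal

noncomputable section

namespace PointProcess

/-- The ambient Euclidean space `ℝ^d`. -/
abbrev Space (d : ℕ) : Type := EuclideanSpace ℝ (Fin d)

/-- The space `ℝ^d × {1, …, m}` of coloured points. -/
abbrev ColSpace (d m : ℕ) : Type := Space d × Fin m

/-- The open cube `C_R` of edge length `R` about `0`. -/
def cube (d : ℕ) (R : ℝ) : Set (Space d) := {x | ∀ i, |x i| < R / 2}

/-- Point measures on `ℝ^d × {1, …, m}`: positive Borel measures taking values in `ℕ`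
on all relatively compact Borel sets. -/
def PointMeasure (d m : ℕ) : Type :=
  {lam : Measure (ColSpace d m) //
    ∀ A, MeasurableSet A → IsCompact (closure A) → ∃ n : ℕ, lam A = n}

variable {d m : ℕ}

/-- The vague topology: the coarsest one making `λ ↦ λ(f)` continuous for all continuous
compactly supported `f` (real-valued `f` suffice). -/
instance : TopologicalSpace (PointMeasure d m) :=
  TopologicalSpace.induced (fun lam (f : C_c(ColSpace d m, ℝ)) => ∫ p, f p ∂lam.1) inferInstance

instance : MeasurableSpace (PointMeasure d m) := borel _

instance : BorelSpace (PointMeasure d m) := ⟨rfl⟩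

/-- Translation on coloured points. -/
def shift (m : ℕ) (t : Space d) : ColSpace d m ≃ₜ ColSpace d m :=
  (Homeomorph.addLeft t).prodCongr (Homeomorph.refl (Fin m))

/-- Translation of point measures, `(T_t λ)(A) = λ(-t + A)`. -/
def translate (t : Space d) (lam : PointMeasure d m) : PointMeasure d m :=
  ⟨lam.1.map (shift m t), fun A hA hc => by
    rw [Measure.map_apply (shift m t).continuous.measurable hA]
    refine lam.2 _ ((shift m t).continuous.measurable hA) ?_
    rw [← (shift m t).preimage_closure]
    exact (shift m t).isCompact_preimage.2 hc⟩

/-- The action of `ℝ^d` by translation: `t +ᵥ λ = T_t λ`. -/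
instance : AddAction (Space d) (PointMeasure d m) where
  vadd := translate
  zero_vadd lam := by
    apply Subtype.ext
    change lam.1.map (shift m 0) = lam.1
    have : (shift m (0 : Space d) : ColSpace d m → ColSpace d m) = id := by
      funext p
      change ((0 : Space d) + p.1, p.2) = p
      rw [zero_add]
    rw [this, Measure.map_id]
  add_vadd s t lam := by
    apply Subtype.ext
    change lam.1.map (shift m (s + t)) = (lam.1.map (shift m t)).map (shift m s)
    rw [Measure.map_map (shift m s).continuous.measurable (shift m t).continuous.measurable]
    congr 1
    funext p
    change ((s + t) + p.1, p.2) = (s + (t + p.1), p.2)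
    rw [add_assoc]

/-- The restriction `λ^i` of `λ` to the colour `i`, as a measure on `ℝ^d`:
`λ^i(A) = λ(A × {i})`. -/
def comp (i : Fin m) (lam : PointMeasure d m) : Measure (Space d) :=
  (lam.1.restrict (Prod.snd ⁻¹' {i})).map Prod.fst

/-- The intensity `I^(i)` of the points of colour `i`: the expected number of them in a set of
Lebesgue measure one, here the unit cube. -/
def intensity (μ : Measure (PointMeasure d m)) (i : Fin m) : ℝ≥0∞ :=
  ∫⁻ lam, comp i lam (cube d 1) ∂μ

/-- The law `μ` belongs to a uniformly discrete, stationary, ergodic point process in which every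
colour has positive intensity. -/
structure IsUniformlyDiscreteErgodic (μ : Measure (PointMeasure d m)) : Prop where
  /-- For some `r > 0`, every configuration in the support of `μ` has at most one point (of any
  colour) in each translate of `C_r`. -/
  uniformlyDiscrete : ∃ r : ℝ, 0 < r ∧ ∀ lam ∈ μ.support, ∀ a : Space d,
    lam.1 (((fun x => a + x) '' cube d r) ×ˢ Set.univ) ≤ 1
  /-- `μ` is invariant under translations (this is part of `ErgodicVAdd`) and ergodic. -/
  ergodic : ErgodicVAdd (Space d) (PointMeasure d m) μ
  intensity_pos : ∀ i, 0 < intensity μ i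

/-- Unique ergodicity of the translation action on `X = supp μ`: `μ` is the only translation
invariant Borel probability measure on `X`. -/
def IsUniquelyErgodic (μ : Measure (PointMeasure d m)) : Prop :=
  ∀ ν : Measure (PointMeasure d m), IsProbabilityMeasure ν →
    VAddInvariantMeasure (Space d) (PointMeasure d m) ν → ν μ.supportᶜ = 0 → ν = μ

/-- `N^w_f(λ) = λ^w(f)`, where `λ^w = ∑ i, w i • λ^i`. -/
def count (w : Fin m → ℝ) (f : Space d → ℂ) (lam : PointMeasure d m) : ℂ :=
  ∑ i, (w i : ℂ) * ∫ x, f x ∂(comp i lam)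

/-- The Palm measure of the points of colour `i`,
`D ↦ ℓ(B)⁻¹ ∫ ∑_{x ∈ B} λ^i({x}) 1_D(T_{-x} λ) dμ(λ)`, with the unit cube as `B`. -/
def palm (μ : Measure (PointMeasure d m)) (i : Fin m) : Measure (PointMeasure d m) :=
  μ.bind fun lam => ((comp i lam).restrict (cube d 1)).map fun x : Space d => (-x) +ᵥ lam

/-- The integral of `F` against the `w`-weighted Palm measure. That signed measure is defined by
`ℓ(B)⁻¹ ∫ ∑_{x ∈ B} λ^w({x}) 1_D(T_{-x} λ) dμ(λ)`, which is linear in `w`, so that it is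
`∑ i, w i • palm μ i`. -/
def weightedPalm (μ : Measure (PointMeasure d m)) (w : Fin m → ℝ) (F : PointMeasure d m → ℂ) : ℂ :=
  ∑ i, (w i : ℂ) * ∫ lam, F lam ∂(palm μ i)

/-- The weighted first moment of the weighted Palm measure, evaluated at `f`. -/
def weightedMoment (μ : Measure (PointMeasure d m)) (w : Fin m → ℝ) (f : Space d → ℂ) : ℂ :=
  weightedPalm μ w (count w f)

/-- Absolute convergence of the integrals in `weightedMoment μ w f`, for all `w`. -/
def MomentIntegrable (μ : Measure (PointMeasure d m)) (f : Space d → ℂ) : Prop :=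
  ∀ i j : Fin m, ∫⁻ lam, ∫⁻ x, ‖f x‖ₑ ∂(comp j lam) ∂(palm μ i) < ∞

/-- `Φ` is a (complex Radon) measure on `ℝ^d`: a linear functional on the continuous compactly
supported functions, bounded in the sup norm on those supported in a given compact set. -/
structure IsRadonMeasure (Φ : (Space d → ℂ) → ℂ) : Prop where
  map_add : ∀ f g : C_c(Space d, ℂ), Φ (fun x => f x + g x) = Φ f + Φ g
  map_smul : ∀ (c : ℂ) (f : C_c(Space d, ℂ)), Φ (fun x => c * f x) = c * Φ f
  bounded : ∀ K : Set (Space d), IsCompact K → ∃ C : ℝ, ∀ f : C_c(Space d, ℂ), tsupport f ⊆ K →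
    ∀ M : ℝ, (∀ x, ‖f x‖ ≤ M) → ‖Φ f‖ ≤ C * M

/-- `Φ(g * g̃) ≥ 0` for all continuous compactly supported `g`,
where `g̃(x)` is the conjugate of `g(-x)`. -/
def IsPositiveDefinite (Φ : (Space d → ℂ) → ℂ) : Prop :=
  ∀ g : C_c(Space d, ℂ), ∃ c : ℝ, 0 ≤ c ∧
    Φ (fun x => ∫ y, g y * (starRingEnd ℂ) (g (y - x))) = (c : ℂ)

/-- A positive measure is translation bounded if the translates of any compact set have bounded
measure. -/
def IsTranslationBounded (σ : Measure (Space d)) : Prop :=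
  ∀ K : Set (Space d), IsCompact K → ∃ C : ℝ≥0∞, C < ∞ ∧ ∀ t : Space d,
    σ ((fun x => t + x) '' K) ≤ C

/-- The positive measure `σ` is the Fourier transform of the weighted first moment `ω`:
`σ(f) = ω(𝓕 f)` for all rapidly decreasing `f`, all integrals being absolutely convergent. -/
def IsMomentFourierTransform (μ : Measure (PointMeasure d m)) (w : Fin m → ℝ)
    (σ : Measure (Space d)) : Prop :=
  ∀ f : 𝓢(Space d, ℂ), MomentIntegrable μ (𝓕 (f : Space d → ℂ)) ∧ Integrable f σ ∧
    ∫ x, f x ∂σ = weightedMoment μ w (𝓕 (f : Space d → ℂ))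

/-- `ℓ(C_R)⁻¹ (λ^w|_{C_R} * (λ^w|_{C_R})^~)(f)`. The weights are real, so this is
`ℓ(C_R)⁻¹ ∑_{x, y ∈ C_R} λ^w({x}) λ^w({y}) f(x - y)`. -/
def autocorrelationAt (w : Fin m → ℝ) (lam : PointMeasure d m) (R : ℝ) (f : Space d → ℂ) : ℂ :=
  ((volume (cube d R)).toReal : ℂ)⁻¹ *
    count w ((cube d R).indicator fun x =>
      count w ((cube d R).indicator fun y => f (x - y)) lam) lam

/-- The `w`-weighted autocorrelation of `λ` exists and equals `γ`: vague convergence as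
`R → ∞`. -/
def HasAutocorrelation (w : Fin m → ℝ) (lam : PointMeasure d m) (γ : (Space d → ℂ) → ℂ) : Prop :=
  ∀ f : C_c(Space d, ℂ), Tendsto (fun R : ℝ => autocorrelationAt w lam R f) atTop (𝓝 (γ f))

end PointProcess

end

/-!
Write `f(x - y)` summed over the pairs of points of `λ` in `C_R` as an average, over translations
`t ∈ C_R`, of the local pair sum `∑ ψ(y) f(x - y)` of `T_t λ`, where `ψ` is a bump of total mass
one; boundary effects are absorbed by slightly smaller and larger cubes. The local pair sum is a
continuous function on the compact support `X` of `μ`, and by the refined Campbell formula its mean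
is the first moment of the Palm measure at `f`. So the autocorrelation of `λ` exists and is this
moment whenever the orbit averages of all continuous functions at `λ` converge to their means. By
the pointwise ergodic theorem this is the case for almost every `λ`, and under unique ergodicity, by
the Krylov–Bogoliubov argument, for every `λ ∈ X`.

The finite volume autocorrelations are positive definite, hence so is their limit. Their Fourier
transforms are the diffraction measures `ℓ(C_R)⁻¹ |∑_{x ∈ C_R} λ^w({x}) e^{-2πi k·x}|² dk`. Tested
against the translates of one bump function, these are bounded uniformly in `R`, because uniform
discreteness makes the autocorrelations uniformly translation bounded. A vague limit point is the
transform of the moment.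
-/

noncomputable section

namespace PointProcess

section Translation

variable {G : Type*} [AddCommGroup G]

lemma mem_image_add_left_iff {t x : G} {s : Set G} : x ∈ (fun y => t + y) '' s ↔ x - t ∈ s := by
  rw [Set.image_add_left, Set.mem_preimage, neg_add_eq_sub]

variable [MeasurableSpace G] [MeasurableAdd G]

lemma measurableSet_image_add_left {s : Set G} (hs : MeasurableSet s) (t : G) :
    MeasurableSet ((fun x => t + x) '' s) :=
  (measurableEmbedding_addLeft t).measurableSet_image.2 hs

lemma measure_image_add_left (ρ : Measure G) [ρ.IsAddLeftInvariant] (t : G) (s : Set G) :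
    ρ ((fun x => t + x) '' s) = ρ s := by
  rw [Set.image_add_left, measure_preimage_add]

variable {Y : Type*} [AddAction G Y] (ρ : Measure G) [ρ.IsAddLeftInvariant]

lemma setIntegral_vadd_vadd (F : Y → ℝ) (g : G) (y : Y) (s : Set G) :
    ∫ t in s, F (t +ᵥ (g +ᵥ y)) ∂ρ = ∫ t in (fun x => g + x) '' s, F (t +ᵥ y) ∂ρ := by
  rw [(measurePreserving_add_left ρ g).setIntegral_image_emb (measurableEmbedding_addLeft g)]
  simp only [← add_vadd, add_comm]

lemma setLIntegral_vadd_vadd (F : Y → ℝ≥0∞) (g : G) (y : Y) (s : Set G) :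
    ∫⁻ t in s, F (t +ᵥ (g +ᵥ y)) ∂ρ = ∫⁻ t in (fun x => g + x) '' s, F (t +ᵥ y) ∂ρ := by
  rw [← (measurePreserving_add_left ρ g).setLIntegral_comp_emb (measurableEmbedding_addLeft g)]
  simp only [← add_vadd, add_comm]

end Translation

/-- If every translate of `U` has `ν`-mass at most `N`, then averaging over the translates of `U`
bounds the `ν`-integral of `g` by the Haar integral of a majorant `h` of `g` at scale `U`. -/
lemma measure_mul_lintegral_le_of_translate_le {G : Type*} [AddCommGroup G] [MeasurableSpace G]
    [MeasurableAdd₂ G] [MeasurableNeg G] {ρ : Measure G} [SFinite ρ] [ρ.IsAddLeftInvariant]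
    [ρ.IsNegInvariant] {ν : Measure G} [SFinite ν] {U : Set G} (hU : MeasurableSet U) {N : ℝ≥0∞}
    (hN : ∀ t, ν ((fun x => t + x) '' U) ≤ N) {g h : G → ℝ≥0∞} (hg : Measurable g)
    (hh : Measurable h) (hgh : ∀ y t, y - t ∈ U → g y ≤ h t) :
    ρ U * ∫⁻ y, g y ∂ν ≤ N * ∫⁻ t, h t ∂ρ := by
  set D : Set (G × G) := {p | p.1 - p.2 ∈ U}
  have hD : MeasurableSet D := hU.preimage (by fun_prop)
  have hleft (y : G) : ρ {t | y - t ∈ U} = ρ U :=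
    (Measure.measurePreserving_sub_left ρ y).measure_preimage hU.nullMeasurableSet
  calc ρ U * ∫⁻ y, g y ∂ν = ∫⁻ y, ∫⁻ t, D.indicator (fun p => g p.1) (y, t) ∂ρ ∂ν := by
        rw [← lintegral_const_mul _ hg]
        refine lintegral_congr fun y => ?_
        rw [← hleft y, mul_comm]
        exact (lintegral_indicator_const (hU.preimage (measurable_const_sub y)) _).symm
    _ ≤ ∫⁻ y, ∫⁻ t, D.indicator (fun p => h p.2) (y, t) ∂ρ ∂ν := by
        refine lintegral_mono fun y => lintegral_mono fun t => ?_
        exact Set.indicator_le_indicator' fun hyt => hgh y t hyt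
    _ = ∫⁻ t, ∫⁻ y, D.indicator (fun p => h p.2) (y, t) ∂ν ∂ρ :=
        lintegral_lintegral_swap ((hh.comp measurable_snd).indicator hD).aemeasurable
    _ ≤ ∫⁻ t, N * h t ∂ρ := by
        refine lintegral_mono fun t => ?_
        have hright : (fun y => D.indicator (fun p => h p.2) (y, t)) =
            ((fun x => t + x) '' U).indicator fun _ => h t := by
          funext y
          exact Set.indicator_eq_indicator mem_image_add_left_iff.symm rfl
        rw [hright, lintegral_indicator_const (measurableSet_image_add_left hU t), mul_comm]
        gcongr
        exact hN t
    _ = N * ∫⁻ t, h t ∂ρ := lintegral_const_mul _ hh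

variable {d m : ℕ}

section Cube

lemma isOpen_cube (R : ℝ) : IsOpen (cube d R) := by
  simp only [cube, Set.ofPred_forall]
  exact isOpen_iInter_of_finite fun i => isOpen_lt (by fun_prop) continuous_const

lemma measurableSet_cube (R : ℝ) : MeasurableSet (cube d R) := (isOpen_cube R).measurableSet

lemma volume_cube (R : ℝ) : volume (cube d R) = ENNReal.ofReal R ^ d := by
  have h : cube d R =
      WithLp.ofLp ⁻¹' Set.univ.pi fun _ => Set.Ioo (-(R / 2)) (R / 2) := by
    ext x
    simp [cube, abs_lt]
  rw [h, (PiLp.volume_preserving_ofLp (Fin d)).measure_preimage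
    (MeasurableSet.univ_pi fun _ => measurableSet_Ioo).nullMeasurableSet, Real.volume_pi_Ioo]
  simp

lemma volume_cube_ne_top (R : ℝ) : volume (cube d R) ≠ ∞ := by
  rw [volume_cube]
  exact ENNReal.pow_ne_top ENNReal.ofReal_ne_top

lemma volume_cube_ne_zero {R : ℝ} (hR : 0 < R) : volume (cube d R) ≠ 0 := by
  rw [volume_cube]
  positivity

lemma volume_real_cube {R : ℝ} (hR : 0 ≤ R) : volume.real (cube d R) = R ^ d := by
  rw [measureReal_def, volume_cube, ENNReal.toReal_pow, ENNReal.toReal_ofReal hR]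

lemma zero_mem_cube {R : ℝ} (hR : 0 < R) : (0 : Space d) ∈ cube d R := fun i => by simpa using hR

lemma neg_mem_cube_iff {R : ℝ} {x : Space d} : -x ∈ cube d R ↔ x ∈ cube d R := by simp [cube]

lemma add_mem_cube {R S T : ℝ} {x y : Space d} (hx : x ∈ cube d R) (hy : y ∈ cube d S)
    (h : R + S ≤ T) : x + y ∈ cube d T := fun i =>
  calc |x i + y i| ≤ |x i| + |y i| := abs_add_le _ _
    _ < T / 2 := by linarith [hx i, hy i]

lemma sub_mem_cube {R S T : ℝ} {x y : Space d} (hx : x ∈ cube d R) (hy : y ∈ cube d S)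
    (h : R + S ≤ T) : x - y ∈ cube d T := by
  rw [sub_eq_add_neg]
  exact add_mem_cube hx (neg_mem_cube_iff.2 hy) h

lemma cube_mono {R S : ℝ} (h : R ≤ S) : cube d R ⊆ cube d S := fun x hx i =>
  (hx i).trans_le (by gcongr)

lemma mem_cube_of_norm_lt {x : Space d} {R : ℝ} (h : ‖x‖ < R / 2) : x ∈ cube d R := fun i =>
  (PiLp.norm_apply_le x i).trans_lt h

lemma isBounded_cube (R : ℝ) : Bornology.IsBounded (cube d R) := by
  refine ((PiLp.antilipschitzWith_ofLp 2 fun _ : Fin d => ℝ).isBounded_preimage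
    (Metric.isBounded_closedBall (x := 0) (r := |R / 2|))).subset fun x hx => ?_
  rw [Set.mem_preimage, mem_closedBall_zero_iff]
  exact (pi_norm_le_iff_of_nonneg (abs_nonneg _)).2 fun i => (hx i).le.trans (le_abs_self _)

lemma exists_norm_le_of_mem_cube (R : ℝ) : ∃ ρ : ℝ, 0 < ρ ∧ ∀ x ∈ cube d R, ‖x‖ ≤ ρ :=
  (isBounded_cube R).exists_pos_norm_le

lemma exists_subset_cube {K : Set (Space d)} (hK : Bornology.IsBounded K) :
    ∃ R : ℝ, 0 < R ∧ K ⊆ cube d R := by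
  obtain ⟨C, hC, hKC⟩ := hK.exists_pos_norm_lt
  exact ⟨2 * C, by positivity, fun x hx => mem_cube_of_norm_lt (by linarith [hKC x hx])⟩

lemma iUnion_cube_natCast : ⋃ n : ℕ, cube d (n : ℝ) = Set.univ := by
  refine Set.eq_univ_of_forall fun x => Set.mem_iUnion.2 ?_
  obtain ⟨R, -, hx⟩ := exists_subset_cube (Bornology.isBounded_singleton (x := x))
  obtain ⟨n, hn⟩ := exists_nat_ge R
  exact ⟨n, cube_mono hn (hx rfl)⟩

lemma isOpen_image_add_cube (t : Space d) (R : ℝ) : IsOpen ((fun x => t + x) '' cube d R) :=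
  isOpenMap_add_left t _ (isOpen_cube R)

lemma tendsto_add_pow_div_pow (k : ℕ) (c : ℝ) :
    Tendsto (fun R : ℝ => (R + c) ^ k / R ^ k) atTop (𝓝 1) := by
  have h : Tendsto (fun R : ℝ => (1 + c / R) ^ k) atTop (𝓝 1) := by
    simpa using ((tendsto_const_nhds (x := c)).div_atTop tendsto_id).const_add 1 |>.pow k
  refine h.congr' ?_
  filter_upwards [eventually_gt_atTop 0] with R hR
  rw [← div_pow, add_div, div_self hR.ne']

lemma tendsto_volume_cube_add_div (c : ℝ) :
    Tendsto (fun R : ℝ => volume (cube d (R + c)) / volume (cube d R)) atTop (𝓝 1) := by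
  have h := ENNReal.tendsto_ofReal (tendsto_add_pow_div_pow d c)
  rw [ENNReal.ofReal_one] at h
  refine h.congr' ?_
  filter_upwards [eventually_gt_atTop 0, eventually_ge_atTop (-c)] with R hR hRc
  rw [volume_cube, volume_cube, ENNReal.ofReal_div_of_pos (by positivity),
    ENNReal.ofReal_pow (by linarith), ENNReal.ofReal_pow hR.le]

end Cube

section Decay

/-- The weight `(1 + ‖x‖)^{-(d+1)}`, a Lebesgue integrable function on `ℝ^d` dominating every
Schwartz function up to a constant. -/
def decay (x : Space d) : ℝ := ((1 + ‖x‖) ^ (d + 1))⁻¹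

lemma decay_pos (x : Space d) : 0 < decay x := by
  unfold decay
  positivity

lemma continuous_decay : Continuous (decay : Space d → ℝ) := by
  unfold decay
  exact Continuous.inv₀ (by fun_prop) fun x => by positivity

lemma lintegral_decay_lt_top : ∫⁻ x : Space d, ENNReal.ofReal (decay x) < ∞ := by
  have h := finite_integral_one_add_norm (E := Space d) (μ := volume) (r := (d + 1 : ℕ)) (by simp)
  convert h using 3 with x
  rw [Real.rpow_neg (by positivity), Real.rpow_natCast, decay]

lemma decay_le_mul_decay {x y : Space d} {ρ : ℝ} (h : ‖x - y‖ ≤ ρ) :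
    decay x ≤ (1 + ρ) ^ (d + 1) * decay y := by
  have hρ : 0 ≤ ρ := (norm_nonneg _).trans h
  unfold decay
  rw [← div_eq_mul_inv, inv_eq_one_div, div_le_div_iff₀ (by positivity) (by positivity), one_mul,
    ← mul_pow]
  have hy : ‖y‖ ≤ ‖x‖ + ‖x - y‖ := by simpa using norm_sub_le x (x - y)
  gcongr
  nlinarith [norm_nonneg x]

lemma exists_lintegral_decay_le {r : ℝ} (hr : 0 < r) : ∃ D : ℝ≥0∞, D < ∞ ∧
    ∀ (ν : Measure (Space d)) [SFinite ν] (N : ℝ≥0∞),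
      (∀ t, ν ((fun x => t + x) '' cube d r) ≤ N) →
      ∫⁻ x, ENNReal.ofReal (decay x) ∂ν ≤ N * D := by
  obtain ⟨ρ, hρ, hcube⟩ := exists_norm_le_of_mem_cube (d := d) r
  have hm : Measurable fun x : Space d => ENNReal.ofReal (decay x) :=
    continuous_decay.measurable.ennreal_ofReal
  refine ⟨(ENNReal.ofReal ((1 + ρ) ^ (d + 1)) * ∫⁻ x : Space d, ENNReal.ofReal (decay x)) /
    volume (cube d r), ENNReal.div_lt_top (ENNReal.mul_ne_top ENNReal.ofReal_ne_top
      lintegral_decay_lt_top.ne) (volume_cube_ne_zero hr), fun ν _ N hN => ?_⟩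
  rw [← mul_div_assoc, ENNReal.le_div_iff_mul_le (.inl (volume_cube_ne_zero hr))
    (.inl (volume_cube_ne_top r)), mul_comm, ← lintegral_const_mul (ENNReal.ofReal _) hm]
  refine measure_mul_lintegral_le_of_translate_le (ρ := volume) (measurableSet_cube r) hN hm
    (hm.const_mul _) fun y t hyt => ?_
  rw [← ENNReal.ofReal_mul (by positivity)]
  exact ENNReal.ofReal_le_ofReal (decay_le_mul_decay (hcube _ hyt))

lemma measure_image_add_cube_le {r : ℝ} (hr : 0 < r) {ν : Measure (Space d)} [SFinite ν]
    {N : ℝ≥0∞} (hN : ∀ t, ν ((fun x => t + x) '' cube d r) ≤ N) (t : Space d) (R : ℝ) :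
    ν ((fun x => t + x) '' cube d R) ≤ N * (volume (cube d (R + r)) / volume (cube d r)) := by
  set Q : ℝ → Set (Space d) := fun S => (fun x => t + x) '' cube d S
  have hm (S : ℝ) : MeasurableSet (Q S) := measurableSet_image_add_left (measurableSet_cube S) t
  have henlarge (y s : Space d) (hys : y - s ∈ cube d r) :
      (Q R).indicator (1 : Space d → ℝ≥0∞) y ≤ (Q (R + r)).indicator 1 s := by
    by_cases hy : y ∈ Q R
    · have hs : s ∈ Q (R + r) := mem_image_add_left_iff.2 <| by
        simpa using sub_mem_cube (mem_image_add_left_iff.1 hy) hys le_rfl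
      simp [hy, hs]
    · simp [hy]
  have hle := measure_mul_lintegral_le_of_translate_le (ρ := volume) (measurableSet_cube r) hN
    (measurable_one.indicator (hm R)) (measurable_one.indicator (hm (R + r))) henlarge
  rw [lintegral_indicator_one (hm R), lintegral_indicator_one (hm _),
    measure_image_add_left volume t] at hle
  rwa [← mul_div_assoc, ENNReal.le_div_iff_mul_le (.inl (volume_cube_ne_zero hr))
    (.inl (volume_cube_ne_top r)), mul_comm]

lemma exists_measure_image_add_le {r : ℝ} (hr : 0 < r) {K : Set (Space d)}
    (hK : Bornology.IsBounded K) : ∃ D : ℝ≥0∞, D < ∞ ∧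
    ∀ (ν : Measure (Space d)) [SFinite ν] (N : ℝ≥0∞),
      (∀ t, ν ((fun x => t + x) '' cube d r) ≤ N) → ∀ t, ν ((fun x => t + x) '' K) ≤ N * D := by
  obtain ⟨R, -, hKR⟩ := exists_subset_cube hK
  exact ⟨volume (cube d (R + r)) / volume (cube d r),
    ENNReal.div_lt_top (volume_cube_ne_top _) (volume_cube_ne_zero hr), fun ν _ N hN t =>
      (measure_mono (Set.image_mono hKR)).trans (measure_image_add_cube_le hr hN t R)⟩

end Decay

section InvariantMeasure

variable {G Y : Type*} [AddGroup G] [AddAction G Y] [MeasurableSpace Y] {μ : Measure Y}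

lemma measurable_setLIntegral_vadd [MeasurableSpace G] [MeasurableVAdd₂ G Y] (ρ : Measure G)
    [SFinite ρ] {F : Y → ℝ≥0∞} (hF : Measurable F) (s : Set G) :
    Measurable fun y => ∫⁻ t in s, F (t +ᵥ y) ∂ρ :=
  ((hF.comp measurable_vadd).comp measurable_swap).lintegral_prod_right'

lemma lintegral_setLIntegral_vadd [MeasurableSpace G] [MeasurableVAdd₂ G Y] [SFinite μ]
    [VAddInvariantMeasure G Y μ] (ρ : Measure G) [SFinite ρ] {F : Y → ℝ≥0∞} (hF : Measurable F)
    (s : Set G) :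
    ∫⁻ y, ∫⁻ t in s, F (t +ᵥ y) ∂ρ ∂μ = ρ s * ∫⁻ y, F y ∂μ := by
  rw [lintegral_lintegral_swap (by fun_prop)]
  simp_rw [fun t : G => (measurePreserving_vadd t μ).lintegral_comp hF]
  rw [setLIntegral_const, mul_comm]

lemma ae_vadd_eq_of_forall_setIntegral_eq [MeasurableConstVAdd G Y]
    [VAddInvariantMeasure G Y μ] {k : Y → ℝ} (hk : Integrable k μ) {g : G}
    (h : ∀ A : Set Y, MeasurableSet A → ∫ y in (g +ᵥ ·) ⁻¹' A, k y ∂μ = ∫ y in A, k y ∂μ) :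
    (fun y => k (g +ᵥ y)) =ᵐ[μ] k := by
  have hg := measurePreserving_vadd g μ
  refine Integrable.ae_eq_of_forall_setIntegral_eq _ _ (hg.integrable_comp_of_integrable hk) hk
    fun s hs _ => ?_
  have hs' : s = (g +ᵥ ·) ⁻¹' ((-g +ᵥ ·) ⁻¹' s) := by ext y; simp
  have hs'm : MeasurableSet ((-g +ᵥ · : Y → Y) ⁻¹' s) := measurable_const_vadd (-g) hs
  calc ∫ y in s, k (g +ᵥ y) ∂μ
      = ∫ y in (g +ᵥ ·) ⁻¹' ((-g +ᵥ ·) ⁻¹' s), k (g +ᵥ y) ∂μ := by rw [← hs']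
    _ = ∫ y in (-g +ᵥ ·) ⁻¹' s, k y ∂μ :=
        hg.setIntegral_preimage_emb (measurableEmbedding_const_vadd g) k _
    _ = ∫ y in s, k y ∂μ := by rw [← h _ hs'm, ← hs']

lemma exists_ae_eq_const_of_forall_ae_vadd_eq [NeZero μ] [ErgodicVAdd G Y μ] {k : Y → ℝ}
    (hk : Measurable k) (h : ∀ g : G, (fun y => k (g +ᵥ y)) =ᵐ[μ] k) :
    ∃ c : ℝ, k =ᵐ[μ] fun _ => c := by
  refine exists_eventuallyEq_const_of_forall_separating MeasurableSet fun U hU => ?_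
  refine eventuallyConst_set.1
    (ErgodicVAdd.aeconst_of_forall_preimage_vadd_ae_eq (G := G) (hk hU) fun g => ?_)
  filter_upwards [h g] with y hy
  exact congrArg (· ∈ U) hy

end InvariantMeasure

section MaximalInequality

variable {Y : Type*} [AddAction (Space d) Y]

/-- The set of points at which the average of `G` along the orbit over one of the cubes
`C_1, …, C_N` exceeds `a`. -/
def exceedanceSet (d : ℕ) {Y : Type*} [AddAction (Space d) Y] (G : Y → ℝ≥0∞) (a : ℝ≥0∞) (N : ℕ) :
    Set Y :=
  {y | ∃ n : ℕ, 1 ≤ n ∧ n ≤ N ∧ a * volume (cube d n) < ∫⁻ s in cube d n, G (s +ᵥ y)}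

lemma exceedanceSet_mono (G : Y → ℝ≥0∞) (a : ℝ≥0∞) : Monotone (exceedanceSet d G a) := by
  rintro N N' hN y ⟨n, hn1, hnN, hn⟩
  exact ⟨n, hn1, hnN.trans hN, hn⟩

lemma exists_disjoint_cubes_covering {T : Set (Space d × ℕ)} {N : ℕ}
    (hT : ∀ p ∈ T, 1 ≤ p.2 ∧ p.2 ≤ N) :
    ∃ u ⊆ T, u.Countable ∧ u.PairwiseDisjoint (fun p => (fun x => p.1 + x) '' cube d (p.2 : ℝ)) ∧
      ∀ p ∈ T, p.1 ∈ ⋃ q ∈ u, (fun x => q.1 + x) '' cube d (3 * (q.2 : ℝ)) := by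
  let B : Space d × ℕ → Set (Space d) := fun p => (fun x => p.1 + x) '' cube d (p.2 : ℝ)
  have hself (p) (hp : p ∈ T) : p.1 ∈ B p :=
    ⟨0, zero_mem_cube (by exact_mod_cast (hT p hp).1), add_zero _⟩
  obtain ⟨u, huT, hud, hu⟩ := Vitali.exists_disjoint_subfamily_covering_enlargement B T
    (fun p => (p.2 : ℝ)) 2 one_lt_two (fun p _ => Nat.cast_nonneg _) N
    (fun p hp => Nat.cast_le.2 (hT p hp).2) (fun p hp => ⟨_, hself p hp⟩)
  refine ⟨u, huT, hud.countable_of_isOpen (fun p _ => isOpen_image_add_cube _ _)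
    (fun p hp => ⟨_, hself p (huT hp)⟩), hud, fun p hp => ?_⟩
  obtain ⟨q, hq, ⟨z, hzp, hzq⟩, hle⟩ := hu p hp
  refine Set.mem_biUnion hq ?_
  rw [mem_image_add_left_iff] at hzp hzq ⊢
  simpa using sub_mem_cube (T := 3 * (q.2 : ℝ)) hzq hzp (by linarith)

lemma mul_volume_inter_exceedanceSet_le (G : Y → ℝ≥0∞) (a : ℝ≥0∞) (N : ℕ) (L : ℝ) (y : Y) :
    a * volume (cube d L ∩ {t | t +ᵥ y ∈ exceedanceSet d G a N}) ≤
      3 ^ d * ∫⁻ t in cube d (L + N), G (t +ᵥ y) := by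
  let B : Space d × ℕ → Set (Space d) := fun p => (fun x => p.1 + x) '' cube d (p.2 : ℝ)
  let T : Set (Space d × ℕ) := {p | p.1 ∈ cube d L ∧ (1 ≤ p.2 ∧ p.2 ≤ N) ∧
    a * volume (cube d p.2) < ∫⁻ s in cube d (p.2 : ℝ), G (s +ᵥ (p.1 +ᵥ y))}
  obtain ⟨u, huT, huc, hud, hu⟩ := exists_disjoint_cubes_covering (T := T) fun p hp => hp.2.1
  have hcov : cube d L ∩ {t | t +ᵥ y ∈ exceedanceSet d G a N} ⊆
      ⋃ p ∈ u, (fun x => p.1 + x) '' cube d (3 * (p.2 : ℝ)) := by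
    rintro t ⟨htL, n, hn1, hnN, hn⟩
    exact hu (t, n) ⟨htL, ⟨hn1, hnN⟩, hn⟩
  have hsub : ⋃ p ∈ u, B p ⊆ cube d (L + N) := by
    refine Set.iUnion₂_subset fun p hp => ?_
    rintro _ ⟨x, hx, rfl⟩
    have hpN : (p.2 : ℝ) ≤ N := Nat.cast_le.2 (huT hp).2.1.2
    exact add_mem_cube (huT hp).1 hx (by linarith)
  calc a * volume (cube d L ∩ {t | t +ᵥ y ∈ exceedanceSet d G a N})
      ≤ a * volume (⋃ p ∈ u, (fun x => p.1 + x) '' cube d (3 * (p.2 : ℝ))) := by gcongr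
    _ ≤ a * ∑' p : u, volume ((fun x => p.1.1 + x) '' cube d (3 * (p.1.2 : ℝ))) := by
        gcongr
        exact measure_biUnion_le _ huc _
    _ = ∑' p : u, 3 ^ d * (a * volume (cube d p.1.2)) := by
        rw [← ENNReal.tsum_mul_left]
        refine tsum_congr fun p => ?_
        rw [measure_image_add_left, volume_cube, volume_cube, ENNReal.ofReal_mul (by norm_num),
          mul_pow, ENNReal.ofReal_ofNat, mul_left_comm]
    _ ≤ ∑' p : u, 3 ^ d * ∫⁻ t in B p, G (t +ᵥ y) := by
        refine ENNReal.tsum_le_tsum fun p => ?_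
        gcongr
        exact (huT p.2).2.2.le.trans_eq (setLIntegral_vadd_vadd volume G _ y _)
    _ = 3 ^ d * ∫⁻ t in ⋃ p ∈ u, B p, G (t +ᵥ y) := by
        rw [ENNReal.tsum_mul_left, lintegral_biUnion huc
          (fun p _ => (isOpen_image_add_cube _ _).measurableSet) hud]
    _ ≤ 3 ^ d * ∫⁻ t in cube d (L + N), G (t +ᵥ y) := by gcongr

variable [MeasurableSpace Y] [MeasurableVAdd₂ (Space d) Y]

lemma measurableSet_exceedanceSet {G : Y → ℝ≥0∞} (hG : Measurable G) (a : ℝ≥0∞) (N : ℕ) :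
    MeasurableSet (exceedanceSet d G a N) := by
  have hset : exceedanceSet d G a N = ⋃ n : ℕ, {y | 1 ≤ n ∧ n ≤ N ∧
      a * volume (cube d n) < ∫⁻ s in cube d n, G (s +ᵥ y)} := by
    ext y
    simp [exceedanceSet]
  rw [hset]
  refine .iUnion fun n => (MeasurableSet.const _).inter ((MeasurableSet.const _).inter ?_)
  exact measurableSet_lt measurable_const (measurable_setLIntegral_vadd volume hG _)

variable {μ : Measure Y} [SFinite μ] [VAddInvariantMeasure (Space d) Y μ]

lemma volume_cube_mul_measure_exceedanceSet_le {G : Y → ℝ≥0∞} (hG : Measurable G) (a : ℝ≥0∞)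
    (N : ℕ) (L : ℝ) : volume (cube d L) * (a * μ (exceedanceSet d G a N)) ≤
      volume (cube d (L + N)) * (3 ^ d * ∫⁻ y, G y ∂μ) := by
  set E := exceedanceSet d G a N
  have hE : MeasurableSet E := measurableSet_exceedanceSet hG a N
  have hEi : Measurable (E.indicator (1 : Y → ℝ≥0∞)) := measurable_one.indicator hE
  have horbit (y : Y) : ∫⁻ t in cube d L, E.indicator 1 (t +ᵥ y) =
      volume (cube d L ∩ {t | t +ᵥ y ∈ E}) := by
    have hEy : MeasurableSet {t : Space d | t +ᵥ y ∈ E} := hE.preimage (measurable_vadd_const y)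
    rw [Set.inter_comm, ← Measure.restrict_apply hEy, ← lintegral_indicator_one hEy]
    rfl
  calc volume (cube d L) * (a * μ E)
      = ∫⁻ y, a * (∫⁻ t in cube d L, E.indicator 1 (t +ᵥ y)) ∂μ := by
        rw [lintegral_const_mul a (measurable_setLIntegral_vadd volume hEi _),
          lintegral_setLIntegral_vadd volume hEi, lintegral_indicator_one hE, mul_left_comm]
    _ ≤ ∫⁻ y, 3 ^ d * (∫⁻ t in cube d (L + N), G (t +ᵥ y)) ∂μ := by
        refine lintegral_mono fun y => ?_
        rw [horbit]
        exact mul_volume_inter_exceedanceSet_le G a N L y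
    _ = volume (cube d (L + N)) * (3 ^ d * ∫⁻ y, G y ∂μ) := by
        rw [lintegral_const_mul' _ _ (by finiteness), lintegral_setLIntegral_vadd volume hG,
          mul_left_comm]

lemma mul_measure_exceedanceSet_le {G : Y → ℝ≥0∞} (hG : Measurable G) (a : ℝ≥0∞) (N : ℕ) :
    a * μ (exceedanceSet d G a N) ≤ 3 ^ d * ∫⁻ y, G y ∂μ := by
  have hlim := ENNReal.Tendsto.mul_const (b := 3 ^ d * ∫⁻ y, G y ∂μ)
    (tendsto_volume_cube_add_div (d := d) N) (.inl one_ne_zero)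
  rw [one_mul] at hlim
  refine ge_of_tendsto hlim ?_
  filter_upwards [eventually_gt_atTop 0] with L hL
  rw [← ENNReal.mul_div_right_comm, ENNReal.le_div_iff_mul_le (.inl (volume_cube_ne_zero hL))
    (.inl (volume_cube_ne_top L)), mul_comm]
  exact volume_cube_mul_measure_exceedanceSet_le hG a N L

theorem mul_measure_iUnion_exceedanceSet_le {G : Y → ℝ≥0∞} (hG : Measurable G) (a : ℝ≥0∞) :
    a * μ (⋃ N, exceedanceSet d G a N) ≤ 3 ^ d * ∫⁻ y, G y ∂μ := by
  rw [(exceedanceSet_mono G a).measure_iUnion, ENNReal.mul_iSup]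
  exact iSup_le fun N => mul_measure_exceedanceSet_le hG a N

end MaximalInequality

section PointwiseErgodicTheorem

lemma norm_setIntegral_sub_setIntegral_le {α E : Type*} [MeasurableSpace α] [NormedAddCommGroup E]
    [NormedSpace ℝ E] {ν : Measure α} {f : α → E} {C : ℝ} {s S : Set α} (hs : MeasurableSet s)
    (hsS : s ⊆ S) (hS : ν S ≠ ∞) (hf : IntegrableOn f S ν) (hC : ∀ x ∈ S, ‖f x‖ ≤ C) :
    ‖∫ x in S, f x ∂ν - ∫ x in s, f x ∂ν‖ ≤ C * (ν.real S - ν.real s) := by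
  rw [← setIntegral_sdiff hs hf hsS, ← measureReal_sdiff hsS hs hS]
  exact norm_setIntegral_le_of_norm_le_const ((measure_mono Set.sdiff_subset).trans_lt hS.lt_top)
    fun x hx => hC x hx.1

variable {Y : Type*} [AddAction (Space d) Y]

/-- The average of `F` along the part of the orbit of `y` parametrized by the cube `C_R`. -/
def cubeAverage (d : ℕ) {Y : Type*} [AddAction (Space d) Y] (F : Y → ℝ) (R : ℝ) (y : Y) : ℝ :=
  (R ^ d)⁻¹ * ∫ t in cube d R, F (t +ᵥ y)

lemma cubeAverage_add {F G : Y → ℝ} {R : ℝ} {y : Y}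
    (hF : IntegrableOn (fun t : Space d => F (t +ᵥ y)) (cube d R))
    (hG : IntegrableOn (fun t : Space d => G (t +ᵥ y)) (cube d R)) :
    cubeAverage d (F + G) R y = cubeAverage d F R y + cubeAverage d G R y := by
  simp only [cubeAverage, Pi.add_apply, integral_add hF hG, mul_add]

lemma cubeAverage_smul (c : ℝ) (F : Y → ℝ) (R : ℝ) (y : Y) :
    cubeAverage d (c • F) R y = c * cubeAverage d F R y := by
  simp only [cubeAverage, Pi.smul_apply, smul_eq_mul, integral_const_mul, mul_left_comm c]

lemma cubeAverage_const (c : ℝ) {R : ℝ} (hR : 0 < R) (y : Y) :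
    cubeAverage d (fun _ => c) R y = c := by
  rw [cubeAverage, setIntegral_const, volume_real_cube hR.le, smul_eq_mul,
    inv_mul_cancel_left₀ (by positivity)]

lemma setLIntegral_le_of_notMem_iUnion_exceedanceSet {G : Y → ℝ≥0∞} {a : ℝ≥0∞} {y : Y}
    (hy : y ∉ ⋃ N, exceedanceSet d G a N) {n : ℕ} (hn : 1 ≤ n) :
    ∫⁻ t in cube d n, G (t +ᵥ y) ≤ a * volume (cube d n) := by
  by_contra! h
  exact hy (Set.mem_iUnion_of_mem n ⟨n, hn, le_rfl, h⟩)

lemma abs_cubeAverage_le_of_notMem_iUnion_exceedanceSet {F : Y → ℝ} {a : ℝ} (ha : 0 ≤ a) {y : Y}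
    (hy : y ∉ ⋃ N, exceedanceSet d (fun z => ‖F z‖ₑ) (ENNReal.ofReal a) N) {R : ℝ} (hR : 1 ≤ R) :
    |cubeAverage d F R y| ≤ 2 ^ d * a := by
  have hR0 : 0 < R := by linarith
  have hn : (⌈R⌉₊ : ℝ) ≤ 2 * R := by linarith [Nat.ceil_lt_add_one hR0.le]
  have hint : ‖∫ t in cube d R, F (t +ᵥ y)‖ₑ ≤ ENNReal.ofReal (a * (2 * R) ^ d) :=
    calc ‖∫ t in cube d R, F (t +ᵥ y)‖ₑ
        ≤ ∫⁻ t in cube d R, ‖F (t +ᵥ y)‖ₑ := enorm_integral_le_lintegral_enorm _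
      _ ≤ ∫⁻ t in cube d ⌈R⌉₊, ‖F (t +ᵥ y)‖ₑ := lintegral_mono_set (cube_mono (Nat.le_ceil R))
      _ ≤ ENNReal.ofReal a * volume (cube d ⌈R⌉₊) :=
          setLIntegral_le_of_notMem_iUnion_exceedanceSet hy (Nat.one_le_ceil_iff.2 hR0)
      _ ≤ ENNReal.ofReal a * volume (cube d (2 * R)) := by gcongr; exact cube_mono hn
      _ = ENNReal.ofReal (a * (2 * R) ^ d) := by
          rw [volume_cube, ENNReal.ofReal_mul ha, ENNReal.ofReal_pow (by positivity)]
  have hint' : |∫ t in cube d R, F (t +ᵥ y)| ≤ a * (2 * R) ^ d := by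
    rwa [Real.enorm_eq_ofReal_abs, ENNReal.ofReal_le_ofReal_iff (by positivity)] at hint
  rw [cubeAverage, abs_mul, abs_of_pos (by positivity), inv_mul_le_iff₀ (by positivity)]
  exact hint'.trans_eq (by ring)

variable [MeasurableSpace Y] [MeasurableVAdd₂ (Space d) Y]

lemma integrableOn_cube_vadd {F : Y → ℝ} (hF : Measurable F) {C : ℝ} (hC : ∀ y, |F y| ≤ C)
    (R : ℝ) (y : Y) : IntegrableOn (fun t : Space d => F (t +ᵥ y)) (cube d R) :=
  Measure.integrableOn_of_bounded (volume_cube_ne_top R)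
    (hF.comp (measurable_vadd_const y)).aestronglyMeasurable (ae_of_all _ fun _ => hC _)

lemma integrableOn_cube_vadd_of_notMem_iUnion_exceedanceSet {F : Y → ℝ} (hF : Measurable F)
    {a : ℝ≥0∞} (ha : a ≠ ∞) {y : Y} (hy : y ∉ ⋃ N, exceedanceSet d (fun z => ‖F z‖ₑ) a N)
    (R : ℝ) : IntegrableOn (fun t : Space d => F (t +ᵥ y)) (cube d R) := by
  refine IntegrableOn.mono_set ⟨(hF.comp (measurable_vadd_const y)).aestronglyMeasurable, ?_⟩
    (cube_mono ((Nat.le_ceil R).trans (Nat.cast_le.2 (Nat.le_succ _))))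
  exact (setLIntegral_le_of_notMem_iUnion_exceedanceSet hy (Nat.succ_pos _)).trans_lt
    (ENNReal.mul_lt_top ha.lt_top (volume_cube_ne_top _).lt_top)

lemma tendsto_cubeAverage_vadd_sub {F : Y → ℝ} (hF : Measurable F) {C : ℝ} (hC : ∀ y, |F y| ≤ C)
    (g : Space d) (y : Y) :
    Tendsto (fun R => cubeAverage d F R (g +ᵥ y) - cubeAverage d F R y) atTop (𝓝 0) := by
  obtain ⟨c, hc, hgc⟩ := exists_subset_cube (Bornology.isBounded_singleton (x := g))
  rw [Set.singleton_subset_iff] at hgc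
  have hlim : Tendsto (fun R : ℝ => 2 * C * ((R + c) ^ d / R ^ d - 1)) atTop (𝓝 0) := by
    simpa using ((tendsto_add_pow_div_pow d c).sub_const 1).const_mul (2 * C)
  refine squeeze_zero_norm' ?_ hlim
  filter_upwards [eventually_gt_atTop 0] with R hR
  have hnear {s : Set (Space d)} (hs : MeasurableSet s) (hsub : s ⊆ cube d (R + c))
      (hvol : volume.real s = R ^ d) :
      |(∫ t in cube d (R + c), F (t +ᵥ y)) - ∫ t in s, F (t +ᵥ y)| ≤ C * ((R + c) ^ d - R ^ d) := by
    rw [← hvol, ← volume_real_cube (by positivity : 0 ≤ R + c)]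
    exact norm_setIntegral_sub_setIntegral_le hs hsub (volume_cube_ne_top _)
      (integrableOn_cube_vadd hF hC _ y) fun t _ => hC _
  have hcube := abs_le.1 <| hnear (measurableSet_cube R)
    (cube_mono (le_add_of_nonneg_right hc.le)) (volume_real_cube hR.le)
  have htranslate := abs_le.1 <| hnear (isOpen_image_add_cube g R).measurableSet
    (by rintro _ ⟨x, hx, rfl⟩; exact add_mem_cube hgc hx (by linarith))
    (by rw [measureReal_def, measure_image_add_left, ← measureReal_def, volume_real_cube hR.le])
  rw [cubeAverage, cubeAverage, setIntegral_vadd_vadd, ← mul_sub, Real.norm_eq_abs, abs_mul,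
    abs_of_pos (by positivity), inv_mul_le_iff₀ (by positivity),
    show R ^ d * (2 * C * ((R + c) ^ d / R ^ d - 1)) = 2 * (C * ((R + c) ^ d - R ^ d)) by
      field_simp, abs_le]
  constructor <;> linarith

/-- Bounded measurable functions whose averages over cubes tend to zero along every orbit. They
are the functions for which the ergodic theorem is trivial, and in the ergodic case they are dense
in the functions of mean zero. -/
structure HasNullAverages (d : ℕ) {Y : Type*} [AddAction (Space d) Y] [MeasurableSpace Y]
    (v : Y → ℝ) : Prop where
  measurable : Measurable v
  bounded : ∃ C, ∀ y, |v y| ≤ C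
  tendsto : ∀ y, Tendsto (fun R => cubeAverage d v R y) atTop (𝓝 0)

namespace HasNullAverages

omit [MeasurableVAdd₂ (Space d) Y] in
lemma zero : HasNullAverages d (0 : Y → ℝ) :=
  ⟨measurable_const, ⟨0, fun y => by simp⟩, fun y => by simp [cubeAverage]⟩

lemma integrableOn_cube_vadd {v : Y → ℝ} (hv : HasNullAverages d v) (R : ℝ) (y : Y) :
    IntegrableOn (fun t : Space d => v (t +ᵥ y)) (cube d R) :=
  let ⟨_, hC⟩ := hv.bounded
  PointProcess.integrableOn_cube_vadd hv.measurable hC R y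

lemma add {v w : Y → ℝ} (hv : HasNullAverages d v) (hw : HasNullAverages d w) :
    HasNullAverages d (v + w) where
  measurable := hv.measurable.add hw.measurable
  bounded :=
    let ⟨C, hC⟩ := hv.bounded
    let ⟨D, hD⟩ := hw.bounded
    ⟨C + D, fun y => (abs_add_le _ _).trans (add_le_add (hC y) (hD y))⟩
  tendsto y := by
    simpa only [add_zero, cubeAverage_add (hv.integrableOn_cube_vadd _ y)
      (hw.integrableOn_cube_vadd _ y)] using (hv.tendsto y).add (hw.tendsto y)

omit [MeasurableVAdd₂ (Space d) Y] in
lemma smul {v : Y → ℝ} (hv : HasNullAverages d v) (c : ℝ) : HasNullAverages d (c • v) where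
  measurable := hv.measurable.const_smul c
  bounded :=
    let ⟨C, hC⟩ := hv.bounded
    ⟨|c| * C, fun y => by
      rw [Pi.smul_apply, smul_eq_mul, abs_mul]
      exact mul_le_mul_of_nonneg_left (hC y) (abs_nonneg _)⟩
  tendsto y := by simpa only [mul_zero, cubeAverage_smul] using (hv.tendsto y).const_mul c

lemma coboundary {F : Y → ℝ} (hF : Measurable F) {C : ℝ} (hC : ∀ y, |F y| ≤ C) (g : Space d) :
    HasNullAverages d fun y => F (g +ᵥ y) - F y where
  measurable := (hF.comp (measurable_const_vadd g)).sub hF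
  bounded := ⟨C + C, fun y => (abs_sub _ _).trans (add_le_add (hC _) (hC _))⟩
  tendsto y := by
    refine (tendsto_cubeAverage_vadd_sub hF hC g y).congr fun R => ?_
    have hcomm (t : Space d) : g +ᵥ (t +ᵥ y) = t +ᵥ (g +ᵥ y) := vadd_comm _ _ _
    simp only [cubeAverage, hcomm]
    rw [integral_sub (PointProcess.integrableOn_cube_vadd hF hC R _)
      (PointProcess.integrableOn_cube_vadd hF hC R _), mul_sub]

end HasNullAverages

/-- The classes in `L²` of the functions in `HasNullAverages`. -/
def nullAverages (d : ℕ) {Y : Type*} [AddAction (Space d) Y] [MeasurableSpace Y]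
    [MeasurableVAdd₂ (Space d) Y] (μ : Measure Y) : Submodule ℝ (Lp ℝ 2 μ) where
  carrier := {g | ∃ v, HasNullAverages d v ∧ g =ᵐ[μ] v}
  add_mem' := by
    rintro g h ⟨v, hv, hgv⟩ ⟨w, hw, hhw⟩
    exact ⟨v + w, hv.add hw, (Lp.coeFn_add g h).trans (hgv.add hhw)⟩
  zero_mem' := ⟨0, .zero, Lp.coeFn_zero _ _ _⟩
  smul_mem' := by
    rintro c g ⟨v, hv, hgv⟩
    exact ⟨c • v, hv.smul c, (Lp.coeFn_smul c g).trans (hgv.const_smul c)⟩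

variable {μ : Measure Y} [IsProbabilityMeasure μ] [ErgodicVAdd (Space d) Y μ]

lemma exists_ae_eq_const_of_mem_orthogonal_nullAverages {k : Lp ℝ 2 μ}
    (hk : k ∈ (nullAverages d μ)ᗮ) : ∃ c : ℝ, k =ᵐ[μ] fun _ => c := by
  refine exists_ae_eq_const_of_forall_ae_vadd_eq (G := Space d) (Lp.stronglyMeasurable k).measurable
    fun g => ae_vadd_eq_of_forall_setIntegral_eq ((Lp.memLp k).integrable one_le_two)
      fun A hA => ?_
  have hgA : MeasurableSet ((g +ᵥ ·) ⁻¹' A) := measurable_const_vadd g hA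
  have hmem : indicatorConstLp 2 hgA (measure_ne_top μ _) (1 : ℝ) -
      indicatorConstLp 2 hA (measure_ne_top μ _) (1 : ℝ) ∈ nullAverages d μ := by
    have hbound (y : Y) : |A.indicator (fun _ => (1 : ℝ)) y| ≤ 1 := by
      by_cases hy : y ∈ A <;> simp [hy]
    exact ⟨_, .coboundary (measurable_const.indicator hA) hbound g,
      (Lp.coeFn_sub _ _).trans (indicatorConstLp_coeFn.sub indicatorConstLp_coeFn)⟩
  have horth := (Submodule.mem_orthogonal _ _).1 hk _ hmem
  rwa [inner_sub_left, L2.inner_indicatorConstLp_one, L2.inner_indicatorConstLp_one,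
    sub_eq_zero] at horth

lemma toLp_sub_integral_mem_topologicalClosure_nullAverages {F : Y → ℝ} (hF : MemLp F 2 μ) :
    (hF.sub (memLp_const (∫ z, F z ∂μ))).toLp _ ∈ (nullAverages d μ).topologicalClosure := by
  rw [← Submodule.orthogonal_orthogonal_eq_closure, Submodule.mem_orthogonal]
  intro k hk
  obtain ⟨a, ha⟩ := exists_ae_eq_const_of_mem_orthogonal_nullAverages hk
  set hL := hF.sub (memLp_const (∫ z, F z ∂μ))
  calc inner ℝ k (hL.toLp _) = ∫ y, a * (F y - ∫ z, F z ∂μ) ∂μ := by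
        rw [L2.inner_def]
        refine integral_congr_ae ?_
        filter_upwards [ha, hL.coeFn_toLp] with y hky hFy
        rw [hky, hFy]
        exact mul_comm _ _
    _ = 0 := by
        rw [integral_const_mul, integral_sub (hF.integrable one_le_two) (integrable_const _)]
        simp

lemma exists_hasNullAverages_eLpNorm_lt_of_memLp_two {F : Y → ℝ} (hF : MemLp F 2 μ) {ε : ℝ≥0∞}
    (hε : ε ≠ 0) :
    ∃ v, HasNullAverages d v ∧ eLpNorm (fun y => F y - ∫ z, F z ∂μ - v y) 1 μ < ε := by
  set hL := hF.sub (memLp_const (∫ z, F z ∂μ))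
  obtain ⟨g, ⟨v, hv, hgv⟩, hd⟩ := EMetric.mem_closure_iff.1
    (toLp_sub_integral_mem_topologicalClosure_nullAverages (d := d) hF) ε (pos_iff_ne_zero.2 hε)
  refine ⟨v, hv, lt_of_le_of_lt ?_ hd⟩
  calc eLpNorm (fun y => F y - ∫ z, F z ∂μ - v y) 1 μ
      ≤ eLpNorm (fun y => F y - ∫ z, F z ∂μ - v y) 2 μ :=
        eLpNorm_le_eLpNorm_of_exponent_le one_le_two
          (hL.aestronglyMeasurable.sub hv.measurable.aestronglyMeasurable)
    _ = edist (hL.toLp _) g := by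
        rw [Lp.edist_def]
        refine eLpNorm_congr_ae ?_
        filter_upwards [hgv, hL.coeFn_toLp] with y hgy hFy
        rw [Pi.sub_apply, hgy, hFy]
        rfl

lemma exists_hasNullAverages_eLpNorm_lt {F : Y → ℝ} (hF : Integrable F μ) {ε : ℝ≥0∞}
    (hε : ε ≠ 0) :
    ∃ v, HasNullAverages d v ∧ eLpNorm (fun y => F y - ∫ z, F z ∂μ - v y) 1 μ < ε := by
  have hε3 : ε / 3 ≠ 0 := by simpa using hε
  obtain ⟨G, hFG, hG⟩ : ∃ G : Y → ℝ, eLpNorm (F - G) 1 μ < ε / 3 ∧ MemLp G 2 μ := by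
    obtain ⟨G, hFG, -⟩ := (memLp_one_iff_integrable.2 hF).exists_simpleFunc_eLpNorm_sub_lt
      ENNReal.one_ne_top hε3
    exact ⟨G, hFG, G.memLp_of_isFiniteMeasure 2 μ⟩
  obtain ⟨v, hv, hGv⟩ := exists_hasNullAverages_eLpNorm_lt_of_memLp_two (d := d) hG hε3
  have hGi : Integrable G μ := hG.integrable one_le_two
  have hmean : eLpNorm (fun _ : Y => ∫ z, G z ∂μ - ∫ z, F z ∂μ) 1 μ < ε / 3 := by
    refine lt_of_le_of_lt ?_ hFG
    rw [eLpNorm_const _ one_ne_zero (NeZero.ne μ), measure_univ, ENNReal.one_rpow, mul_one,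
      ← integral_sub hGi hF, eLpNorm_sub_comm, eLpNorm_one_eq_lintegral_enorm]
    exact enorm_integral_le_lintegral_enorm _
  have hGm : AEStronglyMeasurable (fun y => G y - ∫ z, G z ∂μ - v y) μ :=
    (hGi.aestronglyMeasurable.sub aestronglyMeasurable_const).sub hv.measurable.aestronglyMeasurable
  refine ⟨v, hv, ?_⟩
  calc eLpNorm (fun y => F y - ∫ z, F z ∂μ - v y) 1 μ
      = eLpNorm ((F - G) + ((fun y => G y - ∫ z, G z ∂μ - v y) +
          fun _ => ∫ z, G z ∂μ - ∫ z, F z ∂μ)) 1 μ := by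
        congr 1
        funext y
        simp only [Pi.add_apply, Pi.sub_apply]
        ring
    _ ≤ eLpNorm (F - G) 1 μ + (eLpNorm (fun y => G y - ∫ z, G z ∂μ - v y) 1 μ +
          eLpNorm (fun _ => ∫ z, G z ∂μ - ∫ z, F z ∂μ) 1 μ) :=
        (eLpNorm_add_le (hF.sub hGi).aestronglyMeasurable (hGm.add aestronglyMeasurable_const)
          le_rfl).trans (by gcongr; exact eLpNorm_add_le hGm aestronglyMeasurable_const le_rfl)
    _ < ε / 3 + (ε / 3 + ε / 3) := by gcongr
    _ = ε := by rw [← add_assoc, ENNReal.add_thirds]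

omit [IsProbabilityMeasure μ] [ErgodicVAdd (Space d) Y μ] in
lemma eventually_abs_cubeAverage_sub_le {F v : Y → ℝ} (hF : Measurable F)
    (hv : HasNullAverages d v) (c : ℝ) {a : ℝ} (ha : 0 < a) {y : Y}
    (hy : y ∉ ⋃ N, exceedanceSet d (fun z => ‖F z - c - v z‖ₑ) (ENNReal.ofReal a) N) :
    ∀ᶠ R in atTop, |cubeAverage d F R y - c| ≤ (2 ^ d + 1) * a := by
  set e : Y → ℝ := fun z => F z - c - v z with he
  have hem : Measurable e := (hF.sub_const c).sub hv.measurable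
  have hv0 : ∀ᶠ R in atTop, |cubeAverage d v R y| < a :=
    (abs_zero (α := ℝ) ▸ (hv.tendsto y).abs).eventually_lt_const ha
  filter_upwards [hv0, eventually_ge_atTop 1] with R hvR hR
  have heR := abs_cubeAverage_le_of_notMem_iUnion_exceedanceSet ha.le hy hR
  have hei := integrableOn_cube_vadd_of_notMem_iUnion_exceedanceSet hem ENNReal.ofReal_ne_top hy R
  have hvi := hv.integrableOn_cube_vadd R y
  have hFe : F = e + (v + fun _ => c) := by
    funext z
    simp only [he, Pi.add_apply]
    ring
  have hsplit : cubeAverage d F R y = cubeAverage d e R y + (cubeAverage d v R y + c) := by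
    have hci : IntegrableOn (fun _ : Space d => c) (cube d R) :=
      integrableOn_const (volume_cube_ne_top R)
    conv_lhs => rw [hFe]
    rw [cubeAverage_add hei (hvi.add hci), cubeAverage_add hvi hci,
      cubeAverage_const c (by linarith)]
  calc |cubeAverage d F R y - c| = |cubeAverage d e R y + cubeAverage d v R y| := by
        rw [hsplit]; ring_nf
    _ ≤ |cubeAverage d e R y| + |cubeAverage d v R y| := abs_add_le _ _
    _ ≤ (2 ^ d + 1) * a := by linarith

lemma ae_eventually_abs_cubeAverage_sub_integral_le {F : Y → ℝ} (hF : Measurable F)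
    (hFi : Integrable F μ) {a : ℝ} (ha : 0 < a) :
    ∀ᵐ y ∂μ, ∀ᶠ R in atTop, |cubeAverage d F R y - ∫ z, F z ∂μ| ≤ (2 ^ d + 1) * a := by
  have ha' : ENNReal.ofReal a ≠ 0 := (ENNReal.ofReal_pos.2 ha).ne'
  have h3 : (3 : ℝ≥0∞) ^ d ≠ ∞ := by finiteness
  refine ae_iff.2 (nonpos_iff_eq_zero.1 (le_of_forall_gt_imp_ge_of_dense fun δ hδ => ?_))
  obtain ⟨v, hv, hlt⟩ := exists_hasNullAverages_eLpNorm_lt (d := d) hFi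
    (ENNReal.div_pos (mul_ne_zero ha' hδ.ne') h3).ne'
  set G : Y → ℝ≥0∞ := fun z => ‖F z - ∫ z, F z ∂μ - v z‖ₑ
  have hG : Measurable G := ((hF.sub_const _).sub hv.measurable).enorm
  have hmax : ENNReal.ofReal a * μ (⋃ N, exceedanceSet d G (ENNReal.ofReal a) N) ≤
      ENNReal.ofReal a * δ :=
    calc _ ≤ 3 ^ d * ∫⁻ y, G y ∂μ := mul_measure_iUnion_exceedanceSet_le hG _
      _ ≤ 3 ^ d * (ENNReal.ofReal a * δ / 3 ^ d) := by
          gcongr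
          exact eLpNorm_one_eq_lintegral_enorm.symm.trans_le hlt.le
      _ = ENNReal.ofReal a * δ := ENNReal.mul_div_cancel (by positivity) h3
  refine (measure_mono fun y hy => ?_).trans
    ((ENNReal.mul_le_mul_iff_right ha' ENNReal.ofReal_ne_top).1 hmax)
  by_contra hyG
  exact hy (eventually_abs_cubeAverage_sub_le hF hv _ ha hyG)

theorem ae_tendsto_cubeAverage {F : Y → ℝ} (hF : Measurable F) (hFi : Integrable F μ) :
    ∀ᵐ y ∂μ, Tendsto (fun R => cubeAverage d F R y) atTop (𝓝 (∫ z, F z ∂μ)) := by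
  have hall : ∀ᵐ y ∂μ, ∀ k : ℕ, ∀ᶠ R in atTop,
      |cubeAverage d F R y - ∫ z, F z ∂μ| ≤ (2 ^ d + 1) * (1 / ((k : ℝ) + 1)) :=
    ae_all_iff.2 fun k => ae_eventually_abs_cubeAverage_sub_integral_le hF hFi (by positivity)
  have hlim : Tendsto (fun k : ℕ => (2 ^ d + 1 : ℝ) * (1 / ((k : ℝ) + 1))) atTop (𝓝 0) := by
    simpa using tendsto_one_div_add_atTop_nhds_zero_nat.const_mul (2 ^ d + 1 : ℝ)
  filter_upwards [hall] with y hy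
  refine Metric.tendsto_nhds.2 fun ε hε => ?_
  obtain ⟨k, hk⟩ := (hlim.eventually_lt_const hε).exists
  filter_upwards [hy k] with R hR
  exact hR.trans_lt hk

end PointwiseErgodicTheorem

section CompactSupport

variable {E : Type*} [TopologicalSpace E]

lemma exists_cutoff [T2Space E] [LocallyCompactSpace E] {K U : Set E} (hK : IsCompact K)
    (hU : IsOpen U) (hKU : K ⊆ U) :
    ∃ ψ : C_c(E, ℝ), Set.EqOn ψ 1 K ∧ tsupport ψ ⊆ U ∧ ∀ x, ψ x ∈ Set.Icc 0 1 := by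
  obtain ⟨f, hf1, hfc, hfU, hf⟩ := exists_continuousMap_one_of_isCompact_subset_isOpen hK hU hKU
  exact ⟨⟨f, hfc⟩, hf1, hfU, hf⟩

lemma abs_sub_le_mul_cutoff {K : Set E} {ψ : C_c(E, ℝ)} (hψK : Set.EqOn ψ 1 K)
    (hψ : ∀ x, 0 ≤ ψ x) {ε : ℝ} (hε : 0 ≤ ε) {f g : E → ℝ} (hK : ∀ x ∈ K, |f x - g x| ≤ ε)
    (hf : ∀ x ∉ K, f x = 0) (hg : ∀ x ∉ K, g x = 0) (x : E) : |f x - g x| ≤ ε * ψ x := by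
  by_cases hx : x ∈ K
  · simpa [hψK hx] using hK x hx
  · simpa [hf x hx, hg x hx] using mul_nonneg hε (hψ x)

lemma exists_countable_dense_of_tsupport_subset [T2Space E] [LocallyCompactSpace E]
    [SecondCountableTopology E] {K : Set E} (hK : IsCompact K) :
    ∃ D : Set C_c(E, ℝ), D.Countable ∧ ∀ f : C_c(E, ℝ), tsupport f ⊆ K →
      ∀ ε : ℝ, 0 < ε → ∃ g ∈ D, tsupport g ⊆ K ∧ ∀ x ∈ K, |f x - g x| ≤ ε := by
  have : CompactSpace K := isCompact_iff_compactSpace.1 hK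
  let T : Type _ := {f : C_c(E, ℝ) // tsupport f ⊆ K}
  let toMap : T → C(E, ℝ) := fun f => f.1.toContinuousMap
  let restr : T → C(K, ℝ) := fun f => (toMap f).restrict K
  let _ : TopologicalSpace T := .induced toMap inferInstance
  have : SecondCountableTopology T := TopologicalSpace.secondCountableTopology_induced _ _ _
  have hrestr : Continuous restr :=
    (ContinuousMap.continuous_restrict K).comp continuous_induced_dom
  obtain ⟨D, hDc, hD⟩ := TopologicalSpace.exists_countable_dense T
  refine ⟨Subtype.val '' D, hDc.image _, fun f hf ε hε => ?_⟩
  obtain ⟨g, hg, hgD⟩ := hD.inter_open_nonempty {g : T | dist (restr ⟨f, hf⟩) (restr g) < ε}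
    (isOpen_lt (continuous_const.dist hrestr) continuous_const) ⟨⟨f, hf⟩, by simpa using hε⟩
  refine ⟨g.1, ⟨g, hgD, rfl⟩, g.2, fun x hx => ?_⟩
  exact (ContinuousMap.dist_apply_le_dist (f := restr ⟨f, hf⟩) (g := restr g) ⟨x, hx⟩).trans
    (le_of_lt hg)

lemma exists_countable_approx [T2Space E] [LocallyCompactSpace E] [SecondCountableTopology E] :
    ∃ S : Set C_c(E, ℝ), S.Countable ∧ ∀ f : C_c(E, ℝ), ∃ ψ ∈ S,
      ∀ ε : ℝ, 0 < ε → ∃ g ∈ S, ∀ x, |f x - g x| ≤ ε * ψ x := by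
  let K : CompactExhaustion E := default
  choose ψ hψK _ hψ using fun n =>
    exists_cutoff (K.isCompact n) isOpen_univ (Set.subset_univ (K n))
  choose D hDc hD using fun n => exists_countable_dense_of_tsupport_subset (K.isCompact n)
  refine ⟨Set.range ψ ∪ ⋃ n, D n, (Set.countable_range ψ).union (Set.countable_iUnion hDc),
    fun f => ?_⟩
  obtain ⟨n, hn⟩ := K.exists_superset_of_isCompact f.hasCompactSupport
  refine ⟨ψ n, .inl ⟨n, rfl⟩, fun ε hε => ?_⟩
  obtain ⟨g, hgD, hgK, hg⟩ := hD n f hn ε hε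
  exact ⟨g, .inr (Set.mem_iUnion.2 ⟨n, hgD⟩), abs_sub_le_mul_cutoff (hψK n) (fun x => (hψ n x).1)
    hε.le hg (fun x hx => image_eq_zero_of_notMem_tsupport fun h => hx (hn h))
    fun x hx => image_eq_zero_of_notMem_tsupport fun h => hx (hgK h)⟩

end CompactSupport

section VagueTopology

variable {E : Type*} [TopologicalSpace E] [MeasurableSpace E] [BorelSpace E]

lemma integrable_compactlySupported (ν : Measure E) [IsFiniteMeasureOnCompacts ν] {F : Type*}
    [NormedAddCommGroup F] (f : C_c(E, F)) : Integrable f ν :=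
  f.continuous.integrable_of_hasCompactSupport f.hasCompactSupport

lemma norm_integral_sub_le_mul_integral {F : Type*} [NormedAddCommGroup F] [NormedSpace ℝ F]
    {ν : Measure E} [IsFiniteMeasureOnCompacts ν] {f : E → F} (hf : AEStronglyMeasurable f ν)
    {g : C_c(E, F)} {ψ : E → ℝ} (hψ : Integrable ψ ν) {ε : ℝ}
    (h : ∀ x, ‖f x - g x‖ ≤ ε * ψ x) :
    ‖∫ x, f x ∂ν - ∫ x, g x ∂ν‖ ≤ ε * ∫ x, ψ x ∂ν := by
  have hg := integrable_compactlySupported ν g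
  have hfg : Integrable (fun x => f x - g x) ν :=
    (hψ.const_mul ε).mono' (hf.sub hg.aestronglyMeasurable) (ae_of_all _ h)
  have hfi : Integrable f ν := (hfg.add hg).congr (ae_of_all _ fun x => sub_add_cancel (f x) (g x))
  rw [← integral_sub hfi hg, ← integral_const_mul]
  exact norm_integral_le_of_norm_le (hψ.const_mul ε) (ae_of_all _ h)

lemma tendsto_integral_of_approx {F : Type*} [NormedAddCommGroup F] [NormedSpace ℝ F]
    {ι : Type*} {l : Filter ι} {ν : ι → Measure E} [∀ i, IsFiniteMeasureOnCompacts (ν i)]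
    {ρ : Measure E} [IsFiniteMeasureOnCompacts ρ] {ψ : E → ℝ} {C : ℝ} (hψρ : Integrable ψ ρ)
    (hψ : ∀ᶠ i in l, Integrable ψ (ν i) ∧ ∫ x, ψ x ∂(ν i) ≤ C) {f : ι → E → F} {f₀ : E → F}
    (hf : ∀ i, AEStronglyMeasurable (f i) (ν i)) (hf₀ : AEStronglyMeasurable f₀ ρ)
    (h : ∀ ε : ℝ, 0 < ε → ∃ g : C_c(E, F), (∀ x, ‖f₀ x - g x‖ ≤ ε * ψ x) ∧
      (∀ᶠ i in l, ∀ x, ‖f i x - g x‖ ≤ ε * ψ x) ∧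
      Tendsto (fun i => ∫ x, g x ∂(ν i)) l (𝓝 (∫ x, g x ∂ρ))) :
    Tendsto (fun i => ∫ x, f i x ∂(ν i)) l (𝓝 (∫ x, f₀ x ∂ρ)) := by
  rw [Metric.tendsto_nhds]
  intro ε hε
  set B := |C| + |∫ x, ψ x ∂ρ| + 1
  have hB : 0 < B := by positivity
  have hδ : 0 < ε / (3 * B) := by positivity
  have hδB : ε / (3 * B) * B = ε / 3 := by field_simp
  obtain ⟨g, hgf₀, hgf, hg⟩ := h _ hδ
  have hδψ : ∀ {c}, c ≤ B → ε / (3 * B) * c ≤ ε / 3 := fun hc =>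
    (mul_le_mul_of_nonneg_left hc hδ.le).trans_eq hδB
  have hρ := (norm_integral_sub_le_mul_integral hf₀ hψρ hgf₀).trans
    (hδψ (by linarith [le_abs_self (∫ x, ψ x ∂ρ), abs_nonneg C]))
  filter_upwards [hψ, hgf, Metric.tendsto_nhds.1 hg (ε / 3) (by positivity)]
    with i ⟨hψi, hCi⟩ hi hgi
  have hνi := (norm_integral_sub_le_mul_integral (hf i) hψi hi).trans
    (hδψ (by linarith [le_abs_self C, abs_nonneg (∫ x, ψ x ∂ρ)]))
  rw [← dist_eq_norm] at hρ hνi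
  calc dist (∫ x, f i x ∂(ν i)) (∫ x, f₀ x ∂ρ)
      ≤ dist (∫ x, f i x ∂(ν i)) (∫ x, g x ∂(ν i)) + dist (∫ x, g x ∂(ν i)) (∫ x, g x ∂ρ) +
        dist (∫ x, g x ∂ρ) (∫ x, f₀ x ∂ρ) := dist_triangle4 _ _ _ _
    _ < ε := by rw [dist_comm (∫ x, g x ∂ρ)]; linarith

variable {Z : Type*} [TopologicalSpace Z] {ν : Z → Measure E}
  [∀ z, IsFiniteMeasureOnCompacts (ν z)]

lemma continuous_integral_of_forall_mem {S : Set C_c(E, ℝ)}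
    (hS : ∀ f : C_c(E, ℝ), ∃ ψ ∈ S, ∀ ε : ℝ, 0 < ε → ∃ g ∈ S, ∀ x, |f x - g x| ≤ ε * ψ x)
    (hν : ∀ f ∈ S, Continuous fun z => ∫ x, f x ∂(ν z)) (f : C_c(E, ℝ)) :
    Continuous fun z => ∫ x, f x ∂(ν z) := by
  refine continuous_iff_continuousAt.2 fun z₀ => ?_
  obtain ⟨ψ, hψS, hψ⟩ := hS f
  refine tendsto_integral_of_approx (integrable_compactlySupported _ ψ)
    (((hν ψ hψS).tendsto z₀).eventually_lt_const (lt_add_one _) |>.mono fun z hz =>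
      ⟨integrable_compactlySupported _ ψ, hz.le⟩)
    (fun z => (integrable_compactlySupported _ f).aestronglyMeasurable)
    (integrable_compactlySupported _ f).aestronglyMeasurable fun ε hε => ?_
  obtain ⟨g, hgS, hg⟩ := hψ ε hε
  exact ⟨g, hg, Eventually.of_forall fun _ => hg, (hν g hgS).tendsto z₀⟩

theorem continuous_integral_parametric [T2Space E] [LocallyCompactSpace E]
    (hν : ∀ f : C_c(E, ℝ), Continuous fun z => ∫ x, f x ∂(ν z)) {h : Z → E → ℝ}
    (hh : Continuous fun q : Z × E => h q.1 q.2)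
    (hK : ∀ z₀, ∃ K, IsCompact K ∧ ∀ᶠ z in 𝓝 z₀, ∀ x ∉ K, h z x = 0) :
    Continuous fun z => ∫ x, h z x ∂(ν z) := by
  refine continuous_iff_continuousAt.2 fun z₀ => ?_
  obtain ⟨K, hKc, hKs⟩ := hK z₀
  obtain ⟨ψ, hψK, -, hψ⟩ := exists_cutoff hKc isOpen_univ (Set.subset_univ K)
  have hcont : ∀ z, Continuous (h z) := fun z => hh.comp (f := fun x => (z, x)) (by fun_prop)
  have hz₀ := hKs.self_of_nhds
  let f₀ : C_c(E, ℝ) := ⟨⟨h z₀, hcont z₀⟩, HasCompactSupport.intro hKc hz₀⟩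
  refine tendsto_integral_of_approx (integrable_compactlySupported _ ψ)
    (((hν ψ).tendsto z₀).eventually_lt_const (lt_add_one _) |>.mono fun z hz =>
      ⟨integrable_compactlySupported _ ψ, hz.le⟩)
    (fun z => (hcont z).aestronglyMeasurable) (hcont z₀).aestronglyMeasurable fun ε hε => ?_
  have hunif : ∀ᶠ z in 𝓝 z₀, ∀ x ∈ K, |h z x - h z₀ x| < ε := by
    refine hKc.eventually_forall_of_forall_eventually fun x _ => ?_
    have : Continuous fun q : Z × E => |h q.1 q.2 - h z₀ q.2| :=
      (hh.sub ((hcont z₀).comp continuous_snd)).abs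
    exact (this.tendsto (z₀, x)).eventually_lt_const (by simpa using hε)
  refine ⟨f₀, fun x => by simpa [f₀] using mul_nonneg hε.le (hψ x).1, ?_, (hν f₀).tendsto z₀⟩
  filter_upwards [hKs, hunif] with z hzK hz
  exact abs_sub_le_mul_cutoff hψK (fun x => (hψ x).1) hε.le (fun x hx => (hz x hx).le) hzK hz₀

end VagueTopology

section MeasurabilityOfMeasures

variable {E : Type*} [TopologicalSpace E] [MeasurableSpace E] [BorelSpace E]
  [LocallyCompactSpace E] [SecondCountableTopology E]

variable {Z : Type*} [MeasurableSpace Z] {ν : Z → Measure E}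
  [∀ z, IsFiniteMeasureOnCompacts (ν z)]

lemma measurable_of_measurable_measure_isCompact
    (h : ∀ K, IsCompact K → Measurable fun z => ν z K) : Measurable ν := by
  let K := compactCovering E
  have hK : ∀ n, IsCompact (K n) := isCompact_compactCovering E
  have hrestrict : ∀ n, Measurable fun z => (ν z).restrict (K n) := fun n => by
    have : ∀ z, IsFiniteMeasure ((ν z).restrict (K n)) := fun z =>
      isFiniteMeasure_restrict.2 (hK n).measure_ne_top
    refine Measurable.measure_of_isPiSystem (S := {s | IsClosed s})
      (BorelSpace.measurable_eq.trans borel_eq_generateFrom_isClosed) isPiSystem_isClosed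
      (fun s (hs : IsClosed s) => ?_) (by simpa using h _ (hK n))
    simpa only [Measure.restrict_apply hs.measurableSet] using h _ ((hK n).inter_left hs)
  refine Measure.measurable_of_measurable_coe _ fun A hA => ?_
  have hsup : ∀ z, ν z A = ⨆ n, (ν z).restrict (K n) A := fun z => by
    have hA_eq : A = ⋃ n, A ∩ K n := by
      rw [← Set.inter_iUnion, iUnion_compactCovering, Set.inter_univ]
    simp only [Measure.restrict_apply hA]
    conv_lhs => rw [hA_eq]
    exact Monotone.measure_iUnion fun i j hij =>
      Set.inter_subset_inter_right _ (compactCovering_subset E hij)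
  simp only [hsup]
  exact Measurable.iSup fun n => (Measure.measurable_coe hA).comp (hrestrict n)

variable [T2Space E]

/-- The indicator function of a compact `Gδ` is the decreasing limit of the powers of one
compactly supported function. -/
lemma exists_seq_tendsto_integral_measureReal {K : Set E} (hK : IsCompact K) (hKδ : IsGδ K) :
    ∃ g : ℕ → C_c(E, ℝ), ∀ (ν : Measure E) [IsFiniteMeasureOnCompacts ν],
      Tendsto (fun n => ∫ x, g n x ∂ν) atTop (𝓝 (ν.real K)) := by
  obtain ⟨f, hfK, -, hfc, hf⟩ := exists_continuous_one_zero_of_isCompact_of_isGδ hK hKδ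
    isClosed_empty (Set.disjoint_empty K)
  refine ⟨fun n => ⟨⟨fun x => f x ^ (n + 1), by fun_prop⟩,
    hfc.comp_left (g := fun y : ℝ => y ^ (n + 1)) (by simp)⟩, fun ν _ => ?_⟩
  rw [← integral_indicator_one hK.measurableSet]
  refine tendsto_integral_of_dominated_convergence f (fun n => by fun_prop)
    (f.continuous.integrable_of_hasCompactSupport hfc) (fun n => ae_of_all _ fun x => ?_)
    (ae_of_all _ fun x => ?_)
  · simp only [CompactlySupportedContinuousMap.coe_mk, ContinuousMap.coe_mk]
    rw [Real.norm_of_nonneg (pow_nonneg (hf x).1 _)]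
    exact pow_le_of_le_one (hf x).1 (hf x).2 n.succ_ne_zero
  · by_cases hx : x ∈ K
    · have : f x = 1 := by rwa [hfK] at hx
      simp [this, hx]
    · have : f x < 1 := (hf x).2.lt_of_ne fun h => hx (by rwa [hfK])
      rw [Set.indicator_of_notMem hx]
      exact (tendsto_pow_atTop_nhds_zero_of_lt_one (hf x).1 this).comp (tendsto_add_atTop_nat 1)

theorem measurable_of_measurable_integral
    (h : ∀ f : C_c(E, ℝ), Measurable fun z => ∫ x, f x ∂(ν z)) : Measurable ν := by
  refine measurable_of_measurable_measure_isCompact fun K hK => ?_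
  let _ := TopologicalSpace.pseudoMetrizableSpacePseudoMetric E
  obtain ⟨g, hg⟩ := exists_seq_tendsto_integral_measureReal hK hK.isClosed.isGδ
  have hreal : Measurable fun z => (ν z).real K :=
    measurable_of_tendsto_metrizable (fun n => h (g n)) (tendsto_pi_nhds.2 fun z => hg (ν z))
  simpa only [ofReal_measureReal hK.measure_ne_top] using hreal.ennreal_ofReal

end MeasurabilityOfMeasures

section PointMeasureTopology

lemma PointMeasure.exists_measure_eq_natCast (lam : PointMeasure d m) {K : Set (ColSpace d m)}
    (hK : IsCompact K) : ∃ n : ℕ, lam.1 K = n :=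
  lam.2 K hK.measurableSet (by rwa [hK.isClosed.closure_eq])

instance (lam : PointMeasure d m) : IsFiniteMeasureOnCompacts lam.1 where
  lt_top_of_isCompact K hK := by
    obtain ⟨n, hn⟩ := lam.exists_measure_eq_natCast hK
    rw [hn]
    exact ENNReal.natCast_lt_top n

lemma isInducing_integral : IsInducing
    (fun (lam : PointMeasure d m) (f : C_c(ColSpace d m, ℝ)) => ∫ p, f p ∂lam.1) := ⟨rfl⟩

lemma continuous_integral (f : C_c(ColSpace d m, ℝ)) :
    Continuous fun lam : PointMeasure d m => ∫ p, f p ∂lam.1 :=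
  (continuous_apply f).comp isInducing_integral.continuous

instance : T2Space (PointMeasure d m) :=
  .of_injective_continuous (fun _ _ h => Subtype.ext <|
    Measure.ext_of_integral_eq_on_compactlySupported fun f => congrFun h f)
    isInducing_integral.continuous

instance : SecondCountableTopology (PointMeasure d m) := by
  obtain ⟨S, hSc, hS⟩ := exists_countable_approx (E := ColSpace d m)
  have : Countable S := hSc.to_subtype
  let ev : PointMeasure d m → S → ℝ := fun lam f => ∫ p, f.1 p ∂lam.1
  have hev : (inferInstance : TopologicalSpace (PointMeasure d m)) =
      .induced ev inferInstance := by
    refine le_antisymm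
      (continuous_iff_le_induced.1 (continuous_pi fun f => continuous_integral f.1)) ?_
    let _ : TopologicalSpace (PointMeasure d m) := .induced ev inferInstance
    exact continuous_iff_le_induced.1 <| continuous_pi <| continuous_integral_of_forall_mem hS
      fun f hf => continuous_pi_iff.1 (continuous_induced_dom (f := ev)) ⟨f, hf⟩
  have := TopologicalSpace.secondCountableTopology_induced _ _ ev
  rwa [← hev] at this

lemma measurable_val : Measurable fun lam : PointMeasure d m => lam.1 :=
  measurable_of_measurable_integral fun f => (continuous_integral f).measurable

lemma continuous_shift : Continuous fun q : Space d × ColSpace d m => shift m q.1 q.2 :=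
  show Continuous fun q : Space d × ColSpace d m => ((q.1 + q.2.1, q.2.2) : ColSpace d m) by
    fun_prop

lemma exists_isCompact_shift_notMem {C : Set (Space d)} (hC : IsCompact C)
    {K : Set (ColSpace d m)} (hK : IsCompact K) :
    ∃ K' : Set (ColSpace d m), IsCompact K' ∧ ∀ t ∈ C, ∀ p ∉ K', shift m t p ∉ K := by
  have hneg : Continuous fun q : Space d × ColSpace d m => shift m (-q.1) q.2 :=
    continuous_shift.comp (f := fun q : Space d × ColSpace d m => (-q.1, q.2)) (by fun_prop)
  refine ⟨_, (hC.prod hK).image hneg, fun t ht p hp hpK => hp ⟨(t, shift m t p), ⟨ht, hpK⟩, ?_⟩⟩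
  exact Prod.ext (neg_add_cancel_left t p.1) rfl

lemma integral_vadd (t : Space d) (lam : PointMeasure d m) {F : Type*} [NormedAddCommGroup F]
    [NormedSpace ℝ F] (f : ColSpace d m → F) :
    ∫ p, f p ∂(t +ᵥ lam).1 = ∫ p, f (shift m t p) ∂lam.1 :=
  (shift m t).toMeasurableEquiv.measurableEmbedding.integral_map f

instance : ContinuousVAdd (Space d) (PointMeasure d m) := by
  refine ⟨isInducing_integral.continuous_iff.2 (continuous_pi fun f => ?_)⟩
  have hf : Continuous fun q : (Space d × PointMeasure d m) × ColSpace d m =>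
      f (shift m q.1.1 q.2) :=
    f.continuous.comp (continuous_shift.comp
      ((continuous_fst.comp continuous_fst).prodMk continuous_snd))
  have hK : ∀ z₀ : Space d × PointMeasure d m, ∃ K : Set (ColSpace d m), IsCompact K ∧
      ∀ᶠ z in 𝓝 z₀, ∀ p ∉ K, f (shift m z.1 p) = 0 := fun z₀ => by
    obtain ⟨C, hC, hCz⟩ := exists_compact_mem_nhds z₀.1
    obtain ⟨K, hK, hCK⟩ := exists_isCompact_shift_notMem hC f.hasCompactSupport
    have hfst : ∀ᶠ z : Space d × PointMeasure d m in 𝓝 z₀, z.1 ∈ C :=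
      continuous_fst.continuousAt hCz
    exact ⟨K, hK, hfst.mono fun z hz p hp => image_eq_zero_of_notMem_tsupport (hCK z.1 hz p hp)⟩
  have hcont := continuous_integral_parametric
    (ν := fun z : Space d × PointMeasure d m => z.2.1)
    (fun g => (continuous_integral g).comp continuous_snd) hf hK
  exact hcont.congr fun z => (integral_vadd z.1 z.2 f).symm

instance {Y : Type*} [TopologicalSpace Y] [SecondCountableTopology Y] [MeasurableSpace Y]
    [BorelSpace Y] [AddAction (Space d) Y] [ContinuousVAdd (Space d) Y] :
    MeasurableVAdd₂ (Space d) Y := ⟨continuous_vadd.measurable⟩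

end PointMeasureTopology

section Kernel

open ProbabilityTheory

variable {α β : Type*} [MeasurableSpace α] [MeasurableSpace β]

lemma isSFiniteKernel_of_isFiniteMeasure (η : Kernel α β) [∀ a, IsFiniteMeasure (η a)] :
    IsSFiniteKernel η := by
  classical
  let size : α → ℕ := fun a => ⌊(η a).real Set.univ⌋₊
  have hsize : ∀ k, MeasurableSet (size ⁻¹' {k}) := fun k =>
    (η.measurable_coe .univ).ennreal_toReal.nat_floor (MeasurableSet.singleton k)
  have hsum : η = Kernel.sum fun k => Kernel.piecewise (hsize k) η 0 := by
    ext a s hs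
    rw [Kernel.sum_apply' _ _ hs, tsum_eq_single (size a)]
    · simp [Kernel.piecewise_apply]
    · intro k hk
      simp [Kernel.piecewise_apply, hk.symm]
  have hfin : ∀ k, IsFiniteKernel (Kernel.piecewise (hsize k) η 0) := fun k => by
    refine ⟨ENNReal.ofReal (k + 1), ENNReal.ofReal_lt_top, fun a => ?_⟩
    rw [Kernel.piecewise_apply]
    split_ifs with ha
    · rw [← ofReal_measureReal, ← (show size a = k from ha)]
      exact ENNReal.ofReal_le_ofReal (Nat.lt_floor_add_one _).le
    · simp
  rw [hsum]
  exact Kernel.isSFiniteKernel_sum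

lemma isSFiniteKernel_of_iUnion_eq_univ (η : Kernel α β) {s : ℕ → Set β}
    (hs : ∀ n, MeasurableSet (s n)) (hU : ⋃ n, s n = Set.univ) (hη : ∀ a n, η a (s n) < ∞) :
    IsSFiniteKernel η := by
  have hd : ∀ n, MeasurableSet (disjointed s n) := MeasurableSet.disjointed hs
  have hsum : η = Kernel.sum fun n => η.restrict (hd n) := by
    ext a t ht
    simp only [Kernel.sum_apply' _ _ ht, Kernel.restrict_apply' _ (hd _) _ ht]
    rw [← measure_iUnion (fun i j hij => (disjoint_disjointed s hij).mono
      Set.inter_subset_right Set.inter_subset_right) fun n => ht.inter (hd n),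
      ← Set.inter_iUnion, iUnion_disjointed, hU, Set.inter_univ]
  rw [hsum]
  refine Kernel.isSFiniteKernel_sum (hκs := fun n => ?_)
  have : ∀ a, IsFiniteMeasure (η.restrict (hd n) a) := fun a => by
    rw [Kernel.restrict_apply, isFiniteMeasure_restrict]
    exact ((measure_mono (disjointed_subset s n)).trans_lt (hη a n)).ne
  exact isSFiniteKernel_of_isFiniteMeasure _

end Kernel

section Colour

open ProbabilityTheory

lemma comp_apply (i : Fin m) (lam : PointMeasure d m) {A : Set (Space d)}
    (hA : MeasurableSet A) : comp i lam A = lam.1 (A ×ˢ {i}) := by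
  rw [comp, Measure.map_apply measurable_fst hA, Measure.restrict_apply (measurable_fst hA)]
  rfl

lemma integral_comp (i : Fin m) (lam : PointMeasure d m) {F : Type*} [NormedAddCommGroup F]
    [NormedSpace ℝ F] {f : Space d → F} (hf : StronglyMeasurable f) :
    ∫ x, f x ∂(comp i lam) = ∫ p, (Prod.snd ⁻¹' {i}).indicator (fun p => f p.1) p ∂lam.1 := by
  rw [comp, integral_map measurable_fst.aemeasurable hf.aestronglyMeasurable,
    integral_indicator (measurable_snd (MeasurableSet.singleton i))]

instance (i : Fin m) (lam : PointMeasure d m) : IsFiniteMeasureOnCompacts (comp i lam) where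
  lt_top_of_isCompact K hK := by
    rw [comp_apply i lam hK.measurableSet]
    exact (hK.prod isCompact_singleton).measure_lt_top

lemma comp_vadd (i : Fin m) (t : Space d) (lam : PointMeasure d m) :
    comp i (t +ᵥ lam) = (comp i lam).map (fun x => t + x) := by
  ext A hA
  rw [comp_apply _ _ hA, Measure.map_apply (by fun_prop) hA,
    comp_apply _ _ (hA.preimage (by fun_prop))]
  exact Measure.map_apply (shift m t).continuous.measurable (hA.prod (MeasurableSet.singleton i))

lemma lintegral_comp_vadd (i : Fin m) (t : Space d) (lam : PointMeasure d m)
    (f : Space d → ℝ≥0∞) :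
    ∫⁻ x, f x ∂(comp i (t +ᵥ lam)) = ∫⁻ x, f (t + x) ∂(comp i lam) := by
  rw [comp_vadd]
  exact (MeasurableEquiv.addLeft t).measurableEmbedding.lintegral_map f

lemma measurable_comp (i : Fin m) : Measurable fun lam : PointMeasure d m => comp i lam := by
  refine Measure.measurable_of_measurable_coe _ fun A hA => ?_
  simp only [comp_apply i _ hA]
  exact (Measure.measurable_coe (hA.prod (MeasurableSet.singleton i))).comp measurable_val

/-- `λ ↦ λ^i` as a kernel, so that the library's results on composition of kernels apply. -/
def compKernel (d : ℕ) (i : Fin m) : Kernel (PointMeasure d m) (Space d) :=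
  ⟨fun lam => comp i lam, measurable_comp i⟩

lemma compKernel_apply (i : Fin m) (lam : PointMeasure d m) :
    compKernel d i lam = comp i lam := rfl

instance (i : Fin m) : IsSFiniteKernel (compKernel d i) :=
  isSFiniteKernel_of_iUnion_eq_univ _ (fun n => measurableSet_cube n) iUnion_cube_natCast
    fun lam n => (isBounded_cube n).measure_lt_top (μ := comp i lam)

lemma measurable_lintegral_comp (i : Fin m) {Z : Type*} [MeasurableSpace Z]
    {Λ : Z → PointMeasure d m} (hΛ : Measurable Λ) {f : Z → Space d → ℝ≥0∞}
    (hf : Measurable (Function.uncurry f)) :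
    Measurable fun z => ∫⁻ x, f z x ∂(comp i (Λ z)) :=
  Measurable.lintegral_kernel_prod_right (κ := (compKernel d i).comap Λ hΛ) hf

end Colour

section Campbell

variable {μ : Measure (PointMeasure d m)} {Φ : PointMeasure d m → ℝ≥0∞} {k : Space d → ℝ≥0∞}

lemma measurable_neg_vadd (lam : PointMeasure d m) : Measurable fun x : Space d => -x +ᵥ lam :=
  measurable_neg.vadd_const lam

lemma measurable_campbell (i : Fin m) (hΦ : Measurable Φ) {Z : Type*} [MeasurableSpace Z]
    {Λ : Z → PointMeasure d m} (hΛ : Measurable Λ) {k : Z → Space d → ℝ≥0∞}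
    (hk : Measurable (Function.uncurry k)) :
    Measurable fun z => ∫⁻ y, k z y * Φ (-y +ᵥ Λ z) ∂(comp i (Λ z)) :=
  measurable_lintegral_comp i hΛ <|
    hk.mul (hΦ.comp (measurable_snd.neg.vadd (hΛ.comp measurable_fst)))

lemma lintegral_map_neg_vadd (i : Fin m) (hΦ : Measurable Φ) (lam : PointMeasure d m) :
    ∫⁻ lam', Φ lam' ∂(((comp i lam).restrict (cube d 1)).map fun x : Space d => -x +ᵥ lam) =
      ∫⁻ y, (cube d 1).indicator 1 y * Φ (-y +ᵥ lam) ∂(comp i lam) := by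
  rw [lintegral_map hΦ (measurable_neg_vadd lam), ← lintegral_indicator (measurableSet_cube 1)]
  refine lintegral_congr fun y => ?_
  by_cases hy : y ∈ cube d 1 <;> simp [hy]

lemma lintegral_palm (i : Fin m) (hΦ : Measurable Φ) :
    ∫⁻ lam, Φ lam ∂(palm μ i) =
      ∫⁻ lam, ∫⁻ y, (cube d 1).indicator 1 y * Φ (-y +ᵥ lam) ∂(comp i lam) ∂μ := by
  have hmeas : Measurable fun lam : PointMeasure d m =>
      ((comp i lam).restrict (cube d 1)).map fun x : Space d => -x +ᵥ lam := by
    refine Measure.measurable_of_measurable_coe _ fun A hA => ?_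
    have hΦA : Measurable (A.indicator (1 : PointMeasure d m → ℝ≥0∞)) := measurable_one.indicator hA
    simp only [← lintegral_indicator_one hA, lintegral_map_neg_vadd i hΦA]
    exact measurable_campbell i hΦA measurable_id (k := fun _ => (cube d 1).indicator 1)
      ((measurable_one.indicator (measurableSet_cube 1)).comp measurable_snd)
  rw [palm, Measure.lintegral_bind hmeas.aemeasurable hΦ.aemeasurable]
  exact lintegral_congr fun lam => lintegral_map_neg_vadd i hΦ lam

variable [VAddInvariantMeasure (Space d) (PointMeasure d m) μ]

lemma lintegral_campbell_sub (i : Fin m) (hΦ : Measurable Φ) (hk : Measurable k) (t : Space d) :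
    ∫⁻ lam, ∫⁻ y, k (y - t) * Φ (-y +ᵥ lam) ∂(comp i lam) ∂μ =
      ∫⁻ lam, ∫⁻ y, k y * Φ (-y +ᵥ lam) ∂(comp i lam) ∂μ := by
  rw [← (measurePreserving_vadd (-t) μ).lintegral_comp
    (measurable_campbell i hΦ measurable_id' (k := fun _ => k) (hk.comp measurable_snd))]
  refine lintegral_congr fun lam => ?_
  rw [lintegral_comp_vadd]
  refine lintegral_congr fun y => ?_
  rw [vadd_vadd, neg_add_rev, neg_neg, add_assoc, add_neg_cancel, add_zero, neg_add_eq_sub]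

lemma lintegral_mul_lintegral_campbell [SFinite μ] (i : Fin m) (hΦ : Measurable Φ)
    (hk : Measurable k) {χ : Space d → ℝ≥0∞} (hχ : Measurable χ) :
    (∫⁻ t, χ t) * ∫⁻ lam, ∫⁻ y, k y * Φ (-y +ᵥ lam) ∂(comp i lam) ∂μ =
      ∫⁻ lam, ∫⁻ y, (∫⁻ t, χ t * k (y - t)) * Φ (-y +ᵥ lam) ∂(comp i lam) ∂μ := by
  have hχk : Measurable (Function.uncurry fun t y : Space d => χ t * k (y - t)) :=
    (hχ.comp measurable_fst).mul (hk.comp (measurable_snd.sub measurable_fst))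
  have hΦy : ∀ lam : PointMeasure d m, Measurable fun y : Space d => Φ (-y +ᵥ lam) := fun lam =>
    hΦ.comp (measurable_neg_vadd lam)
  calc (∫⁻ t, χ t) * ∫⁻ lam, ∫⁻ y, k y * Φ (-y +ᵥ lam) ∂(comp i lam) ∂μ
      = ∫⁻ t, ∫⁻ lam, ∫⁻ y, (χ t * k (y - t)) * Φ (-y +ᵥ lam) ∂(comp i lam) ∂μ := by
        rw [← lintegral_mul_const _ hχ]
        refine lintegral_congr fun t => ?_
        have hkt : Measurable fun y => k (y - t) := hk.comp (measurable_sub_const t)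
        rw [← lintegral_campbell_sub i hΦ hk t, ← lintegral_const_mul _
          (measurable_campbell i hΦ measurable_id' (k := fun _ y => k (y - t))
            (hkt.comp measurable_snd))]
        refine lintegral_congr fun lam => ?_
        simp only [mul_assoc]
        exact (lintegral_const_mul _ (hkt.mul (hΦy lam))).symm
    _ = ∫⁻ lam, ∫⁻ y, ∫⁻ t, (χ t * k (y - t)) * Φ (-y +ᵥ lam) ∂volume ∂(comp i lam) ∂μ := by
        rw [lintegral_lintegral_swap (measurable_campbell i hΦ measurable_snd
          (k := fun q y => χ q.1 * k (y - q.1))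
          (hχk.comp ((measurable_fst.comp measurable_fst).prodMk measurable_snd))).aemeasurable]
        exact lintegral_congr fun lam =>
          lintegral_lintegral_swap (hχk.mul ((hΦy lam).comp measurable_snd)).aemeasurable
    _ = _ := lintegral_congr fun lam => lintegral_congr fun y =>
        lintegral_mul_const _ (hχk.comp measurable_prodMk_right)

/-- The refined Campbell formula. By invariance both sides smooth to the same convolution of `k`
with the indicator function of the unit cube. -/
theorem lintegral_campbell [SFinite μ] (i : Fin m) (hΦ : Measurable Φ) (hk : Measurable k) :
    ∫⁻ lam, ∫⁻ y, k y * Φ (-y +ᵥ lam) ∂(comp i lam) ∂μ =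
      (∫⁻ y, k y) * ∫⁻ lam, Φ lam ∂(palm μ i) := by
  set χ : Space d → ℝ≥0∞ := (cube d 1).indicator 1
  have hχ : Measurable χ := measurable_one.indicator (measurableSet_cube 1)
  have hχ1 : ∫⁻ t, χ t = 1 := by
    rw [lintegral_indicator_one (measurableSet_cube 1), volume_cube, ENNReal.ofReal_one, one_pow]
  have hconv : ∀ y, ∫⁻ t, χ t * k (y - t) = ∫⁻ t, k t * χ (y - t) := fun y => by
    rw [← lintegral_sub_left_eq_self (fun t => χ t * k (y - t)) y]
    simp only [sub_sub_cancel, mul_comm]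
  rw [lintegral_palm i hΦ, lintegral_mul_lintegral_campbell i hΦ hχ hk]
  simp only [← hconv]
  rw [← lintegral_mul_lintegral_campbell i hΦ hk hχ, hχ1, one_mul]

end Campbell

section VagueLimit

variable {X : Type*} [TopologicalSpace X] [MeasurableSpace X] [BorelSpace X]

lemma ofReal_integral_le_measure (ν : Measure X) [IsFiniteMeasureOnCompacts ν] {ψ : C_c(X, ℝ)}
    (hψ : ∀ x, ψ x ∈ Set.Icc 0 1) {s : Set X} (hs : tsupport ψ ⊆ s) :
    ENNReal.ofReal (∫ x, ψ x ∂ν) ≤ ν s := by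
  rw [ofReal_integral_eq_lintegral_ofReal (integrable_compactlySupported ν ψ)
    (ae_of_all _ fun x => (hψ x).1)]
  refine le_trans ?_ (measure_mono hs)
  rw [← lintegral_indicator_one (isClosed_tsupport ψ).measurableSet]
  refine lintegral_mono fun x => ?_
  by_cases hx : x ∈ tsupport ψ
  · rw [Set.indicator_of_mem hx]
    exact ENNReal.ofReal_le_one.2 (hψ x).2
  · simp [image_eq_zero_of_notMem_tsupport hx]

variable [T2Space X]

lemma measure_le_ofReal_integral (ν : Measure X) [IsFiniteMeasureOnCompacts ν] {ψ : C_c(X, ℝ)}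
    (hψ : ∀ x, ψ x ∈ Set.Icc 0 1) {K : Set X} (hK : IsCompact K) (hψK : Set.EqOn ψ 1 K) :
    ν K ≤ ENNReal.ofReal (∫ x, ψ x ∂ν) := by
  rw [ofReal_integral_eq_lintegral_ofReal (integrable_compactlySupported ν ψ)
    (ae_of_all _ fun x => (hψ x).1), ← lintegral_indicator_one hK.measurableSet]
  exact lintegral_mono (Set.indicator_le fun x hx => by simp [hψK hx])

variable [LocallyCompactSpace X] {ι : Type*}

lemma exists_vague_limit (U : Ultrafilter ι) (ν : ι → Measure X)
    [∀ i, IsFiniteMeasureOnCompacts (ν i)]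
    (hb : ∀ f : C_c(X, ℝ), ∃ C : ℝ, ∀ᶠ i in (U : Filter ι), |∫ x, f x ∂(ν i)| ≤ C) :
    ∃ ρ : Measure X, ρ.Regular ∧ ∀ f : C_c(X, ℝ),
      Tendsto (fun i => ∫ x, f x ∂(ν i)) U (𝓝 (∫ x, f x ∂ρ)) := by
  have hL : ∀ f : C_c(X, ℝ), ∃ l : ℝ, Tendsto (fun i => ∫ x, f x ∂(ν i)) U (𝓝 l) := fun f => by
    obtain ⟨C, hC⟩ := hb f
    obtain ⟨l, -, hl⟩ := (isCompact_Icc (a := -C) (b := C)).ultrafilter_le_nhds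
      (U.map fun i => ∫ x, f x ∂(ν i)) (le_principal_iff.2 (hC.mono fun i hi => abs_le.1 hi))
    exact ⟨l, hl⟩
  choose L hL using hL
  let Λ : C_c(X, ℝ) →ₚ[ℝ] ℝ := PositiveLinearMap.mk₀
    { toFun := L
      map_add' := fun f g => tendsto_nhds_unique (hL (f + g)) (((hL f).add (hL g)).congr fun i =>
        (integral_add (integrable_compactlySupported (ν i) f)
          (integrable_compactlySupported (ν i) g)).symm)
      map_smul' := fun c f => tendsto_nhds_unique (hL (c • f)) (((hL f).const_mul c).congr
        fun i => (integral_const_mul c _).symm) }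
    fun f hf => ge_of_tendsto' (hL f) fun i => integral_nonneg hf
  refine ⟨RealRMK.rieszMeasure Λ, inferInstance, fun f => ?_⟩
  rw [RealRMK.integral_rieszMeasure]
  exact hL f

variable {l : Filter ι} [l.NeBot] {ν : ι → Measure X} [∀ i, IsFiniteMeasureOnCompacts (ν i)]
  {ρ : Measure X} [ρ.Regular]

lemma measure_le_of_vague_limit
    (hlim : ∀ f : C_c(X, ℝ), Tendsto (fun i => ∫ x, f x ∂(ν i)) l (𝓝 (∫ x, f x ∂ρ)))
    {V : Set X} (hV : IsOpen V) {c : ℝ≥0∞} (hν : ∀ᶠ i in l, ν i V ≤ c) : ρ V ≤ c := by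
  rw [hV.measure_eq_iSup_isCompact]
  refine iSup₂_le fun K hKV => iSup_le fun hK => ?_
  obtain ⟨ψ, hψK, hψV, hψ⟩ := exists_cutoff hK hV hKV
  refine (measure_le_ofReal_integral ρ hψ hK hψK).trans ?_
  exact le_of_tendsto (ENNReal.tendsto_ofReal (hlim ψ))
    (hν.mono fun i hi => (ofReal_integral_le_measure (ν i) hψ hψV).trans hi)

lemma le_measure_of_vague_limit
    (hlim : ∀ f : C_c(X, ℝ), Tendsto (fun i => ∫ x, f x ∂(ν i)) l (𝓝 (∫ x, f x ∂ρ)))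
    {c : ℝ≥0∞} (hν : ∀ i K, IsCompact K → ν i K ≠ 0 → c ≤ ν i K) {V : Set X} (hV : IsOpen V)
    (hV0 : ρ V ≠ 0) : c ≤ ρ V := by
  obtain ⟨K, hKV, hK, hK0⟩ := hV.exists_lt_isCompact (pos_iff_ne_zero.2 hV0)
  obtain ⟨ψ, hψK, hψV, hψ⟩ := exists_cutoff hK hV hKV
  obtain ⟨χ, hχψ, hχV, hχ⟩ := exists_cutoff ψ.hasCompactSupport hV hψV
  have hpos : 0 < ∫ x, ψ x ∂ρ :=
    ENNReal.ofReal_pos.1 (hK0.trans_le (measure_le_ofReal_integral ρ hψ hK hψK))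
  have hle : c ≤ ENNReal.ofReal (∫ x, χ x ∂ρ) := by
    refine ge_of_tendsto (ENNReal.tendsto_ofReal (hlim χ)) ?_
    filter_upwards [(hlim ψ).eventually_const_lt hpos] with i hi
    have hne : ν i (tsupport ψ) ≠ 0 :=
      ((ENNReal.ofReal_pos.2 hi).trans_le (ofReal_integral_le_measure (ν i) hψ subset_rfl)).ne'
    exact (hν i _ ψ.hasCompactSupport hne).trans
      (measure_le_ofReal_integral (ν i) hχ ψ.hasCompactSupport hχψ)
  exact hle.trans (ofReal_integral_le_measure ρ hχ hχV)

end VagueLimit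

section IntegerValued

variable {X : Type*} [MeasurableSpace X] {ρ : Measure X}

lemma exists_measure_eq_natCast_of_subset [TopologicalSpace X] [ρ.OuterRegular] {Q : Set X}
    (hρQ : ρ Q ≤ 1) (hρ : ∀ V, IsOpen V → ρ V ≠ 0 → 1 ≤ ρ V) {A : Set X}
    (hA : A ⊆ Q) : ∃ n : ℕ, ρ A = n := by
  rcases lt_or_ge (ρ A) 1 with hlt | hge
  · obtain ⟨V, hAV, hV, hV1⟩ := A.exists_isOpen_lt_of_lt 1 hlt
    have hnull : ρ V = 0 := by
      by_contra hne
      exact (hρ V hV hne).not_gt hV1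
    exact ⟨0, by rw [measure_mono_null hAV hnull, Nat.cast_zero]⟩
  · exact ⟨1, by rw [le_antisymm ((measure_mono hA).trans hρQ) hge, Nat.cast_one]⟩

lemma exists_measure_eq_natCast_of_subset_biUnion {ι : Type*} {Q : ι → Set X}
    (hQ : ∀ a, MeasurableSet (Q a)) (hρ : ∀ a, ∀ A ⊆ Q a, ∃ n : ℕ, ρ A = n) (t : Finset ι)
    {A : Set X} (hA : A ⊆ ⋃ a ∈ t, Q a) : ∃ n : ℕ, ρ A = n := by
  classical
  induction t using Finset.induction_on generalizing A with
  | empty =>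
    obtain rfl : A = ∅ := by simpa using hA
    exact ⟨0, by simp⟩
  | insert a t _ ih =>
    obtain ⟨n, hn⟩ := hρ a (A ∩ Q a) Set.inter_subset_right
    obtain ⟨k, hk⟩ := ih (A := A \ Q a) <| by
      rw [Finset.set_biUnion_insert] at hA
      exact Set.sdiff_subset_iff.2 hA
    exact ⟨n + k, by rw [← measure_inter_add_sdiff A (hQ a), hn, hk, Nat.cast_add]⟩

end IntegerValued

section UniformlyDiscrete

/-- Configurations with at most one point, of any colour, in each translate of the cube `C_r`. -/
def uniformlyDiscrete (d m : ℕ) (r : ℝ) : Set (PointMeasure d m) :=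
  {lam | ∀ a : Space d, lam.1 (((fun x => a + x) '' cube d r) ×ˢ Set.univ) ≤ 1}

lemma isOpen_box (a : Space d) (r : ℝ) :
    IsOpen (((fun x => a + x) '' cube d r) ×ˢ (Set.univ : Set (Fin m))) :=
  (isOpen_image_add_cube a r).prod isOpen_univ

variable {r : ℝ}

lemma exists_box_cover (hr : 0 < r) {K : Set (ColSpace d m)} (hK : IsCompact K) :
    ∃ t : Finset (Space d), K ⊆ ⋃ a ∈ t, ((fun x => a + x) '' cube d r) ×ˢ Set.univ :=
  hK.elim_finite_subcover _ (fun a => isOpen_box a r) fun p _ =>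
    Set.mem_iUnion.2 ⟨p.1, ⟨⟨0, zero_mem_cube hr, by simp⟩, trivial⟩⟩

lemma exists_measure_le_of_uniformlyDiscrete (hr : 0 < r) {K : Set (ColSpace d m)}
    (hK : IsCompact K) : ∃ N : ℕ, ∀ lam ∈ uniformlyDiscrete d m r, lam.1 K ≤ N := by
  obtain ⟨t, ht⟩ := exists_box_cover hr hK
  refine ⟨t.card, fun lam hlam => ?_⟩
  calc lam.1 K ≤ ∑ a ∈ t, lam.1 (((fun x => a + x) '' cube d r) ×ˢ Set.univ) :=
        (measure_mono ht).trans (measure_biUnion_finset_le t _)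
    _ ≤ ∑ _a ∈ t, 1 := Finset.sum_le_sum fun a _ => hlam a
    _ = t.card := by simp

lemma exists_abs_integral_le_of_uniformlyDiscrete (hr : 0 < r) (f : C_c(ColSpace d m, ℝ)) :
    ∃ C : ℝ, ∀ lam ∈ uniformlyDiscrete d m r, |∫ p, f p ∂lam.1| ≤ C := by
  obtain ⟨N, hN⟩ := exists_measure_le_of_uniformlyDiscrete (m := m) hr f.hasCompactSupport
  obtain ⟨C, hC⟩ := f.hasCompactSupport.exists_bound_of_continuous f.continuous
  refine ⟨|C| * N, fun lam hlam => ?_⟩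
  rw [← setIntegral_tsupport]
  refine (norm_setIntegral_le_of_norm_le_const f.hasCompactSupport.measure_lt_top
    fun x _ => (hC x).trans (le_abs_self C)).trans ?_
  gcongr
  exact ENNReal.toReal_le_of_le_ofReal (by positivity) (by simpa using hN lam hlam)

lemma PointMeasure.one_le_measure (lam : PointMeasure d m) {K : Set (ColSpace d m)}
    (hK : IsCompact K) (h : lam.1 K ≠ 0) : 1 ≤ lam.1 K := by
  obtain ⟨n, hn⟩ := lam.exists_measure_eq_natCast hK
  rw [hn] at h ⊢
  exact_mod_cast Nat.one_le_iff_ne_zero.2 (by simpa using h)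

theorem isCompact_uniformlyDiscrete (hr : 0 < r) : IsCompact (uniformlyDiscrete d m r) := by
  rw [isCompact_iff_ultrafilter_le_nhds']
  intro U hU
  obtain ⟨ρ, hρ, hlim⟩ := exists_vague_limit U (fun lam : PointMeasure d m => lam.1) fun f => by
    obtain ⟨C, hC⟩ := exists_abs_integral_le_of_uniformlyDiscrete hr f
    exact ⟨C, mem_of_superset hU hC⟩
  have hbox : ∀ a : Space d, ρ (((fun x => a + x) '' cube d r) ×ˢ Set.univ) ≤ 1 := fun a =>
    measure_le_of_vague_limit hlim (isOpen_box a r) (mem_of_superset hU fun _ hlam => hlam a)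
  have hone : ∀ V, IsOpen V → ρ V ≠ 0 → 1 ≤ ρ V := fun V =>
    le_measure_of_vague_limit hlim fun lam K => lam.one_le_measure
  let lam : PointMeasure d m := ⟨ρ, fun A _ hA => by
    obtain ⟨t, ht⟩ := exists_box_cover hr hA
    exact exists_measure_eq_natCast_of_subset_biUnion (fun a => (isOpen_box a r).measurableSet)
      (fun a _ => exists_measure_eq_natCast_of_subset (hbox a) hone) t
      (subset_closure.trans ht)⟩
  refine ⟨lam, hbox, ?_⟩
  rw [isInducing_integral.nhds_eq_comap, ← map_le_iff_le_comap]
  exact tendsto_pi_nhds.2 hlim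

end UniformlyDiscrete

section Generic

lemma abs_cubeAverage_le {Y : Type*} [AddAction (Space d) Y] {F : Y → ℝ} {y : Y} {C R : ℝ}
    (hR : 0 < R) (h : ∀ t : Space d, |F (t +ᵥ y)| ≤ C) : |cubeAverage d F R y| ≤ C := by
  rw [cubeAverage, abs_mul, abs_of_pos (by positivity), inv_mul_le_iff₀ (by positivity),
    ← volume_real_cube hR.le, mul_comm]
  exact norm_setIntegral_le_of_norm_le_const (f := fun t => F (t +ᵥ y))
    (volume_cube_ne_top R).lt_top fun t _ => h t

section OrbitMeasure

variable {Z : Type*} [AddAction (Space d) Z] [MeasurableSpace Z]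

/-- The image of the uniform distribution on `C_R` under `t ↦ t +ᵥ z`, the measure against which
`cubeAverage d F R z` integrates `F`. -/
def orbitMeasure (d : ℕ) {Z : Type*} [AddAction (Space d) Z] [MeasurableSpace Z] (z : Z) (R : ℝ) :
    Measure Z :=
  ENNReal.ofReal (R ^ d)⁻¹ • (volume.restrict (cube d R)).map fun t => t +ᵥ z

instance (z : Z) (R : ℝ) : IsFiniteMeasure (orbitMeasure d z R) := by
  have : IsFiniteMeasure (volume.restrict (cube d R)) :=
    isFiniteMeasure_restrict.2 (volume_cube_ne_top R)
  exact Measure.smul_finite _ ENNReal.ofReal_ne_top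

lemma integral_orbitMeasure [MeasurableVAdd₂ (Space d) Z] {F : Z → ℝ} (hF : Measurable F) {R : ℝ}
    (hR : 0 ≤ R) (z : Z) : ∫ x, F x ∂(orbitMeasure d z R) = cubeAverage d F R z := by
  rw [orbitMeasure, integral_smul_measure, integral_map (measurable_vadd_const z).aemeasurable
    hF.aestronglyMeasurable, ENNReal.toReal_ofReal (by positivity), smul_eq_mul, cubeAverage]

end OrbitMeasure

section CompactSpace

variable {Z : Type*} [TopologicalSpace Z] [CompactSpace Z] [T2Space Z]
  [MeasurableSpace Z] [BorelSpace Z] [AddAction (Space d) Z] [ContinuousVAdd (Space d) Z]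

lemma vaddInvariantMeasure_of_forall_integral_eq {ρ : Measure Z} [ρ.Regular]
    (h : ∀ (t : Space d) (f : C_c(Z, ℝ)), ∫ z, f (t +ᵥ z) ∂ρ = ∫ z, f z ∂ρ) :
    VAddInvariantMeasure (Space d) Z ρ := by
  refine ((vaddInvariantMeasure_tfae (Space d) ρ).out 0 5).2 fun t => ?_
  have : (ρ.map (Homeomorph.vadd t)).Regular := .map _
  refine Measure.ext_of_integral_eq_on_compactlySupported (μ := ρ.map (Homeomorph.vadd t))
    fun f => ?_
  rw [(Homeomorph.vadd t).measurableEmbedding.integral_map]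
  exact h t f

variable [SecondCountableTopology Z]

/-- The Krylov–Bogoliubov argument: the averages over the orbit of `z` are integrals against
probability measures, whose vague limits are invariant. -/
lemma exists_invariant_limit_cubeAverage {U : Ultrafilter ℝ} (hU : (U : Filter ℝ) ≤ atTop) (z : Z) :
    ∃ ρ : Measure Z, IsProbabilityMeasure ρ ∧ VAddInvariantMeasure (Space d) Z ρ ∧
      ∀ F : C(Z, ℝ), Tendsto (fun R => cubeAverage d F R z) U (𝓝 (∫ x, F x ∂ρ)) := by
  have hpos : ∀ᶠ R : ℝ in (U : Filter ℝ), 0 < R := hU (eventually_gt_atTop 0)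
  obtain ⟨ρ, hρ, hlim⟩ := exists_vague_limit U (orbitMeasure d z) fun f => by
    obtain ⟨C, hC⟩ := f.hasCompactSupport.exists_bound_of_continuous f.continuous
    refine ⟨C, hpos.mono fun R hR => ?_⟩
    rw [integral_orbitMeasure (F := ⇑f) f.continuous.measurable hR.le]
    exact abs_cubeAverage_le hR fun t => hC _
  have htendsto : ∀ F : C(Z, ℝ),
      Tendsto (fun R => cubeAverage d F R z) U (𝓝 (∫ x, F x ∂ρ)) := fun F =>
    (hlim ⟨F, HasCompactSupport.of_compactSpace _⟩).congr' <| hpos.mono fun R hR =>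
      integral_orbitMeasure F.continuous.measurable hR.le z
  refine ⟨ρ, ⟨?_⟩, vaddInvariantMeasure_of_forall_integral_eq fun t f => ?_, htendsto⟩
  · have hone : ∫ _x : Z, (1 : ℝ) ∂ρ = 1 := tendsto_nhds_unique (htendsto (ContinuousMap.const Z 1))
      (tendsto_const_nhds.congr' (hpos.mono fun R hR => (cubeAverage_const 1 hR z).symm))
    rw [integral_const, smul_eq_mul, mul_one, measureReal_def] at hone
    exact (ENNReal.toReal_eq_one_iff _).1 hone
  · obtain ⟨C, hC⟩ := f.hasCompactSupport.exists_bound_of_continuous f.continuous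
    have htranslate : Tendsto (fun R => cubeAverage d f R (t +ᵥ z)) U
        (𝓝 (∫ x, f (t +ᵥ x) ∂ρ)) := by
      refine (htendsto ⟨fun x => f (t +ᵥ x), by fun_prop⟩).congr fun R => ?_
      simp only [cubeAverage, ContinuousMap.coe_mk, vadd_comm t]
    exact sub_eq_zero.1 <| tendsto_nhds_unique (htranslate.sub (htendsto f.1)) <|
      (tendsto_cubeAverage_vadd_sub f.continuous.measurable hC t z).mono_left hU

end CompactSpace

lemma exists_countable_approx_on {Y : Type*} [TopologicalSpace Y] [T2Space Y]
    [SecondCountableTopology Y] {K : Set Y} (hK : IsCompact K) :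
    ∃ D : Set C(Y, ℝ), D.Countable ∧
      ∀ F : C(Y, ℝ), ∀ ε > 0, ∃ G ∈ D, ∀ y ∈ K, |F y - G y| ≤ ε := by
  have : CompactSpace K := isCompact_iff_compactSpace.1 hK
  let res : C(Y, ℝ) → C(K, ℝ) := ContinuousMap.restrict K
  obtain ⟨D, hDc, hDd⟩ := TopologicalSpace.exists_countable_dense (Set.range res)
  refine ⟨Set.rangeSplitting res '' D, hDc.image _, fun F ε hε => ?_⟩
  obtain ⟨G, hGD, hFG⟩ := Metric.mem_closure_iff.1 (hDd ⟨res F, F, rfl⟩) ε hε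
  refine ⟨_, ⟨G, hGD, rfl⟩, fun y hy => ?_⟩
  have hG : res (Set.rangeSplitting res G) = G := Set.apply_rangeSplitting res G
  calc |F y - Set.rangeSplitting res G y| = dist (res F ⟨y, hy⟩) (G.1 ⟨y, hy⟩) := by
        rw [← hG]; rfl
    _ ≤ dist (res F) G.1 := ContinuousMap.dist_apply_le_dist _
    _ ≤ ε := hFG.le

variable {Y : Type*} [TopologicalSpace Y] [AddAction (Space d) Y]

lemma integrableOn_orbit [ContinuousVAdd (Space d) Y] {F : Y → ℝ} (hF : Continuous F) (y : Y)
    (R : ℝ) : IntegrableOn (fun t : Space d => F (t +ᵥ y)) (cube d R) :=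
  ((by fun_prop : Continuous fun t : Space d => F (t +ᵥ y)).continuousOn.integrableOn_compact
    (isBounded_cube R).isCompact_closure).mono_set subset_closure

lemma abs_cubeAverage_sub_le [ContinuousVAdd (Space d) Y] {F G : Y → ℝ} (hF : Continuous F)
    (hG : Continuous G) {R C : ℝ} (hR : 0 < R) {y : Y}
    (h : ∀ t : Space d, |F (t +ᵥ y) - G (t +ᵥ y)| ≤ C) :
    |cubeAverage d F R y - cubeAverage d G R y| ≤ C := by
  have hsub : cubeAverage d F R y - cubeAverage d G R y = cubeAverage d (F - G) R y := by
    simp only [cubeAverage, Pi.sub_apply, ← mul_sub,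
      integral_sub (integrableOn_orbit hF y R) (integrableOn_orbit hG y R)]
  rw [hsub]
  exact abs_cubeAverage_le hR h

variable [MeasurableSpace Y]

lemma vadd_mem_support [ContinuousVAdd (Space d) Y] {μ : Measure Y}
    [VAddInvariantMeasure (Space d) Y μ] (t : Space d) {y : Y} (h : y ∈ μ.support) :
    t +ᵥ y ∈ μ.support := by
  rw [Measure.mem_support_iff_forall] at h ⊢
  intro V hV
  rw [← measure_preimage_vadd μ t V]
  exact h _ ((continuous_const_vadd t).continuousAt hV)

variable [BorelSpace Y]

lemma exists_invariant_limit_cubeAverage_of_isCompact [T2Space Y] [SecondCountableTopology Y]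
    [ContinuousVAdd (Space d) Y] {K : Set Y} (hK : IsCompact K)
    (hinv : ∀ (t : Space d), ∀ y ∈ K, t +ᵥ y ∈ K) {U : Ultrafilter ℝ}
    (hU : (U : Filter ℝ) ≤ atTop) {y : Y} (hy : y ∈ K) :
    ∃ ρ : Measure Y, IsProbabilityMeasure ρ ∧ VAddInvariantMeasure (Space d) Y ρ ∧ ρ Kᶜ = 0 ∧
      ∀ F : C(Y, ℝ), Tendsto (fun R => cubeAverage d F R y) U (𝓝 (∫ x, F x ∂ρ)) := by
  let S : SubAddAction (Space d) Y := ⟨K, fun t {y} hy => hinv t y hy⟩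
  have : CompactSpace S := isCompact_iff_compactSpace.1 hK
  have : SecondCountableTopology S := inferInstanceAs (SecondCountableTopology K)
  have : ContinuousVAdd (Space d) S := ⟨by
    exact Continuous.subtype_mk (by fun_prop) _⟩
  have hval : MeasurableEmbedding (Subtype.val : S → Y) := .subtype_coe hK.measurableSet
  obtain ⟨ρ, hρ, hρinv, hlim⟩ := exists_invariant_limit_cubeAverage (d := d) hU (⟨y, hy⟩ : S)
  refine ⟨ρ.map Subtype.val, Measure.isProbabilityMeasure_map hval.measurable.aemeasurable,
    vaddInvariantMeasure_map ρ _ (fun _ _ => rfl) hval.measurable, ?_, fun F => ?_⟩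
  · rw [hval.map_apply, measure_eq_zero_iff_ae_notMem]
    exact ae_of_all _ fun z hz => hz z.2
  · rw [hval.integral_map]
    exact hlim (F.restrict K)

/-- A point of the support of `μ` along whose orbit the averages of all continuous functions
converge to their integrals. -/
def IsGeneric (d : ℕ) {Y : Type*} [TopologicalSpace Y] [MeasurableSpace Y] [AddAction (Space d) Y]
    (μ : Measure Y) (y : Y) : Prop :=
  y ∈ μ.support ∧
    ∀ F : C(Y, ℝ), Tendsto (fun R => cubeAverage d F R y) atTop (𝓝 (∫ z, F z ∂μ))

lemma integrable_of_isCompact_support [HereditarilyLindelofSpace Y] {μ : Measure Y}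
    [IsFiniteMeasureOnCompacts μ] (hc : IsCompact μ.support) {F : Y → ℝ} (hF : Continuous F) :
    Integrable F μ := by
  rw [← Measure.restrict_eq_self_of_ae_mem (Measure.support_mem_ae (μ := μ))]
  exact hF.continuousOn.integrableOn_compact' hc Measure.isClosed_support.measurableSet

theorem ae_isGeneric [T2Space Y] [SecondCountableTopology Y] [ContinuousVAdd (Space d) Y]
    {μ : Measure Y} [IsProbabilityMeasure μ] [ErgodicVAdd (Space d) Y μ]
    (hc : IsCompact μ.support) :
    ∀ᵐ y ∂μ, IsGeneric d μ y := by
  obtain ⟨D, hDc, hD⟩ := exists_countable_approx_on hc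
  have hint : ∀ F : C(Y, ℝ), Integrable F μ := fun F =>
    integrable_of_isCompact_support hc F.continuous
  have hall : ∀ᵐ y ∂μ, ∀ G ∈ D,
      Tendsto (fun R => cubeAverage d G R y) atTop (𝓝 (∫ z, G z ∂μ)) :=
    (ae_ball_iff hDc).2 fun G _ => ae_tendsto_cubeAverage G.continuous.measurable (hint G)
  filter_upwards [hall, Measure.support_mem_ae] with y hlim hy
  refine ⟨hy, fun F => Metric.tendsto_nhds.2 fun ε hε => ?_⟩
  obtain ⟨G, hGD, hFG⟩ := hD F (ε / 3) (by positivity)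
  have hintegral : |∫ z, F z ∂μ - ∫ z, G z ∂μ| ≤ ε / 3 := by
    rw [← integral_sub (hint F) (hint G)]
    simpa using norm_integral_le_of_norm_le_const (μ := μ) (f := fun z => F z - G z)
      (Filter.mem_of_superset Measure.support_mem_ae hFG)
  filter_upwards [Metric.tendsto_nhds.1 (hlim G hGD) (ε / 3) (by positivity),
    eventually_gt_atTop 0] with R hR hR0
  have haverage : |cubeAverage d F R y - cubeAverage d G R y| ≤ ε / 3 :=
    abs_cubeAverage_sub_le F.continuous G.continuous hR0 fun t => hFG _ (vadd_mem_support t hy)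
  rw [Real.dist_eq] at hR ⊢
  rw [abs_le] at hintegral haverage
  rw [abs_lt] at hR ⊢
  constructor <;> linarith

lemma isGeneric_of_isUniquelyErgodic {μ : Measure (PointMeasure d m)}
    [VAddInvariantMeasure (Space d) (PointMeasure d m) μ] (hc : IsCompact μ.support)
    (hu : IsUniquelyErgodic μ) {lam : PointMeasure d m} (hlam : lam ∈ μ.support) :
    IsGeneric d μ lam := by
  refine ⟨hlam, fun F => (tendsto_iff_ultrafilter _ _ _).2 fun U hU => ?_⟩
  obtain ⟨ρ, hρ, hρinv, hρc, hlim⟩ := exists_invariant_limit_cubeAverage_of_isCompact hc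
    (fun (t : Space d) _ => vadd_mem_support t) hU hlam
  rw [← hu ρ hρ hρinv hρc]
  exact hlim F

end Generic

section VagueConvergence

variable {E : Type*} [TopologicalSpace E] [MeasurableSpace E] [BorelSpace E] {ι : Type*}
  {l : Filter ι} {ν : ι → Measure E} [∀ i, IsFiniteMeasureOnCompacts (ν i)] {ρ : Measure E}
  [IsFiniteMeasureOnCompacts ρ]

lemma tendsto_integral_of_nonneg
    (h : ∀ f : C_c(E, ℝ), (∀ x, 0 ≤ f x) → Tendsto (fun i => ∫ x, f x ∂(ν i)) l (𝓝 (∫ x, f x ∂ρ)))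
    (f : C_c(E, ℝ)) : Tendsto (fun i => ∫ x, f x ∂(ν i)) l (𝓝 (∫ x, f x ∂ρ)) := by
  set p : C_c(E, ℝ) := f.nnrealPart.toReal
  set n : C_c(E, ℝ) := (-f).nnrealPart.toReal
  have hpn : f = p - n := f.nnrealPart_sub_nnrealPart_neg.symm
  have hint (κ : Measure E) [IsFiniteMeasureOnCompacts κ] :
      ∫ x, f x ∂κ = ∫ x, p x ∂κ - ∫ x, n x ∂κ := by
    rw [hpn]
    exact integral_sub (integrable_compactlySupported κ p) (integrable_compactlySupported κ n)
  simp only [hint]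
  exact (h p fun x => by simp [p]).sub (h n fun x => by simp [n])

lemma tendsto_integral_complex
    (h : ∀ f : C_c(E, ℝ), Tendsto (fun i => ∫ x, f x ∂(ν i)) l (𝓝 (∫ x, f x ∂ρ)))
    (f : C_c(E, ℂ)) : Tendsto (fun i => ∫ x, f x ∂(ν i)) l (𝓝 (∫ x, f x ∂ρ)) := by
  let re : C_c(E, ℝ) := ⟨⟨fun x => (f x).re, by fun_prop⟩,
    f.hasCompactSupport.comp_left (g := Complex.re) Complex.zero_re⟩
  let im : C_c(E, ℝ) := ⟨⟨fun x => (f x).im, by fun_prop⟩,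
    f.hasCompactSupport.comp_left (g := Complex.im) Complex.zero_im⟩
  have hint (κ : Measure E) [IsFiniteMeasureOnCompacts κ] :
      ∫ x, f x ∂κ = ((∫ x, re x ∂κ : ℝ) : ℂ) + ((∫ x, im x ∂κ : ℝ) : ℂ) * Complex.I :=
    (integral_re_add_im (𝕜 := ℂ) (integrable_compactlySupported κ f)).symm
  simp only [hint]
  exact ((Complex.continuous_ofReal.tendsto _).comp (h re)).add
    (((Complex.continuous_ofReal.tendsto _).comp (h im)).mul_const _)

end VagueConvergence

section TranslationBounded

lemma isTranslationBounded_of_cube {ν : Measure (Space d)} [SFinite ν] {r : ℝ} (hr : 0 < r)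
    {N : ℝ≥0∞} (hN : N < ∞) (h : ∀ t, ν ((fun x => t + x) '' cube d r) ≤ N) :
    IsTranslationBounded ν := by
  intro K hK
  obtain ⟨D, hD, hb⟩ := exists_measure_image_add_le hr hK.isBounded
  exact ⟨N * D, ENNReal.mul_lt_top hN hD, hb ν N h⟩

lemma IsTranslationBounded.isFiniteMeasureOnCompacts {ν : Measure (Space d)}
    (h : IsTranslationBounded ν) : IsFiniteMeasureOnCompacts ν where
  lt_top_of_isCompact K hK := by
    obtain ⟨C, hC, hb⟩ := h K hK
    simpa using (hb 0).trans_lt hC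

lemma exists_integral_decay_le {r : ℝ} (hr : 0 < r) {N : ℝ≥0∞} (hN : N < ∞) :
    ∃ C : ℝ, ∀ (ν : Measure (Space d)) [SFinite ν],
      (∀ t, ν ((fun x => t + x) '' cube d r) ≤ N) →
      Integrable decay ν ∧ ∫ x, decay x ∂ν ≤ C := by
  obtain ⟨D, hD, hb⟩ := exists_lintegral_decay_le (d := d) hr
  have hND : N * D < ∞ := ENNReal.mul_lt_top hN hD
  have hpos (ν : Measure (Space d)) : 0 ≤ᵐ[ν] decay := ae_of_all _ fun x => (decay_pos x).le
  refine ⟨(N * D).toReal, fun ν _ hν => ⟨⟨continuous_decay.aestronglyMeasurable, ?_⟩, ?_⟩⟩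
  · rw [hasFiniteIntegral_iff_ofReal (hpos ν)]
    exact (hb ν N hν).trans_lt hND
  · rw [integral_eq_lintegral_of_nonneg_ae (hpos ν) continuous_decay.aestronglyMeasurable]
    exact ENNReal.toReal_mono hND.ne (hb ν N hν)

lemma exists_compactlySupported_norm_sub_le {f : Space d → ℂ} (hf : Continuous f)
    (hfd : f =o[cocompact (Space d)] (decay : Space d → ℝ)) {ε : ℝ} (hε : 0 < ε) :
    ∃ g : C_c(Space d, ℂ), ∀ x, ‖f x - g x‖ ≤ ε * decay x := by
  obtain ⟨K, hK, hKf⟩ := mem_cocompact.1 (hfd.bound hε)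
  obtain ⟨χ, hχK, -, hχ⟩ := exists_cutoff hK isOpen_univ (Set.subset_univ _)
  refine ⟨⟨⟨fun x => (χ x : ℂ) * f x, by fun_prop⟩,
    (χ.hasCompactSupport.comp_left (g := Complex.ofReal) Complex.ofReal_zero).mul_right⟩,
    fun x => ?_⟩
  change ‖f x - (χ x : ℂ) * f x‖ ≤ _
  rw [← one_sub_mul, norm_mul, ← Complex.ofReal_one, ← Complex.ofReal_sub, Complex.norm_real,
    Real.norm_of_nonneg (sub_nonneg.2 (hχ x).2)]
  by_cases hx : x ∈ K
  · rw [hχK hx, Pi.one_apply, sub_self, zero_mul]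
    exact (mul_pos hε (decay_pos x)).le
  · have hfx : ‖f x‖ ≤ ε * ‖decay x‖ := hKf hx
    rw [Real.norm_of_nonneg (decay_pos x).le] at hfx
    exact (mul_le_of_le_one_left (norm_nonneg _) (sub_le_self _ (hχ x).1)).trans hfx

theorem tendsto_integral_of_isLittleO_decay {ι : Type*} {l : Filter ι}
    {ν : ι → Measure (Space d)} [∀ i, SFinite (ν i)] [∀ i, IsFiniteMeasureOnCompacts (ν i)]
    {ρ : Measure (Space d)} [SFinite ρ] [IsFiniteMeasureOnCompacts ρ] {r : ℝ} (hr : 0 < r)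
    {N : ℝ≥0∞} (hN : N < ∞) (hν : ∀ᶠ i in l, ∀ t, ν i ((fun x => t + x) '' cube d r) ≤ N)
    (hρ : ∀ t, ρ ((fun x => t + x) '' cube d r) ≤ N)
    (h : ∀ f : C_c(Space d, ℝ), Tendsto (fun i => ∫ x, f x ∂(ν i)) l (𝓝 (∫ x, f x ∂ρ)))
    {f : Space d → ℂ} (hf : Continuous f) (hfd : f =o[cocompact (Space d)] (decay : Space d → ℝ)) :
    Tendsto (fun i => ∫ x, f x ∂(ν i)) l (𝓝 (∫ x, f x ∂ρ)) := by
  obtain ⟨C, hC⟩ := exists_integral_decay_le (d := d) hr hN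
  refine tendsto_integral_of_approx (hC ρ hρ).1 (hν.mono fun i hi => hC (ν i) hi)
    (fun i => hf.aestronglyMeasurable) hf.aestronglyMeasurable fun ε hε => ?_
  obtain ⟨g, hg⟩ := exists_compactlySupported_norm_sub_le hf hfd hε
  exact ⟨g, hg, .of_forall fun _ => hg, tendsto_integral_complex h g⟩

lemma exists_norm_mul_one_add_norm_le_mul_decay (f : 𝓢(Space d, ℂ)) :
    ∃ C : ℝ, 0 ≤ C ∧ ∀ x, ‖f x‖ * (1 + ‖x‖) ≤ C * decay x := by
  refine ⟨2 ^ (d + 2) * ((Finset.Iic (d + 2, 0)).sup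
    fun p => SchwartzMap.seminorm ℝ p.1 p.2) f, by positivity, fun x => ?_⟩
  have h := SchwartzMap.one_add_le_sup_seminorm_apply (𝕜 := ℝ) (m := (d + 2, 0)) le_rfl le_rfl f x
  rw [norm_iteratedFDeriv_zero] at h
  rw [decay, ← div_eq_mul_inv, le_div_iff₀ (by positivity)]
  exact h.trans_eq' (by ring)

lemma exists_norm_le_mul_decay (f : 𝓢(Space d, ℂ)) :
    ∃ C : ℝ, 0 ≤ C ∧ ∀ x, ‖f x‖ ≤ C * decay x := by
  obtain ⟨C, hC0, hC⟩ := exists_norm_mul_one_add_norm_le_mul_decay f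
  exact ⟨C, hC0, fun x => (le_mul_of_one_le_right (norm_nonneg _)
    (le_add_of_nonneg_right (norm_nonneg _))).trans (hC x)⟩

lemma isLittleO_decay (f : 𝓢(Space d, ℂ)) : f =o[cocompact (Space d)] (decay : Space d → ℝ) := by
  obtain ⟨C, -, hC⟩ := exists_norm_mul_one_add_norm_le_mul_decay f
  refine Asymptotics.isLittleO_iff.2 fun ε hε => ?_
  filter_upwards [(tendsto_norm_cocompact_atTop (E := Space d)).eventually_ge_atTop (C / ε)]
    with x hx
  rw [Real.norm_of_nonneg (decay_pos x).le]
  refine le_of_mul_le_mul_right ?_ (by positivity : 0 < 1 + ‖x‖)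
  calc ‖f x‖ * (1 + ‖x‖) ≤ C * decay x := hC x
    _ ≤ (ε * (1 + ‖x‖)) * decay x := by
        gcongr
        · exact (decay_pos x).le
        · rw [div_le_iff₀' hε] at hx
          nlinarith
    _ = ε * decay x * (1 + ‖x‖) := by ring

end TranslationBounded

section Moment

open ProbabilityTheory

variable {μ : Measure (PointMeasure d m)}

/-- The first moment measure of colour `j` of the Palm measure of colour `i`. -/
def momentMeasure (μ : Measure (PointMeasure d m)) (i j : Fin m) : Measure (Space d) :=
  (palm μ i).bind (compKernel d j)

instance (i j : Fin m) [IsFiniteMeasure (palm μ i)] : SFinite (momentMeasure μ i j) := by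
  unfold momentMeasure
  infer_instance

lemma lintegral_momentMeasure (i j : Fin m) {f : Space d → ℝ≥0∞} (hf : Measurable f) :
    ∫⁻ x, f x ∂(momentMeasure μ i j) = ∫⁻ lam, ∫⁻ x, f x ∂(comp j lam) ∂(palm μ i) :=
  Measure.lintegral_bind (Kernel.aemeasurable _) hf.aemeasurable

lemma integrable_integral_comp (i j : Fin m) {f : Space d → ℂ}
    (hf : Integrable f (momentMeasure μ i j)) :
    Integrable (fun lam => ∫ x, f x ∂(comp j lam)) (palm μ i) := by
  rw [momentMeasure, Measure.comp_eq_comp_const_apply] at hf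
  simpa [compKernel_apply] using hf.integral_comp

lemma integral_momentMeasure (i j : Fin m) {f : Space d → ℂ}
    (hf : Integrable f (momentMeasure μ i j)) :
    ∫ x, f x ∂(momentMeasure μ i j) = ∫ lam, ∫ x, f x ∂(comp j lam) ∂(palm μ i) := by
  rw [momentMeasure, Measure.comp_eq_comp_const_apply] at hf ⊢
  rw [Kernel.integral_comp hf]
  simp [compKernel_apply]

lemma weightedMoment_eq_sum (w : Fin m → ℝ) {f : Space d → ℂ}
    (hf : ∀ i j, Integrable f (momentMeasure μ i j)) :
    weightedMoment μ w f =
      ∑ i, ∑ j, (w i : ℂ) * (w j : ℂ) * ∫ x, f x ∂(momentMeasure μ i j) := by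
  simp only [weightedMoment, weightedPalm, count]
  refine Finset.sum_congr rfl fun i _ => ?_
  rw [integral_finsetSum _ fun j _ => (integrable_integral_comp i j (hf i j)).const_mul _,
    Finset.mul_sum]
  refine Finset.sum_congr rfl fun j _ => ?_
  rw [integral_const_mul, integral_momentMeasure i j (hf i j), mul_assoc]

lemma momentIntegrable_of_integrable {f : Space d → ℂ} (hfm : Measurable f)
    (hf : ∀ i j, Integrable f (momentMeasure μ i j)) : MomentIntegrable μ f := fun i j => by
  rw [← lintegral_momentMeasure i j hfm.enorm]
  exact (hf i j).2

lemma comp_image_add_cube_le {r : ℝ} {lam : PointMeasure d m}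
    (h : lam ∈ uniformlyDiscrete d m r) (i : Fin m) (t : Space d) :
    comp i lam ((fun x => t + x) '' cube d r) ≤ 1 := by
  rw [comp_apply i lam (isOpen_image_add_cube t r).measurableSet]
  exact (measure_mono (Set.prod_mono subset_rfl (Set.subset_univ _))).trans (h t)

variable {r : ℝ} (hud : μ.support ⊆ uniformlyDiscrete d m r)

include hud in
lemma palm_univ_lt_top [IsProbabilityMeasure μ] (hr : 0 < r) (i : Fin m) :
    palm μ i Set.univ < ∞ := by
  obtain ⟨D, hD, hb⟩ := exists_measure_image_add_le hr (isBounded_cube (d := d) 1)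
  rw [← lintegral_one, lintegral_palm i measurable_const]
  have hle : ∀ᵐ lam ∂μ, ∫⁻ y, (cube d 1).indicator 1 y * 1 ∂(comp i lam) ≤ D := by
    filter_upwards [Measure.support_mem_ae (μ := μ)] with lam hlam
    simpa [lintegral_indicator_one (measurableSet_cube 1)] using
      hb (comp i lam) 1 (comp_image_add_cube_le (hud hlam) i) 0
  exact (lintegral_mono_ae hle).trans_lt (by simpa using hD)

variable [VAddInvariantMeasure (Space d) (PointMeasure d m) μ]

lemma ae_palm_mem_support (i : Fin m) : ∀ᵐ lam ∂(palm μ i), lam ∈ μ.support := by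
  have hms : MeasurableSet μ.supportᶜ := Measure.isClosed_support.measurableSet.compl
  change palm μ i μ.supportᶜ = 0
  rw [← lintegral_indicator_one hms, lintegral_palm i (measurable_one.indicator hms),
    ← lintegral_zero (μ := μ)]
  refine lintegral_congr_ae ?_
  filter_upwards [Measure.support_mem_ae (μ := μ)] with lam hlam
  have horbit (y : Space d) :
      μ.supportᶜ.indicator (1 : PointMeasure d m → ℝ≥0∞) (-y +ᵥ lam) = 0 :=
    Set.indicator_of_notMem (Set.notMem_compl_iff.2 (vadd_mem_support (-y) hlam)) _
  simp [horbit]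

include hud in
lemma momentMeasure_image_add_cube_le (i j : Fin m) (t : Space d) :
    momentMeasure μ i j ((fun x => t + x) '' cube d r) ≤ palm μ i Set.univ := by
  have hm := (isOpen_image_add_cube t r).measurableSet
  rw [← lintegral_indicator_one hm, lintegral_momentMeasure i j (measurable_one.indicator hm),
    ← lintegral_one]
  refine lintegral_mono_ae ?_
  filter_upwards [ae_palm_mem_support i] with lam hlam
  rw [lintegral_indicator_one hm]
  exact comp_image_add_cube_le (hud hlam) j t

include hud in
lemma isFiniteMeasureOnCompacts_momentMeasure [IsProbabilityMeasure μ] (hr : 0 < r) (i j : Fin m)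
    [SFinite (momentMeasure μ i j)] : IsFiniteMeasureOnCompacts (momentMeasure μ i j) :=
  (isTranslationBounded_of_cube hr (palm_univ_lt_top hud hr i)
    (momentMeasure_image_add_cube_le hud i j)).isFiniteMeasureOnCompacts

end Moment

section Autocorrelation

/-- The contribution `ℓ(C_R)⁻¹ λ^i|_{C_R} * (λ^j|_{C_R})^~` of the colours `i` and `j` to the
autocorrelation in finite volume. -/
def autocorrMeasure (lam : PointMeasure d m) (i j : Fin m) (R : ℝ) : Measure (Space d) :=
  ENNReal.ofReal (R ^ d)⁻¹ •
    (((comp i lam).restrict (cube d R)).prod ((comp j lam).restrict (cube d R))).map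
      fun p => p.1 - p.2

instance (lam : PointMeasure d m) (i : Fin m) (R : ℝ) :
    IsFiniteMeasure ((comp i lam).restrict (cube d R)) :=
  ⟨by simpa using (isBounded_cube R).measure_lt_top (μ := comp i lam)⟩

instance (lam : PointMeasure d m) (i j : Fin m) (R : ℝ) :
    IsFiniteMeasure (autocorrMeasure lam i j R) :=
  Measure.smul_finite _ ENNReal.ofReal_ne_top

lemma integrable_comp_sub {f : Space d → ℂ} (hf : Measurable f) {C : ℝ} (hC : ∀ x, ‖f x‖ ≤ C)
    (ν ν' : Measure (Space d)) [IsFiniteMeasure ν] [IsFiniteMeasure ν'] :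
    Integrable (fun p : Space d × Space d => f (p.1 - p.2)) (ν.prod ν') :=
  .of_bound (hf.comp measurable_sub).aestronglyMeasurable C (ae_of_all _ fun _ => hC _)

lemma integral_autocorrMeasure (lam : PointMeasure d m) (i j : Fin m) {R : ℝ} (hR : 0 ≤ R)
    {f : Space d → ℂ} (hf : Measurable f) :
    ∫ z, f z ∂(autocorrMeasure lam i j R) = ((R ^ d)⁻¹ : ℝ) *
      ∫ p, f (p.1 - p.2)
        ∂(((comp i lam).restrict (cube d R)).prod ((comp j lam).restrict (cube d R))) := by
  rw [autocorrMeasure, integral_smul_measure,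
    integral_map measurable_sub.aemeasurable hf.aestronglyMeasurable,
    ENNReal.toReal_ofReal (by positivity)]
  rfl

theorem autocorrelationAt_eq_sum (w : Fin m → ℝ) (lam : PointMeasure d m) {R : ℝ} (hR : 0 ≤ R)
    {f : Space d → ℂ} (hf : Measurable f) {C : ℝ} (hC : ∀ x, ‖f x‖ ≤ C) :
    autocorrelationAt w lam R f =
      ∑ i, ∑ j, (w i : ℂ) * (w j : ℂ) * ∫ z, f z ∂(autocorrMeasure lam i j R) := by
  have hint (i j) := integrable_comp_sub hf hC ((comp i lam).restrict (cube d R))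
    ((comp j lam).restrict (cube d R))
  simp only [autocorrelationAt, count, integral_indicator (measurableSet_cube R)]
  rw [Finset.mul_sum]
  refine Finset.sum_congr rfl fun i _ => ?_
  rw [integral_finsetSum _ fun j _ => (hint i j).integral_prod_left.const_mul _, Finset.mul_sum,
    Finset.mul_sum]
  refine Finset.sum_congr rfl fun j _ => ?_
  rw [integral_const_mul, integral_autocorrMeasure lam i j hR hf, integral_prod _ (hint i j),
    ← measureReal_def, volume_real_cube hR]
  push_cast
  ring

lemma autocorrMeasure_le {r : ℝ} {lam : PointMeasure d m} (hlam : lam ∈ uniformlyDiscrete d m r)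
    (i j : Fin m) (R : ℝ) (t : Space d) :
    autocorrMeasure lam i j R ((fun x => t + x) '' cube d r) ≤
      ENNReal.ofReal (R ^ d)⁻¹ * comp i lam (cube d R) := by
  have hm := (isOpen_image_add_cube t r).measurableSet
  have hfibre (x : Space d) : (comp j lam).restrict (cube d R)
      (Prod.mk x ⁻¹' ((fun p => p.1 - p.2) ⁻¹' ((fun x => t + x) '' cube d r))) ≤ 1 := by
    refine (Measure.restrict_apply_le _ _).trans
      ((measure_mono fun y hy => ?_).trans (comp_image_add_cube_le hlam j (x - t)))
    have hy' : x - y ∈ (fun x => t + x) '' cube d r := hy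
    rw [mem_image_add_left_iff] at hy' ⊢
    rwa [← neg_mem_cube_iff, neg_sub, sub_right_comm]
  rw [autocorrMeasure, Measure.smul_apply, smul_eq_mul, Measure.map_apply measurable_sub hm,
    Measure.prod_apply (measurable_sub hm)]
  gcongr
  simpa using lintegral_mono (μ := (comp i lam).restrict (cube d R)) hfibre

lemma exists_autocorrMeasure_image_add_le {r : ℝ} (hr : 0 < r) : ∃ N : ℝ≥0∞, N < ∞ ∧
    ∀ lam ∈ uniformlyDiscrete d m r, ∀ (i j : Fin m) (R : ℝ), 1 ≤ R → ∀ t,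
      autocorrMeasure lam i j R ((fun x => t + x) '' cube d r) ≤ N := by
  refine ⟨ENNReal.ofReal ((1 + r) ^ d) / volume (cube d r),
    ENNReal.div_lt_top ENNReal.ofReal_ne_top (volume_cube_ne_zero hr),
    fun lam hlam i j R hR t => (autocorrMeasure_le hlam i j R t).trans ?_⟩
  have : 0 < R := by linarith
  have hcount : comp i lam (cube d R) ≤ volume (cube d (R + r)) / volume (cube d r) := by
    simpa using measure_image_add_cube_le hr (comp_image_add_cube_le hlam i) 0 R
  calc ENNReal.ofReal (R ^ d)⁻¹ * comp i lam (cube d R)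
      ≤ ENNReal.ofReal (R ^ d)⁻¹ * (volume (cube d (R + r)) / volume (cube d r)) := by gcongr
    _ = ENNReal.ofReal ((R ^ d)⁻¹ * (R + r) ^ d) / volume (cube d r) := by
        rw [volume_cube (R + r), ← ENNReal.ofReal_pow (by positivity), ← mul_div_assoc,
          ← ENNReal.ofReal_mul (by positivity)]
    _ ≤ ENNReal.ofReal ((1 + r) ^ d) / volume (cube d r) := by
        gcongr
        rw [inv_mul_le_iff₀ (by positivity), ← mul_pow]
        gcongr
        nlinarith

end Autocorrelation

section PairSum

lemma exists_normalized_bump (d : ℕ) : ∃ ψ : C_c(Space d, ℝ), (∀ x, 0 ≤ ψ x) ∧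
    ∫⁻ x, ENNReal.ofReal (ψ x) = 1 := by
  obtain ⟨φ, hφ1, -, hφ⟩ := exists_cutoff (isCompact_singleton (x := (0 : Space d))) isOpen_univ
    (Set.subset_univ _)
  have hpos : 0 < ∫ x, φ x := φ.continuous.integral_pos_of_hasCompactSupport_nonneg_nonzero
    φ.hasCompactSupport (fun x => (hφ x).1) (x := 0) (by simp [hφ1 rfl])
  have hψ0 (x : Space d) : 0 ≤ ((∫ x, φ x)⁻¹ • φ) x :=
    mul_nonneg (inv_nonneg.2 hpos.le) (hφ x).1
  refine ⟨(∫ x, φ x)⁻¹ • φ, hψ0, ?_⟩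
  rw [← ofReal_integral_eq_lintegral_ofReal (integrable_compactlySupported volume _)
    (ae_of_all _ hψ0), ← ENNReal.ofReal_one, ← inv_mul_cancel₀ hpos.ne', ← integral_const_mul]
  rfl

lemma continuous_integral_comp (i : Fin m) (f : C_c(Space d, ℝ)) :
    Continuous fun lam : PointMeasure d m => ∫ x, f x ∂(comp i lam) := by
  have hcl : IsClopen (Prod.snd ⁻¹' {i} : Set (ColSpace d m)) :=
    (isClopen_discrete {i}).preimage continuous_snd
  let fi : C_c(ColSpace d m, ℝ) :=
    ⟨⟨(Prod.snd ⁻¹' {i}).indicator fun p => f p.1,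
      (f.continuous.comp continuous_fst).indicator (by simp [hcl.frontier_eq])⟩,
      .intro (f.hasCompactSupport.isCompact.prod isCompact_univ) fun p hp => by
        have hfp : f p.1 = 0 := image_eq_zero_of_notMem_tsupport fun h => hp ⟨h, Set.mem_univ _⟩
        simp [hfp]⟩
  rw [show (fun lam : PointMeasure d m => ∫ x, f x ∂(comp i lam)) = fun lam => ∫ p, fi p ∂lam.1 from
    funext fun lam => integral_comp i lam f.continuous.measurable.stronglyMeasurable]
  exact continuous_integral fi

/-- The sum of `ψ y f (x - y)` over the points `y` of colour `j` and `x` of colour `i`. -/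
def pairSum (i j : Fin m) (f ψ : Space d → ℝ) (lam : PointMeasure d m) : ℝ :=
  ∫ y, ψ y * ∫ x, f x ∂(comp i (-y +ᵥ lam)) ∂(comp j lam)

variable (i j : Fin m)

lemma continuous_pairSum (f ψ : C_c(Space d, ℝ)) :
    Continuous (pairSum i j f ψ : PointMeasure d m → ℝ) := by
  have hf : Continuous fun q : PointMeasure d m × Space d => ∫ x, f x ∂(comp i (-q.2 +ᵥ q.1)) :=
    (continuous_integral_comp i f).comp (f := fun q : PointMeasure d m × Space d => -q.2 +ᵥ q.1)
      (by fun_prop)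
  refine continuous_integral_parametric (continuous_integral_comp j)
    ((ψ.continuous.comp continuous_snd).mul hf) fun _ =>
      ⟨tsupport ψ, ψ.hasCompactSupport, .of_forall fun _ y hy => ?_⟩
  rw [image_eq_zero_of_notMem_tsupport hy, zero_mul]

variable {f ψ : C_c(Space d, ℝ)} (hf : ∀ x, 0 ≤ f x) (hψ : ∀ x, 0 ≤ ψ x)

include hf hψ

lemma pairSum_nonneg (lam : PointMeasure d m) : 0 ≤ pairSum i j f ψ lam :=
  integral_nonneg fun y => mul_nonneg (hψ y) (integral_nonneg hf)

lemma ofReal_pairSum (lam : PointMeasure d m) :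
    ENNReal.ofReal (pairSum i j f ψ lam) = ∫⁻ y, ENNReal.ofReal (ψ y) *
      ∫⁻ x, ENNReal.ofReal (f x) ∂(comp i (-y +ᵥ lam)) ∂(comp j lam) := by
  have hc : Continuous fun y : Space d => ψ y * ∫ x, f x ∂(comp i (-y +ᵥ lam)) :=
    ψ.continuous.mul ((continuous_integral_comp i f).comp
      (f := fun y : Space d => -y +ᵥ lam) (by fun_prop))
  rw [pairSum, ofReal_integral_eq_lintegral_ofReal
    (hc.integrable_of_hasCompactSupport ψ.hasCompactSupport.mul_right)
    (ae_of_all _ fun y => mul_nonneg (hψ y) (integral_nonneg hf))]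
  refine lintegral_congr fun y => ?_
  rw [ENNReal.ofReal_mul (hψ y), ofReal_integral_eq_lintegral_ofReal
    (integrable_compactlySupported _ f) (ae_of_all _ hf)]

/-- The refined Campbell formula turns the mean of a pair sum into a Palm expectation. -/
lemma integral_pairSum {μ : Measure (PointMeasure d m)} [IsProbabilityMeasure μ]
    [VAddInvariantMeasure (Space d) (PointMeasure d m) μ]
    [IsFiniteMeasureOnCompacts (momentMeasure μ j i)] (hc : IsCompact μ.support)
    (hψ1 : ∫⁻ x, ENNReal.ofReal (ψ x) = 1) :
    ∫ lam, pairSum i j f ψ lam ∂μ = ∫ x, f x ∂(momentMeasure μ j i) := by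
  have hF := pairSum_nonneg i j hf hψ
  have hfm : Measurable fun x => ENNReal.ofReal (f x) := f.continuous.measurable.ennreal_ofReal
  have hψm : Measurable fun y => ENNReal.ofReal (ψ y) := ψ.continuous.measurable.ennreal_ofReal
  rw [← ENNReal.ofReal_eq_ofReal_iff (integral_nonneg hF) (integral_nonneg hf),
    ofReal_integral_eq_lintegral_ofReal
      (integrable_of_isCompact_support hc (continuous_pairSum i j f ψ)) (ae_of_all _ hF),
    ofReal_integral_eq_lintegral_ofReal (integrable_compactlySupported _ f) (ae_of_all _ hf),
    lintegral_momentMeasure _ _ hfm]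
  simp only [ofReal_pairSum i j hf hψ]
  rw [lintegral_campbell j (Φ := fun lam => ∫⁻ x, ENNReal.ofReal (f x) ∂(comp i lam))
    (measurable_lintegral_comp i measurable_id (hfm.comp measurable_snd)) hψm, hψ1, one_mul]

lemma setLIntegral_pairSum_orbit (lam : PointMeasure d m) (R : ℝ) :
    ∫⁻ t in cube d R, ENNReal.ofReal (pairSum i j f ψ (t +ᵥ lam)) =
      ∫⁻ y, (∫⁻ t in cube d R, ENNReal.ofReal (ψ (t + y))) *
        ∫⁻ x, ENNReal.ofReal (f (x - y)) ∂(comp i lam) ∂(comp j lam) := by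
  have horbit (t : Space d) : ENNReal.ofReal (pairSum i j f ψ (t +ᵥ lam)) =
      ∫⁻ y, ENNReal.ofReal (ψ (t + y)) *
        ∫⁻ x, ENNReal.ofReal (f (x - y)) ∂(comp i lam) ∂(comp j lam) := by
    rw [ofReal_pairSum i j hf hψ, lintegral_comp_vadd]
    refine lintegral_congr fun y => ?_
    rw [vadd_vadd, neg_add_rev, neg_add_cancel_right, lintegral_comp_vadd]
    simp only [neg_add_eq_sub]
  have hψm : Measurable fun p : Space d × Space d => ENNReal.ofReal (ψ (p.1 + p.2)) := by fun_prop
  have hfm : Measurable fun p : Space d × Space d => ENNReal.ofReal (f (p.2 - p.1)) := by fun_prop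
  have hΦ : Measurable fun y => ∫⁻ x, ENNReal.ofReal (f (x - y)) ∂(comp i lam) :=
    hfm.lintegral_prod_right'
  simp only [horbit]
  rw [lintegral_lintegral_swap (hψm.mul (hΦ.comp measurable_snd)).aemeasurable]
  exact lintegral_congr fun y => lintegral_mul_const _ (hψm.comp measurable_prodMk_right)

end PairSum

section PairAverage

variable (i j : Fin m) {f ψ : C_c(Space d, ℝ)} (hf : ∀ x, 0 ≤ f x)

include hf

lemma ofReal_integral_autocorrMeasure (lam : PointMeasure d m) (R : ℝ) :
    ENNReal.ofReal (∫ z, f z ∂(autocorrMeasure lam i j R)) = ENNReal.ofReal (R ^ d)⁻¹ *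
      ∫⁻ y in cube d R, ∫⁻ x in cube d R, ENNReal.ofReal (f (x - y)) ∂(comp i lam)
        ∂(comp j lam) := by
  have hfm : Measurable fun x => ENNReal.ofReal (f x) := f.continuous.measurable.ennreal_ofReal
  rw [ofReal_integral_eq_lintegral_ofReal (integrable_compactlySupported _ f) (ae_of_all _ hf),
    autocorrMeasure, lintegral_smul_measure, lintegral_map hfm measurable_sub,
    lintegral_prod_symm' _ (by exact hfm.comp measurable_sub), smul_eq_mul]

variable (hψ : ∀ x, 0 ≤ ψ x) (hψ1 : ∫⁻ x, ENNReal.ofReal (ψ x) = 1) {c : ℝ}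
  (hψc : ∀ x ∉ cube d c, ψ x = 0)

include hψ

lemma ofReal_div_mul_cubeAverage_pairSum (lam : PointMeasure d m) {R S : ℝ} (hR : 0 < R)
    (hS : 0 < S) :
    ENNReal.ofReal (S ^ d / R ^ d * cubeAverage d (pairSum i j f ψ) S lam) =
      ENNReal.ofReal (R ^ d)⁻¹ *
        ∫⁻ t in cube d S, ENNReal.ofReal (pairSum i j f ψ (t +ᵥ lam)) := by
  rw [cubeAverage, ← mul_assoc, div_mul_eq_mul_div, mul_inv_cancel₀ (by positivity), one_div,
    ENNReal.ofReal_mul (by positivity), ofReal_integral_eq_lintegral_ofReal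
      (integrableOn_orbit (continuous_pairSum i j f ψ) lam S)
      (ae_of_all _ fun t => pairSum_nonneg i j hf hψ _)]

include hψ1 hψc

lemma setLIntegral_pair_le (lam : PointMeasure d m) (R : ℝ) :
    ∫⁻ y in cube d R, ∫⁻ x in cube d R, ENNReal.ofReal (f (x - y)) ∂(comp i lam) ∂(comp j lam) ≤
      ∫⁻ t in cube d (R + c), ENNReal.ofReal (pairSum i j f ψ (t +ᵥ lam)) := by
  rw [setLIntegral_pairSum_orbit i j hf hψ, ← lintegral_indicator (measurableSet_cube R)]
  refine lintegral_mono fun y => ?_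
  by_cases hy : y ∈ cube d R
  · have hmass : ∫⁻ t in cube d (R + c), ENNReal.ofReal (ψ (t + y)) = 1 := by
      rw [setLIntegral_eq_of_support_subset, lintegral_add_right_eq_self
        (fun x => ENNReal.ofReal (ψ x)), hψ1]
      refine Function.support_subset_iff'.2 fun t ht => ?_
      rw [hψc _ fun hty => ht ?_, ENNReal.ofReal_zero]
      simpa using sub_mem_cube hty hy (add_comm c R).le
    rw [Set.indicator_of_mem hy, hmass, one_mul]
    exact setLIntegral_le_lintegral _ _
  · rw [Set.indicator_of_notMem hy]
    exact zero_le

lemma setLIntegral_pairSum_orbit_le (hc : 0 ≤ c) (hfc : ∀ x ∉ cube d c, f x = 0)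
    (lam : PointMeasure d m) (R : ℝ) :
    ∫⁻ t in cube d R, ENNReal.ofReal (pairSum i j f ψ (t +ᵥ lam)) ≤
      ∫⁻ y in cube d (R + 2 * c), ∫⁻ x in cube d (R + 2 * c), ENNReal.ofReal (f (x - y))
        ∂(comp i lam) ∂(comp j lam) := by
  rw [setLIntegral_pairSum_orbit i j hf hψ, ← lintegral_indicator (measurableSet_cube _)]
  refine lintegral_mono fun y => ?_
  by_cases hy : y ∈ cube d (R + c)
  · have hmass : ∫⁻ t in cube d R, ENNReal.ofReal (ψ (t + y)) ≤ 1 := by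
      refine (setLIntegral_le_lintegral _ _).trans ?_
      rw [lintegral_add_right_eq_self (fun x => ENNReal.ofReal (ψ x)), hψ1]
    rw [Set.indicator_of_mem (cube_mono (by linarith) hy)]
    refine (mul_le_of_le_one_left' hmass).trans_eq ?_
    rw [setLIntegral_eq_of_support_subset]
    refine Function.support_subset_iff'.2 fun x hx => ?_
    rw [hfc _ fun hxy => hx ?_, ENNReal.ofReal_zero]
    simpa using add_mem_cube hy hxy (by linarith)
  · have hmass : ∫⁻ t in cube d R, ENNReal.ofReal (ψ (t + y)) = 0 := by
      refine (setLIntegral_eq_zero_iff (measurableSet_cube R) (by fun_prop)).2 <|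
        ae_of_all _ fun t ht => ?_
      rw [hψc _ fun hty => hy ?_, ENNReal.ofReal_zero]
      simpa using sub_mem_cube hty ht (add_comm c R).le
    rw [hmass, zero_mul]
    exact zero_le

lemma integral_autocorrMeasure_le_cubeAverage_pairSum (hc : 0 ≤ c) (lam : PointMeasure d m)
    {R : ℝ} (hR : 0 < R) :
    ∫ z, f z ∂(autocorrMeasure lam i j R) ≤
      (R + c) ^ d / R ^ d * cubeAverage d (pairSum i j f ψ) (R + c) lam := by
  have hS : 0 < R + c := by linarith
  have hA : 0 ≤ cubeAverage d (pairSum i j f ψ) (R + c) lam := mul_nonneg (by positivity)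
    (integral_nonneg fun t => pairSum_nonneg i j hf hψ _)
  rw [← ENNReal.ofReal_le_ofReal_iff (by positivity), ofReal_integral_autocorrMeasure i j hf,
    ofReal_div_mul_cubeAverage_pairSum i j hf hψ lam hR hS]
  exact mul_le_mul' le_rfl (setLIntegral_pair_le i j hf hψ hψ1 hψc lam R)

lemma cubeAverage_pairSum_le_integral_autocorrMeasure (hc : 0 ≤ c)
    (hfc : ∀ x ∉ cube d c, f x = 0) (lam : PointMeasure d m) {R : ℝ} (hR : 2 * c < R) :
    (R - 2 * c) ^ d / R ^ d * cubeAverage d (pairSum i j f ψ) (R - 2 * c) lam ≤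
      ∫ z, f z ∂(autocorrMeasure lam i j R) := by
  rw [← ENNReal.ofReal_le_ofReal_iff (integral_nonneg hf), ofReal_integral_autocorrMeasure i j hf,
    ofReal_div_mul_cubeAverage_pairSum i j hf hψ lam (by linarith) (by linarith)]
  refine mul_le_mul' le_rfl ?_
  simpa using setLIntegral_pairSum_orbit_le i j hf hψ hψ1 hψc hc hfc lam (R - 2 * c)

end PairAverage

section Generic

variable {μ : Measure (PointMeasure d m)} [IsProbabilityMeasure μ]
  [VAddInvariantMeasure (Space d) (PointMeasure d m) μ] {lam : PointMeasure d m}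

lemma IsGeneric.tendsto_autocorrMeasure_of_nonneg (h : IsGeneric d μ lam)
    (hc : IsCompact μ.support) (i j : Fin m) [IsFiniteMeasureOnCompacts (momentMeasure μ j i)]
    {f : C_c(Space d, ℝ)} (hf : ∀ x, 0 ≤ f x) :
    Tendsto (fun R => ∫ x, f x ∂(autocorrMeasure lam i j R)) atTop
      (𝓝 (∫ x, f x ∂(momentMeasure μ j i))) := by
  obtain ⟨ψ, hψ, hψ1⟩ := exists_normalized_bump d
  obtain ⟨c, hc0, hsub⟩ := exists_subset_cube (f.hasCompactSupport.isCompact.isBounded.union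
    ψ.hasCompactSupport.isCompact.isBounded)
  have hfc : ∀ x ∉ cube d c, f x = 0 := fun x hx =>
    image_eq_zero_of_notMem_tsupport fun h => hx (hsub (.inl h))
  have hψc : ∀ x ∉ cube d c, ψ x = 0 := fun x hx =>
    image_eq_zero_of_notMem_tsupport fun h => hx (hsub (.inr h))
  have hshift (b : ℝ) : Tendsto (fun R => (R + b) ^ d / R ^ d *
      cubeAverage d (pairSum i j f ψ) (R + b) lam) atTop
      (𝓝 (∫ x, f x ∂(momentMeasure μ j i))) := by
    have hA := h.2 ⟨pairSum i j f ψ, continuous_pairSum i j f ψ⟩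
    rw [ContinuousMap.coe_mk, integral_pairSum i j hf hψ hc hψ1] at hA
    simpa using (tendsto_add_pow_div_pow d b).mul
      (hA.comp (tendsto_atTop_add_const_right _ b tendsto_id))
  refine tendsto_of_tendsto_of_tendsto_of_le_of_le' (hshift (-(2 * c))) (hshift c) ?_ ?_
  · filter_upwards [eventually_gt_atTop (2 * c)] with R hR
    exact cubeAverage_pairSum_le_integral_autocorrMeasure i j hf hψ hψ1 hψc hc0.le hfc lam hR
  · filter_upwards [eventually_gt_atTop 0] with R hR
    exact integral_autocorrMeasure_le_cubeAverage_pairSum i j hf hψ hψ1 hψc hc0.le lam hR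

theorem IsGeneric.tendsto_autocorrMeasure (h : IsGeneric d μ lam) (hc : IsCompact μ.support)
    (i j : Fin m) [IsFiniteMeasureOnCompacts (momentMeasure μ j i)] (f : C_c(Space d, ℝ)) :
    Tendsto (fun R => ∫ x, f x ∂(autocorrMeasure lam i j R)) atTop
      (𝓝 (∫ x, f x ∂(momentMeasure μ j i))) :=
  tendsto_integral_of_nonneg (fun _ hf => h.tendsto_autocorrMeasure_of_nonneg hc i j hf) f

theorem IsGeneric.hasAutocorrelation (h : IsGeneric d μ lam) (hc : IsCompact μ.support)
    [∀ i j, IsFiniteMeasureOnCompacts (momentMeasure μ i j)] (w : Fin m → ℝ) :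
    HasAutocorrelation w lam (weightedMoment μ w) := by
  intro f
  obtain ⟨C, hC⟩ := f.hasCompactSupport.exists_bound_of_continuous f.continuous
  rw [weightedMoment_eq_sum w fun i j => integrable_compactlySupported _ f, Finset.sum_comm]
  have hlim : Tendsto (fun R => ∑ i, ∑ j, (w i : ℂ) * (w j : ℂ) *
      ∫ z, f z ∂(autocorrMeasure lam i j R)) atTop
      (𝓝 (∑ i, ∑ j, (w j : ℂ) * (w i : ℂ) * ∫ x, f x ∂(momentMeasure μ j i))) := by
    refine tendsto_finsetSum _ fun i _ => tendsto_finsetSum _ fun j _ => ?_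
    rw [mul_comm (w j : ℂ)]
    exact (tendsto_integral_complex (h.tendsto_autocorrMeasure hc i j) f).const_mul _
  refine hlim.congr' ?_
  filter_upwards [eventually_ge_atTop 0] with R hR
  exact (autocorrelationAt_eq_sum w lam hR f.continuous.measurable hC).symm

end Generic

section QuadraticForm

open ComplexConjugate

variable {U E : Type*} [MeasurableSpace U] [MeasurableSpace E] {τ : Measure U} {ρ : U → ℂ}

lemma integrable_mul_mul_conj (hρ : Integrable ρ τ) {G : U → E → ℂ}
    (hG : Measurable (Function.uncurry G)) {M : ℝ} (hM : ∀ u x, ‖G u x‖ ≤ M)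
    (ν ν' : Measure E) [IsFiniteMeasure ν] [IsFiniteMeasure ν'] :
    Integrable (fun q : U × E × E => ρ q.1 * (G q.1 q.2.1 * conj (G q.1 q.2.2)))
      (τ.prod (ν.prod ν')) := by
  have hfst : Measurable fun q : U × E × E => G q.1 q.2.1 :=
    hG.comp (measurable_fst.prodMk measurable_snd.fst)
  have hsnd : Measurable fun q : U × E × E => conj (G q.1 q.2.2) :=
    Complex.continuous_conj.measurable.comp (hG.comp (measurable_fst.prodMk measurable_snd.snd))
  refine (hρ.comp_fst (ν.prod ν')).mul_bdd (c := M * M) (hfst.mul hsnd).aestronglyMeasurable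
    (ae_of_all _ fun q => ?_)
  rw [norm_mul, RCLike.norm_conj]
  exact mul_le_mul (hM _ _) (hM _ _) (norm_nonneg _) ((norm_nonneg _).trans (hM q.1 q.2.1))

variable [SFinite τ]

theorem integral_mul_normSq_sum (hρ : Integrable ρ τ) {G : U → E → ℂ}
    (hG : Measurable (Function.uncurry G)) {M : ℝ} (hM : ∀ u x, ‖G u x‖ ≤ M)
    (ν : Fin m → Measure E) [∀ i, IsFiniteMeasure (ν i)] (w : Fin m → ℝ) :
    ∫ u, ρ u * (Complex.normSq (∑ i, (w i : ℂ) * ∫ x, G u x ∂(ν i)) : ℂ) ∂τ =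
      ∑ i, ∑ j, (w i : ℂ) * (w j : ℂ) *
        ∫ p, ∫ u, ρ u * (G u p.1 * conj (G u p.2)) ∂τ ∂((ν i).prod (ν j)) := by
  have hprod (i j) := integrable_mul_mul_conj hρ hG hM (ν i) (ν j)
  have hexp (u : U) : ρ u * (Complex.normSq (∑ i, (w i : ℂ) * ∫ x, G u x ∂(ν i)) : ℂ) =
      ∑ i, ∑ j, (w i : ℂ) * (w j : ℂ) *
        ∫ p, ρ u * (G u p.1 * conj (G u p.2)) ∂((ν i).prod (ν j)) := by
    rw [← Complex.mul_conj, map_sum, Finset.sum_mul_sum, Finset.mul_sum]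
    refine Finset.sum_congr rfl fun i _ => ?_
    rw [Finset.mul_sum]
    refine Finset.sum_congr rfl fun j _ => ?_
    rw [integral_const_mul, integral_prod_mul (G u) (fun y => conj (G u y)), integral_conj, map_mul,
      Complex.conj_ofReal]
    ring
  have hint (i j) : Integrable (fun u => (w i : ℂ) * (w j : ℂ) *
      ∫ p, ρ u * (G u p.1 * conj (G u p.2)) ∂((ν i).prod (ν j))) τ :=
    (hprod i j).integral_prod_left.const_mul _
  simp only [hexp]
  rw [integral_finsetSum _ fun i _ => integrable_finsetSum _ fun j _ => hint i j]
  refine Finset.sum_congr rfl fun i _ => ?_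
  rw [integral_finsetSum _ fun j _ => hint i j]
  refine Finset.sum_congr rfl fun j _ => ?_
  rw [integral_const_mul, integral_integral_swap (hprod i j)]

theorem sum_integral_autocorrMeasure_eq (hρ : Integrable ρ τ) {G : U → Space d → ℂ}
    (hG : Measurable (Function.uncurry G)) {M : ℝ} (hM : ∀ u x, ‖G u x‖ ≤ M) (w : Fin m → ℝ)
    (lam : PointMeasure d m) {R : ℝ} (hR : 0 ≤ R) {H : Space d → ℂ} (hH : Measurable H)
    (h : ∀ x ∈ cube d R, ∀ y ∈ cube d R, ∫ u, ρ u * (G u x * conj (G u y)) ∂τ = H (x - y)) :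
    ∑ i, ∑ j, (w i : ℂ) * (w j : ℂ) * ∫ z, H z ∂(autocorrMeasure lam i j R) =
      ((R ^ d)⁻¹ : ℝ) * ∫ u, ρ u *
        (Complex.normSq (∑ i, (w i : ℂ) * ∫ x in cube d R, G u x ∂(comp i lam)) : ℂ) ∂τ := by
  rw [integral_mul_normSq_sum hρ hG hM (fun i => (comp i lam).restrict (cube d R)) w,
    Finset.mul_sum]
  refine Finset.sum_congr rfl fun i _ => ?_
  rw [Finset.mul_sum]
  refine Finset.sum_congr rfl fun j _ => ?_
  rw [integral_autocorrMeasure lam i j hR hH, Measure.prod_restrict,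
    setIntegral_congr_fun ((measurableSet_cube R).prod (measurableSet_cube R))
      fun p hp => (h p.1 hp.1 p.2 hp.2).symm]
  ring

end QuadraticForm

section PositiveDefinite

open ComplexConjugate

lemma integral_mul_conj_sub_eq_convolution (g : Space d → ℂ) :
    (fun x => ∫ y, g y * conj (g (y - x))) =
      convolution g (fun x => conj (g (-x))) (ContinuousLinearMap.mul ℝ ℂ) := by
  ext x
  simp only [convolution, ContinuousLinearMap.mul_apply', neg_sub]

/-- The convolution `g * g̃` of positive definiteness, written out as in `IsPositiveDefinite`. -/
def selfConvolution (g : C_c(Space d, ℂ)) : C_c(Space d, ℂ) where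
  toFun x := ∫ y, g y * conj (g (y - x))
  continuous_toFun := by
    rw [integral_mul_conj_sub_eq_convolution]
    have hconj : Continuous fun x => conj (g (-x)) :=
      Complex.continuous_conj.comp (g.continuous.comp continuous_neg)
    exact g.hasCompactSupport.continuous_convolution_left _ g.continuous hconj.locallyIntegrable
  hasCompactSupport' := by
    rw [integral_mul_conj_sub_eq_convolution]
    have hconj : HasCompactSupport fun x => conj (g (-x)) :=
      (g.hasCompactSupport.comp_homeomorph (Homeomorph.neg (Space d))).comp_left
        (g := conj) (map_zero conj)
    exact g.hasCompactSupport.convolution _ hconj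

/-- The translates `u` that move a point of `C_R` into the support of `g` lie in `C_{c + R}`, so
that the integral may be restricted to a set of finite volume. -/
lemma setIntegral_mul_conj_eq_selfConvolution {g : C_c(Space d, ℂ)} {c R : ℝ}
    (hgc : tsupport g ⊆ cube d c) {x : Space d} (hx : x ∈ cube d R) (y : Space d) :
    ∫ u in cube d (c + R), g (u + x) * conj (g (u + y)) = selfConvolution g (x - y) := by
  have hzero (u : Space d) (hu : u ∉ cube d (c + R)) : g (u + x) * conj (g (u + y)) = 0 := by
    have hgu : g (u + x) = 0 := image_eq_zero_of_notMem_tsupport fun h => hu <| by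
      simpa using sub_mem_cube (hgc h) hx le_rfl
    rw [hgu, zero_mul]
  have hsub (u : Space d) : u + y = u + x - (x - y) := by abel
  rw [setIntegral_eq_integral_of_forall_compl_eq_zero hzero]
  simp only [hsub]
  exact integral_add_right_eq_self (fun v => g v * conj (g (v - (x - y)))) x

lemma exists_autocorrelationAt_selfConvolution_eq (w : Fin m → ℝ) (lam : PointMeasure d m)
    (g : C_c(Space d, ℂ)) {R : ℝ} (hR : 0 ≤ R) : ∃ c : ℝ, 0 ≤ c ∧
      autocorrelationAt w lam R (selfConvolution g) = (c : ℂ) := by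
  obtain ⟨C, hC⟩ := (selfConvolution g).hasCompactSupport.exists_bound_of_continuous
    (selfConvolution g).continuous
  obtain ⟨M, hM⟩ := g.hasCompactSupport.exists_bound_of_continuous g.continuous
  obtain ⟨c, -, hgc⟩ := exists_subset_cube g.hasCompactSupport.isCompact.isBounded
  have : IsFiniteMeasure (volume.restrict (cube d (c + R))) :=
    isFiniteMeasure_restrict.2 (volume_cube_ne_top _)
  have hG : Continuous fun p : Space d × Space d => g (p.1 + p.2) := by fun_prop
  have hm : Measurable (selfConvolution g) := (selfConvolution g).continuous.measurable
  refine ⟨(R ^ d)⁻¹ * ∫ u in cube d (c + R), Complex.normSq (∑ i, (w i : ℂ) *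
    ∫ x in cube d R, g (u + x) ∂(comp i lam)), mul_nonneg (by positivity)
    (integral_nonneg fun u => Complex.normSq_nonneg _), ?_⟩
  rw [autocorrelationAt_eq_sum w lam hR hm hC,
    sum_integral_autocorrMeasure_eq (τ := volume.restrict (cube d (c + R))) (ρ := fun _ => 1)
      (G := fun u x => g (u + x)) (integrable_const 1) hG.measurable (fun u x => hM (u + x)) w lam
      hR hm fun x hx y _ => by
        simpa only [one_mul] using setIntegral_mul_conj_eq_selfConvolution hgc hx y]
  simp only [one_mul, integral_complex_ofReal, Complex.ofReal_mul]

theorem HasAutocorrelation.isPositiveDefinite {w : Fin m → ℝ} {lam : PointMeasure d m}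
    {γ : (Space d → ℂ) → ℂ} (h : HasAutocorrelation w lam γ) : IsPositiveDefinite γ := by
  intro g
  have hcl : IsClosed ((fun c : ℝ => (c : ℂ)) '' Set.Ici 0) :=
    Complex.isometry_ofReal.isClosedEmbedding.isClosedMap _ isClosed_Ici
  have hmem : ∀ᶠ R in atTop, autocorrelationAt w lam R (selfConvolution g) ∈
      (fun c : ℝ => (c : ℂ)) '' Set.Ici 0 := by
    filter_upwards [eventually_ge_atTop 0] with R hR
    obtain ⟨c, hc, hRc⟩ := exists_autocorrelationAt_selfConvolution_eq w lam g hR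
    exact ⟨c, hc, hRc.symm⟩
  obtain ⟨c, hc, hγ⟩ := hcl.mem_of_tendsto (h (selfConvolution g)) hmem
  exact ⟨c, hc, hγ.symm⟩

end PositiveDefinite

section Radon

theorem isRadonMeasure_weightedMoment {μ : Measure (PointMeasure d m)} (w : Fin m → ℝ)
    [∀ i j, IsFiniteMeasureOnCompacts (momentMeasure μ i j)] :
    IsRadonMeasure (weightedMoment μ w) where
  map_add f g := by
    have hf (i j) := integrable_compactlySupported (momentMeasure μ i j) f
    have hg (i j) := integrable_compactlySupported (momentMeasure μ i j) g
    rw [weightedMoment_eq_sum w hf, weightedMoment_eq_sum w hg,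
      weightedMoment_eq_sum w (f := fun x => f x + g x) fun i j => (hf i j).add (hg i j)]
    simp only [← Finset.sum_add_distrib, ← mul_add]
    refine Finset.sum_congr rfl fun i _ => Finset.sum_congr rfl fun j _ => ?_
    rw [← integral_add (hf i j) (hg i j)]
  map_smul c f := by
    have hf (i j) := integrable_compactlySupported (momentMeasure μ i j) f
    rw [weightedMoment_eq_sum w hf, weightedMoment_eq_sum w fun i j => (hf i j).const_mul c]
    simp only [Finset.mul_sum, integral_const_mul]
    exact Finset.sum_congr rfl fun i _ => Finset.sum_congr rfl fun j _ => by ring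
  bounded K hK := by
    refine ⟨∑ i, ∑ j, |w i| * |w j| * (momentMeasure μ i j).real K, fun f hfK M hM => ?_⟩
    have hbound (i j) : ‖∫ x, f x ∂(momentMeasure μ i j)‖ ≤ M * (momentMeasure μ i j).real K := by
      rw [← setIntegral_eq_integral_of_forall_compl_eq_zero (s := K) fun x hx =>
        image_eq_zero_of_notMem_tsupport fun h => hx (hfK h)]
      exact norm_setIntegral_le_of_norm_le_const hK.measure_lt_top fun x _ => hM x
    rw [weightedMoment_eq_sum w fun i j => integrable_compactlySupported _ f, Finset.sum_mul]
    refine norm_sum_le_of_le _ fun i _ => ?_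
    rw [Finset.sum_mul]
    refine norm_sum_le_of_le _ fun j _ => ?_
    rw [norm_mul, norm_mul, Complex.norm_real, Complex.norm_real, Real.norm_eq_abs,
      Real.norm_eq_abs, mul_assoc _ _ M, mul_comm _ M]
    gcongr
    exact hbound i j

end Radon

section Diffraction

open ComplexConjugate

/-- The exponential sum `∑_{x ∈ C_R} λ^w({x}) e^{-2πi k·x}`. -/
def exponentialSum (w : Fin m → ℝ) (lam : PointMeasure d m) (R : ℝ) (k : Space d) : ℂ :=
  ∑ i, (w i : ℂ) * ∫ x in cube d R, (Real.fourierChar (-inner ℝ k x) : ℂ) ∂(comp i lam)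

/-- The density of the diffraction of `λ^w|_{C_R}`. Lebesgue measure of `C_R` is written `R ^ d`. -/
def diffractionDensity (w : Fin m → ℝ) (lam : PointMeasure d m) (R : ℝ) (k : Space d) : ℝ :=
  (R ^ d)⁻¹ * Complex.normSq (exponentialSum w lam R k)

/-- The diffraction measure of `λ^w|_{C_R}`, the Fourier transform of its autocorrelation. -/
def diffractionAt (w : Fin m → ℝ) (lam : PointMeasure d m) (R : ℝ) : Measure (Space d) :=
  volume.withDensity fun k => ENNReal.ofReal (diffractionDensity w lam R k)

variable (w : Fin m → ℝ)

lemma continuous_exponentialSum (lam : PointMeasure d m) (R : ℝ) :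
    Continuous (exponentialSum w lam R) := by
  have hchar (k : Space d) : Continuous fun x : Space d => (Real.fourierChar (-inner ℝ k x) : ℂ) :=
    by fun_prop
  refine continuous_finsetSum _ fun i _ => continuous_const.mul <|
    continuous_of_dominated (bound := fun _ => 1) (fun k => (hchar k).aestronglyMeasurable)
      (fun k => ae_of_all _ fun x => (Circle.norm_coe _).le) (integrable_const _)
      (ae_of_all _ fun x => by fun_prop)

lemma continuous_diffractionDensity (lam : PointMeasure d m) (R : ℝ) :
    Continuous (diffractionDensity w lam R) :=
  continuous_const.mul (Complex.continuous_normSq.comp (continuous_exponentialSum w lam R))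

instance (lam : PointMeasure d m) (R : ℝ) : IsLocallyFiniteMeasure (diffractionAt w lam R) :=
  IsLocallyFiniteMeasure.withDensity_ofReal (continuous_diffractionDensity w lam R)

lemma integral_mul_fourierChar_mul_conj (f : Space d → ℂ) (x y : Space d) :
    ∫ k, f k * ((Real.fourierChar (-inner ℝ k x) : ℂ) *
      conj (Real.fourierChar (-inner ℝ k y) : ℂ)) = 𝓕 f (x - y) := by
  rw [Real.fourier_eq]
  refine integral_congr_ae (ae_of_all _ fun k => ?_)
  simp only
  rw [Circle.smul_def, smul_eq_mul, mul_comm, ← Circle.coe_inv_eq_conj, ← Circle.coe_mul,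
    ← AddChar.map_neg_eq_inv, ← AddChar.map_add_eq_mul, inner_sub_right]
  congr 3
  ring

theorem integral_diffractionAt (lam : PointMeasure d m) {R : ℝ} (hR : 0 ≤ R) {f : Space d → ℂ}
    (hf : Integrable f) :
    ∫ k, f k ∂(diffractionAt w lam R) =
      ∑ i, ∑ j, (w i : ℂ) * (w j : ℂ) * ∫ z, 𝓕 f z ∂(autocorrMeasure lam i j R) := by
  have hG : Continuous fun p : Space d × Space d => (Real.fourierChar (-inner ℝ p.1 p.2) : ℂ) := by
    fun_prop
  have hfour : Continuous (𝓕 f) := VectorFourier.fourierIntegral_continuous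
    Real.continuous_fourierChar (by exact continuous_inner) hf
  have h0 (k : Space d) : 0 ≤ diffractionDensity w lam R k :=
    mul_nonneg (by positivity) (Complex.normSq_nonneg _)
  rw [sum_integral_autocorrMeasure_eq hf hG.measurable (fun k x => (Circle.norm_coe _).le) w lam hR
      hfour.measurable fun x _ y _ => integral_mul_fourierChar_mul_conj f x y,
    diffractionAt, integral_withDensity_eq_integral_toReal_smul
      (continuous_diffractionDensity w lam R).measurable.ennreal_ofReal
      (ae_of_all _ fun _ => ENNReal.ofReal_lt_top), ← integral_const_mul]
  refine integral_congr_ae (ae_of_all _ fun k => ?_)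
  simp only [ENNReal.toReal_ofReal (h0 k)]
  rw [diffractionDensity, exponentialSum, Complex.real_smul, Complex.ofReal_mul]
  ring

lemma norm_fourier_comp_add_right (f : Space d → ℂ) (v z : Space d) :
    ‖𝓕 (fun x => f (x + v)) z‖ = ‖𝓕 f z‖ := by
  have h := congrFun (VectorFourier.fourierIntegral_comp_add_right Real.fourierChar volume
    (innerₗ (Space d)) f v) z
  exact (congrArg norm h).trans (Circle.norm_smul _ _)

end Diffraction

section DiffractionBound

variable {r : ℝ} (hr : 0 < r) (w : Fin m → ℝ)

include hr

lemma exists_norm_integral_diffractionAt_le (h : 𝓢(Space d, ℂ)) : ∃ B : ℝ,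
    ∀ lam ∈ uniformlyDiscrete d m r, ∀ R, 1 ≤ R → ∀ t,
      ‖∫ x, h (x + t) ∂(diffractionAt w lam R)‖ ≤ B := by
  obtain ⟨N, hN, hb⟩ := exists_autocorrMeasure_image_add_le (d := d) (m := m) hr
  obtain ⟨D, hD⟩ := exists_integral_decay_le (d := d) hr hN
  obtain ⟨C, hC0, hC⟩ := exists_norm_le_mul_decay (𝓕 h)
  rw [SchwartzMap.fourier_coe] at hC
  refine ⟨∑ i, ∑ j, |w i| * |w j| * (C * D), fun lam hlam R hR t => ?_⟩
  have hbound (i j : Fin m) :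
      ‖∫ z, 𝓕 (fun x => h (x + t)) z ∂(autocorrMeasure lam i j R)‖ ≤ C * D := by
    obtain ⟨hdecay, hle⟩ := hD _ (hb lam hlam i j R hR)
    calc ‖∫ z, 𝓕 (fun x => h (x + t)) z ∂(autocorrMeasure lam i j R)‖
        ≤ ∫ z, C * decay z ∂(autocorrMeasure lam i j R) :=
          norm_integral_le_of_norm_le (hdecay.const_mul C) <| ae_of_all _ fun z =>
            (norm_fourier_comp_add_right h t z).trans_le (hC z)
      _ ≤ C * D := by
          rw [integral_const_mul]
          gcongr
  rw [integral_diffractionAt w lam (by linarith) (h.integrable.comp_add_right t)]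
  refine norm_sum_le_of_le _ fun i _ => norm_sum_le_of_le _ fun j _ => ?_
  rw [norm_mul, norm_mul, Complex.norm_real, Complex.norm_real, Real.norm_eq_abs, Real.norm_eq_abs]
  gcongr
  exact hbound i j

lemma exists_diffractionAt_image_add_le : ∃ N : ℝ≥0∞, N < ∞ ∧
    ∀ lam ∈ uniformlyDiscrete d m r, ∀ R, 1 ≤ R → ∀ t,
      diffractionAt w lam R ((fun x => t + x) '' cube d 1) ≤ N := by
  obtain ⟨ρ, hρ, hcube⟩ := exists_norm_le_of_mem_cube (d := d) 1
  let b : ContDiffBump (0 : Space d) := ⟨ρ, ρ + 1, hρ, by linarith⟩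
  have hb : HasCompactSupport fun x => (b x : ℂ) :=
    b.hasCompactSupport.comp_left (g := fun y : ℝ => (y : ℂ)) Complex.ofReal_zero
  obtain ⟨B, hB⟩ := exists_norm_integral_diffractionAt_le hr w
    (hb.toSchwartzMap (Complex.ofRealCLM.contDiff.comp b.contDiff))
  refine ⟨ENNReal.ofReal B, ENNReal.ofReal_lt_top, fun lam hlam R hR t => ?_⟩
  let ψ : C_c(Space d, ℝ) := ⟨⟨fun x => b (x + -t), b.continuous.comp (continuous_add_const (-t))⟩,
    b.hasCompactSupport.comp_homeomorph (Homeomorph.addRight (-t))⟩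
  have hsub : (fun x => t + x) '' cube d 1 ⊆ Metric.closedBall t ρ := by
    rintro _ ⟨x, hx, rfl⟩
    simpa using hcube x hx
  have hψ1 : Set.EqOn ψ 1 (Metric.closedBall t ρ) := fun x hx => b.one_of_mem_closedBall <| by
    simpa [dist_eq_norm, sub_eq_add_neg] using hx
  calc diffractionAt w lam R ((fun x => t + x) '' cube d 1)
      ≤ diffractionAt w lam R (Metric.closedBall t ρ) := measure_mono hsub
    _ ≤ ENNReal.ofReal (∫ x, b (x + -t) ∂(diffractionAt w lam R)) :=
        measure_le_ofReal_integral _ (ψ := ψ) (fun x => ⟨b.nonneg, b.le_one⟩)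
          (isCompact_closedBall t ρ) hψ1
    _ ≤ ENNReal.ofReal B := by
        refine ENNReal.ofReal_le_ofReal ((le_abs_self _).trans ?_)
        have hBt : ‖∫ x, (b (x + -t) : ℂ) ∂(diffractionAt w lam R)‖ ≤ B := hB lam hlam R hR (-t)
        rwa [integral_complex_ofReal, Complex.norm_real, Real.norm_eq_abs] at hBt

end DiffractionBound

section DiffractionLimit

lemma exists_vague_limit_of_image_add_le {ι : Type*} (U : Ultrafilter ι)
    (ν : ι → Measure (Space d)) [∀ i, IsFiniteMeasureOnCompacts (ν i)] {r : ℝ} (hr : 0 < r)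
    {N : ℝ≥0∞} (hN : N < ∞)
    (hν : ∀ᶠ i in (U : Filter ι), ∀ t, ν i ((fun x => t + x) '' cube d r) ≤ N) :
    ∃ σ : Measure (Space d), σ.Regular ∧ (∀ t, σ ((fun x => t + x) '' cube d r) ≤ N) ∧
      ∀ f : C_c(Space d, ℝ), Tendsto (fun i => ∫ x, f x ∂(ν i)) U (𝓝 (∫ x, f x ∂σ)) := by
  obtain ⟨σ, hσ, hlim⟩ := exists_vague_limit U ν fun f => by
    obtain ⟨D, hD, hb⟩ := exists_measure_image_add_le hr f.hasCompactSupport.isCompact.isBounded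
    obtain ⟨C, hC⟩ := f.hasCompactSupport.exists_bound_of_continuous f.continuous
    have hND : N * D < ∞ := ENNReal.mul_lt_top hN hD
    have : 0 ≤ C := (norm_nonneg _).trans (hC 0)
    refine ⟨C * (N * D).toReal, hν.mono fun i hi => ?_⟩
    have hsupp : ν i (tsupport f) ≤ N * D := by simpa using hb (ν i) N hi 0
    calc |∫ x, f x ∂(ν i)| = ‖∫ x in tsupport f, f x ∂(ν i)‖ := by
          rw [setIntegral_eq_integral_of_forall_compl_eq_zero fun x hx =>
            image_eq_zero_of_notMem_tsupport hx, Real.norm_eq_abs]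
      _ ≤ C * (ν i).real (tsupport f) :=
          norm_setIntegral_le_of_norm_le_const (hsupp.trans_lt hND) fun x _ => hC x
      _ ≤ C * (N * D).toReal := by
          gcongr
          exact ENNReal.toReal_mono hND.ne hsupp
  exact ⟨σ, hσ, fun t => measure_le_of_vague_limit hlim (isOpen_image_add_cube t r)
    (hν.mono fun i hi => hi t), hlim⟩

variable {μ : Measure (PointMeasure d m)} [IsProbabilityMeasure μ]
  [VAddInvariantMeasure (Space d) (PointMeasure d m) μ] {r : ℝ} (hr : 0 < r)
  (hud : μ.support ⊆ uniformlyDiscrete d m r)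
  [∀ i j, SFinite (momentMeasure μ i j)]

include hr hud

lemma integrable_schwartz_momentMeasure (f : 𝓢(Space d, ℂ)) (i j : Fin m) :
    Integrable f (momentMeasure μ i j) := by
  obtain ⟨D, hD⟩ := exists_integral_decay_le hr (palm_univ_lt_top hud hr i)
  obtain ⟨C, -, hC⟩ := exists_norm_le_mul_decay f
  exact ((hD _ (momentMeasure_image_add_cube_le hud i j)).1.const_mul C).mono'
    f.continuous.aestronglyMeasurable (ae_of_all _ hC)

variable [∀ i j, IsFiniteMeasureOnCompacts (momentMeasure μ i j)]

lemma IsGeneric.tendsto_integral_schwartz_autocorrMeasure {lam : PointMeasure d m}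
    (h : IsGeneric d μ lam) (hc : IsCompact μ.support) (i j : Fin m) (f : 𝓢(Space d, ℂ)) :
    Tendsto (fun R => ∫ z, f z ∂(autocorrMeasure lam i j R)) atTop
      (𝓝 (∫ z, f z ∂(momentMeasure μ j i))) := by
  obtain ⟨N, hN, hb⟩ := exists_autocorrMeasure_image_add_le (d := d) (m := m) hr
  refine tendsto_integral_of_isLittleO_decay hr (max_lt hN (palm_univ_lt_top hud hr j)) ?_
    (fun t => (momentMeasure_image_add_cube_le hud j i t).trans (le_max_right _ _))
    (h.tendsto_autocorrMeasure hc i j) f.continuous (isLittleO_decay f)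
  filter_upwards [eventually_ge_atTop 1] with R hR t
  exact (hb lam (hud h.1) i j R hR t).trans (le_max_left _ _)

/-- The transform is any vague limit point of the finite volume diffraction measures of a generic
configuration. -/
theorem IsGeneric.exists_isMomentFourierTransform {lam : PointMeasure d m}
    (h : IsGeneric d μ lam) (hc : IsCompact μ.support) (w : Fin m → ℝ) :
    ∃ σ, IsMomentFourierTransform μ w σ ∧ IsTranslationBounded σ := by
  obtain ⟨N, hN, hb⟩ := exists_diffractionAt_image_add_le hr w
  let U : Ultrafilter ℝ := Ultrafilter.of atTop
  have hU : (U : Filter ℝ) ≤ atTop := Ultrafilter.of_le _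
  have hbU : ∀ᶠ R in (U : Filter ℝ), ∀ t,
      diffractionAt w lam R ((fun x => t + x) '' cube d 1) ≤ N :=
    hU ((eventually_ge_atTop 1).mono fun R hR => hb lam (hud h.1) R hR)
  obtain ⟨σ, hσ, hσN, hlim⟩ :=
    exists_vague_limit_of_image_add_le U (diffractionAt w lam) one_pos hN hbU
  obtain ⟨D, hD⟩ := exists_integral_decay_le (d := d) one_pos hN
  refine ⟨σ, fun f => ?_, isTranslationBounded_of_cube one_pos hN hσN⟩
  obtain ⟨C, -, hC⟩ := exists_norm_le_mul_decay f
  have hint := integrable_schwartz_momentMeasure hr hud (𝓕 f)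
  have hA (i j) := h.tendsto_integral_schwartz_autocorrMeasure hr hud hc i j (𝓕 f)
  have hcont := (𝓕 f).continuous
  rw [SchwartzMap.fourier_coe] at hint hA hcont
  refine ⟨momentIntegrable_of_integrable hcont.measurable hint,
    ((hD σ hσN).1.const_mul C).mono' f.continuous.aestronglyMeasurable (ae_of_all _ hC), ?_⟩
  have hdiff : Tendsto (fun R => ∫ x, f x ∂(diffractionAt w lam R)) atTop
      (𝓝 (weightedMoment μ w (𝓕 (f : Space d → ℂ)))) := by
    rw [weightedMoment_eq_sum w hint, Finset.sum_comm]
    refine Tendsto.congr' ((eventually_ge_atTop 0).mono fun R hR =>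
      (integral_diffractionAt w lam hR f.integrable).symm) ?_
    refine tendsto_finsetSum _ fun i _ => tendsto_finsetSum _ fun j _ => ?_
    rw [mul_comm (w j : ℂ)]
    exact (hA i j).const_mul _
  exact tendsto_nhds_unique (tendsto_integral_of_isLittleO_decay one_pos hN hbU hσN hlim
    f.continuous (isLittleO_decay f)) (hdiff.mono_left hU)

theorem exists_isTranslationBounded_eq_weightedMoment {w : Fin m → ℝ} (hw : ∀ i, 0 ≤ w i) :
    ∃ ν : Measure (Space d), IsTranslationBounded ν ∧ ∀ f : C_c(Space d, ℂ),
      weightedMoment μ w f = ∫ x, f x ∂ν := by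
  let c (i j : Fin m) : ℝ≥0∞ := ENNReal.ofReal (w i * w j)
  refine ⟨Measure.sum fun i => Measure.sum fun j => c i j • momentMeasure μ i j,
    isTranslationBounded_of_cube hr (N := ∑ i, ∑ j, c i j * palm μ i Set.univ) ?_ fun t => ?_,
    fun f => ?_⟩
  · exact ENNReal.sum_lt_top.2 fun i _ => ENNReal.sum_lt_top.2 fun j _ =>
      ENNReal.mul_lt_top ENNReal.ofReal_lt_top (palm_univ_lt_top hud hr i)
  · have hm := (isOpen_image_add_cube t r).measurableSet
    simp only [Measure.sum_apply _ hm, tsum_fintype, Measure.smul_apply, smul_eq_mul]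
    gcongr with i _ j _
    exact momentMeasure_image_add_cube_le hud i j t
  · have hf (i j) : Integrable f (c i j • momentMeasure μ i j) :=
      (integrable_compactlySupported _ f).smul_measure ENNReal.ofReal_ne_top
    simp only [Measure.sum_fintype]
    rw [weightedMoment_eq_sum w fun i j => integrable_compactlySupported _ f,
      integral_finsetSum_measure fun i _ => integrable_finsetSum_measure.2 fun j _ => hf i j]
    refine Finset.sum_congr rfl fun i _ => ?_
    rw [integral_finsetSum_measure fun j _ => hf i j]
    refine Finset.sum_congr rfl fun j _ => ?_
    rw [integral_smul_measure, ENNReal.toReal_ofReal (mul_nonneg (hw i) (hw j)), Complex.real_smul,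
      Complex.ofReal_mul]

end DiffractionLimit

end PointProcess

end

open PointProcess in
theorem theorem5p1_general {d m : ℕ} (μ : Measure (PointMeasure d m)) [IsProbabilityMeasure μ]
    [ErgodicVAdd (Space d) (PointMeasure d m) μ] {r : ℝ} (hr : 0 < r)
    (hud : μ.support ⊆ uniformlyDiscrete d m r) (w : Fin m → ℝ) :
    IsRadonMeasure (weightedMoment μ w) ∧
    IsPositiveDefinite (weightedMoment μ w) ∧
    (∃ σ : Measure (Space d), IsMomentFourierTransform μ w σ ∧ IsTranslationBounded σ) ∧
    (∀ᵐ lam ∂μ, HasAutocorrelation w lam (weightedMoment μ w)) ∧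
    (IsUniquelyErgodic μ → ∀ lam ∈ μ.support, HasAutocorrelation w lam (weightedMoment μ w)) ∧
    ((∀ i, 0 ≤ w i) → ∃ ν : Measure (Space d), IsTranslationBounded ν ∧
      ∀ f : C_c(Space d, ℂ), weightedMoment μ w f = ∫ x, f x ∂ν) := by
  have hc : IsCompact μ.support :=
    (isCompact_uniformlyDiscrete hr).of_isClosed_subset Measure.isClosed_support hud
  have (i : Fin m) : IsFiniteMeasure (palm μ i) := ⟨palm_univ_lt_top hud hr i⟩
  have (i j : Fin m) : IsFiniteMeasureOnCompacts (momentMeasure μ i j) :=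
    isFiniteMeasureOnCompacts_momentMeasure hud hr i j
  have hgeneric : ∀ᵐ lam ∂μ, IsGeneric d μ lam := ae_isGeneric hc
  obtain ⟨lam, hlam⟩ := hgeneric.exists
  exact ⟨isRadonMeasure_weightedMoment w,
    (hlam.hasAutocorrelation hc w).isPositiveDefinite,
    hlam.exists_isMomentFourierTransform hr hud hc w,
    hgeneric.mono fun _ h => h.hasAutocorrelation hc w,
    fun hu _ h => (isGeneric_of_isUniquelyErgodic hc hu h).hasAutocorrelation hc w,
    exists_isTranslationBounded_eq_weightedMoment hr hud⟩

theorem theorem5p1 {d m : ℕ} {Ω : Type*} [MeasurableSpace Ω] (P : Measure Ω)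
    [IsProbabilityMeasure P] (ξ : Ω → PointProcess.PointMeasure d m) (hξ : Measurable ξ)
    (μ : Measure (PointProcess.PointMeasure d m)) (hμ : μ = P.map ξ)
    (hpp : PointProcess.IsUniformlyDiscreteErgodic μ) (w : Fin m → ℝ) :
    PointProcess.IsRadonMeasure (PointProcess.weightedMoment μ w) ∧
    PointProcess.IsPositiveDefinite (PointProcess.weightedMoment μ w) ∧
    (∃ σ : Measure (PointProcess.Space d),
      PointProcess.IsMomentFourierTransform μ w σ ∧ PointProcess.IsTranslationBounded σ) ∧
    (∀ᵐ lam ∂μ, PointProcess.HasAutocorrelation w lam (PointProcess.weightedMoment μ w)) ∧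
    (PointProcess.IsUniquelyErgodic μ → ∀ lam ∈ μ.support,
      PointProcess.HasAutocorrelation w lam (PointProcess.weightedMoment μ w)) ∧
    (m = 1 → (∀ i, w i = 1) → ∃ ν : Measure (PointProcess.Space d),
      PointProcess.IsTranslationBounded ν ∧ ∀ f : C_c(PointProcess.Space d, ℂ),
        PointProcess.weightedMoment μ w f = ∫ x, f x ∂ν) := by
  obtain ⟨⟨r, hr, hud⟩, _, -⟩ := hpp
  have : IsProbabilityMeasure μ := hμ ▸ Measure.isProbabilityMeasure_map hξ.aemeasurable
  obtain ⟨hRadon, hpos, hFourier, hae, huniq, hnonneg⟩ := theorem5p1_general μ hr hud w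
  exact ⟨hRadon, hpos, hFourier, hae, huniq, fun _ hw => hnonneg fun i => by simp [hw]⟩
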